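/- **Data.** Let $d,\tau\in\mathbb N$ with $\tau\ge 1$, let $T>0$, and let $K\subseteq\{1,2,3,\dots\}$ be a finite or infinite set of component numbers ($K=\{1,2,\dots\}$ is allowed). A process $\xi(t)$ with periodically correlated $d$th increments (step $\tau T$, period $T$) generates the vector stationary increment sequence $\vec\xi^{(d)}_j=(\xi^{(d)}_{kj})_{k\in K}$ whose entries are the coefficients of $u\mapsto \xi^{(d)}(u+jT,\tau T)$, $u\in[0,T)$, in the orthonormal basis $\tilde e_k(u)=T^{-1/2}e^{2\pi i(-1)^k[k/2]u/T}$ (components with $k\notin K$ are absent). Put $w(\lambda)=|1-e^{i\lambda\tau}|^{2d}/\lambda^{2d}$. Let $\delta_k$ denote the unit vectors of $\ell_2(K)$ and let $\langle\cdot,\cdot\rangle$ be linear in the first argument. A *spectral density* is a measurable function $f$ on $[-\pi,\pi)$ whose values are a.e. positive trace-class operators on $\ell_2(K)$, with entries $f_{kn}=\langle f\delta_k,\delta_n\rangle$ and with $\int_{-\pi}^{\pi}w\,\mathrm{Tr} f\,d\lambda<\infty$. Let $a$ be a locally integrable function on $[0,\infty)$, $A\xi=\int_0^\infty a(t)\xi(t)dt$,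 $\vec a_j=(\int_0^T a(v+jT)\tilde e_k(v)dv)_{k\in K}$, and $\vec b_j=(D^\tau\mathbf a)_j=\sum_{m\ge j}d_\tau(m-j)\vec a_m$ (the series converging entrywise), where $\sum_k d_\tau(k)x^k=(\sum_j x^{\tau j})^d$. Assume $\vec b_j\in\ell_2(K)$ and $\sum_{j\ge0}(j+1)\|\vec b_j\|<\infty$. Put $\vec B_\tau(e^{i\lambda})=\sum_{j\ge0}\vec b_je^{ij\lambda}$. Let $L_2(f)$ have the squared norm $\frac1{2\pi}\int_{-\pi}^\pi\langle f g,g\rangle d\lambda$, and let $L_2^{0-}(f)$ be the closed span in it of $e^{i\lambda j}(1-e^{-i\lambda\tau})^d(i\lambda)^{-d}\delta_n$, $j\le-1$, $n\in K$. The mean square error of the linear estimate of $A\xi$ from the observations at $t<0$ with spectral characteristic $h$ is $$\Delta(h;f)=\tfrac1{2\pi}\int_{-\pi}^{\pi}\langle f g,g\rangle\,d\lambda,\qquad g=\vec B_\tau(e^{i\lambda})\tfrac{(1-e^{-i\lambda\tau})^d}{(i\lambda)^d}-h,$$ and the error of the optimal estimate is $\Delta(f)=\inf_{h\in L_2^{0-}(f)}\Delta(h;f)$.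 For a class $\mathcal D$ of spectral densities, $f_0\in\mathcal D$ is *least favourable* if $\Delta(f_0)=\max_{f\in\mathcal D}\Delta(f)$, and $h^0\in H_{\mathcal D}=\bigcap_{f\in\mathcal D}L_2^{0-}(f)$ is *minimax-robust* if $\sup_{f\in\mathcal D}\Delta(h^0;f)=\min_{h\in H_{\mathcal D}}\sup_{f\in\mathcal D}\Delta(h;f)$. A density $f$ satisfies the *minimality condition* if $f(\lambda)$ has a bounded inverse for a.e. $\lambda$ and $\int_{-\pi}^\pi \mathrm{Tr}[w^{-1}f^{-1}]d\lambda<\infty$. (For infinite $K$ a trace-class operator has no bounded inverse, so the condition can be met only for finite $K$.) Then $\mathbf F_\tau$ denotes the operator in $\ell_2$ with the block matrix $F_{j,l}=\frac1{2\pi}\int_{-\pi}^{\pi}e^{-i\lambda(j-l)}w^{-1}f^{-1}d\lambda$, i.e. the Toeplitz operator sending $\mathbf c=(\vec c_j)_{j\ge0}$ to the Fourier coefficients with numbers $l\ge0$ of $w^{-1}f^{-1}\vec C$, $\vec C(\lambda)=\sum_j\vec c_je^{ij\lambda}$, on the domain of all $\mathbf c\in\ell_2$ for which this product is integrable. **Classes.**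 For given positive definite bounded operators $P,B_1$ on $\ell_2(K)$ and real numbers $p,p_k$, the following are classes of spectral densities: $$\mathcal D_0^1=\{f:\tfrac1{2\pi}\!\int wf\,d\lambda=P\}\ \text{(entrywise)},\quad \mathcal D_0^2=\{f:\tfrac1{2\pi}\!\int w\,\mathrm{Tr} f\,d\lambda=p\},$$ $$\mathcal D_0^3=\{f:\tfrac1{2\pi}\!\int wf_{kk}\,d\lambda=p_k,\ k\in K\},\quad \mathcal D_0^4=\{f:\tfrac1{2\pi}\!\int w\,\mathrm{Tr}(B_1f)\,d\lambda=p\}.$$ **Theorem.** Let the spectral density $f_0$ satisfy the minimality condition. Then $\mathbf F^0_\tau\mathbf c^0=D^\tau\mathbf a$ (with $\mathbf F^0_\tau$ the operator of $f_0$) has exactly one solution $\mathbf c^0=(\mathbf F^0_\tau)^{-1}D^\tau\mathbf a$. Put $\vec C^0=\sum_{j\ge0}\vec c^{\,0}_je^{ij\lambda}$. For each $k=1,2,3,4$ and $\mathcal D=\mathcal D_0^k$: 1. $f_0$ is least favourable in $\mathcal D$ if and only if $f_0\in\mathcal D$ and the $k$th of the following equations holds for a.e. $\lambda\in[-\pi,\pi)$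 with some constant Lagrange multipliers: - ($k=1$) $\vec C^0(\vec C^0)^*=(wf_0)\,\vec\alpha\vec\alpha^*\,(wf_0)$ with some $\vec\alpha\in\ell_2(K)$; - ($k=2$) $\vec C^0(\vec C^0)^*=\alpha^2(wf_0)^2$ with some real $\alpha$; - ($k=3$) $\vec C^0(\vec C^0)^*=(wf_0)\{\alpha_k^2\delta_{kl}\}(wf_0)$ with some real $\alpha_k$ (the diagonal operator being bounded); - ($k=4$) $\vec C^0(\vec C^0)^*=\alpha^2(wf_0)B_1(wf_0)$ with some real $\alpha$. 2. $f_0$ is least favourable in $\mathcal D$ if and only if it solves the constrained optimization problem: $f_0\in\mathcal D$ and $\langle D^\tau\mathbf a,\mathbf F_\tau^{-1}D^\tau\mathbf a\rangle\le\langle D^\tau\mathbf a,(\mathbf F^0_\tau)^{-1}D^\tau\mathbf a\rangle$ for all $f\in\mathcal D$ that satisfy the minimality condition. 3. If $f_0$ is least favourable in $\mathcal D$, then the minimax-robust spectral characteristic is, uniquely up to a.e. equality, $$h^0(\lambda)=\vec B_\tau(e^{i\lambda})\frac{(1-e^{-i\lambda\tau})^d}{(i\lambda)^d}-\frac{(-i\lambda)^d}{(1-e^{i\lambda\tau})^d}f_0^{-1}(\lambda)\vec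 C^0(\lambda).$$ -/

import Mathlib

open MeasureTheory Set Complex

noncomputable section

/-- Vectors with square-summable components indexed by the set `S` of component numbers `k`. -/
abbrev Vec (S : Set ℕ+) : Type := lp (fun _ : S => ℂ) 2

/-- Bounded operators on `Vec S`. A matrix `{A_{kn}}` of the text is identified with the operator
`A` for which `A_{kn} = ⟨A δ_k, δ_n⟩`. -/
abbrev Op (S : Set ℕ+) : Type := Vec S →L[ℂ] Vec S

/-- The unit vector `δ_k`. -/
def unitVec {S : Set ℕ+} (k : S) : Vec S := lp.single 2 k (1 : ℂ)

/-- The entry `⟨A δ_k, δ_n⟩` (the first argument of the bracket is the linear one). -/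
def entry {S : Set ℕ+} (A : Op S) (k n : S) : ℂ := inner ℂ (unitVec n) (A (unitVec k))

/-- The trace `Σ_k ⟨A δ_k, δ_k⟩`. -/
def opTrace {S : Set ℕ+} (A : Op S) : ℂ := ∑' k : S, entry A k k

/-- The trace of a positive operator, with values in `[0, ∞]`. -/
def posTrace {S : Set ℕ+} (A : Op S) : ENNReal := ∑' k : S, ENNReal.ofReal (entry A k k).re

/-- A positive definite Hermitian operator. -/
def IsPosDef {S : Set ℕ+} (A : Op S) : Prop :=
  A.IsPositive ∧ ∀ v : Vec S, v ≠ 0 → 0 < (inner ℂ v (A v) : ℂ).re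

/-- Lebesgue measure on `[-π, π)`. -/
def circ : Measure ℝ := volume.restrict (Ico (-Real.pi) Real.pi)

/-! ### The functional -/

/-- The basis functions `T^{-1/2} exp (2πi (-1)^k [k/2] u / T)`, `k = 1, 2, …`. -/
def basisFun (T : ℝ) (k : ℕ+) (u : ℝ) : ℂ :=
  (1 / Real.sqrt T : ℝ) *
    exp (2 * Real.pi * I * (((-1 : ℤ) ^ (k : ℕ) * (((k : ℕ) / 2 : ℕ) : ℤ) : ℤ) : ℂ) * u / T)

/-- The `k`-th entry of the vector `a_j` generated by `a`. It is the inner product of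
`a_j(u) = a(u + jT)` with the complex conjugate of the `k`-th basis function, so that
`∫_0^T a_j(u) x(u) du = Σ_k aCoef k j * x_k` for `x = Σ_k x_k basisFun k`. (The conjugate is again
a basis function; this is the reordering `(a_{1j}, a_{3j}, a_{2j}, a_{5j}, a_{4j}, …)`.) -/
def aCoef (T : ℝ) (a : ℝ → ℂ) (k : ℕ+) (j : ℕ) : ℂ :=
  ∫ v in Ico 0 T, a (v + j * T) * basisFun T k v

/-- The coefficients `d_τ(k)` of the power series `(Σ_j x^{τ j})^d`. -/
def stepCoeff (d τ k : ℕ) : ℕ :=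
  PowerSeries.coeff k ((PowerSeries.mk fun j => if τ ∣ j then (1 : ℕ) else 0) ^ d)

/-- The entries of `b_j = (D^τ a)_j = Σ_{m ≥ j} d_τ(m - j) a_m`. -/
def bCoef (d τ : ℕ) (T : ℝ) (a : ℝ → ℂ) (k : ℕ+) (j : ℕ) : ℂ :=
  ∑' i : ℕ, (stepCoeff d τ i : ℂ) * aCoef T a k (j + i)

/-- `B_τ(e^{ix}) = Σ_j b_j e^{ijx}`. -/
def bSymbol {S : Set ℕ+} (b : ℕ → Vec S) (x : ℝ) : Vec S :=
  ∑' j : ℕ, exp (I * j * x) • b j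

/-! ### Spectral densities -/

/-- `|1 - e^{ixτ}|^{2d} / x^{2d}`. -/
def weight (d τ : ℕ) (x : ℝ) : ℝ := ‖1 - exp (I * x * τ)‖ ^ (2 * d) / x ^ (2 * d)

/-- `(1 - e^{-ixτ})^d / (ix)^d`. -/
def incr (d τ : ℕ) (x : ℝ) : ℂ := (1 - exp (-(I * x * τ))) ^ d / (I * x) ^ d

/-- Spectral densities: measurable functions on `[-π, π)` whose values are positive kernel
operators with integrable (weighted) kernel norm. -/
structure IsSpectralDensity {S : Set ℕ+} (d τ : ℕ) (f : ℝ → Op S) : Prop where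
  measurable : ∀ k n : S, AEMeasurable (fun x => entry (f x) k n) circ
  positive : ∀ᵐ x ∂circ, (f x).IsPositive
  kernel : ∫⁻ x, ENNReal.ofReal (weight d τ x) * posTrace (f x) ∂circ < ⊤

/-- The minimality condition
`∫ Tr [x^{2d} |1 - e^{ixτ}|^{-2d} f(x)^{-1}] dx < ∞`. -/
def Minimality {S : Set ℕ+} (d τ : ℕ) (f : ℝ → Op S) : Prop :=
  (∀ᵐ x ∂circ, IsUnit (f x)) ∧
    ∫⁻ x, ENNReal.ofReal (weight d τ x)⁻¹ * posTrace (Ring.inverse (f x)) ∂circ < ⊤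

/-! ### Estimates and their errors -/

/-- The squared norm `(1/2π) ∫ ⟨f(x) g(x), g(x)⟩ dx` of `L_2(f)`. -/
def specNormSq {S : Set ℕ+} (f : ℝ → Op S) (g : ℝ → Vec S) : ENNReal :=
  ENNReal.ofReal (1 / (2 * Real.pi)) *
    ∫⁻ x, ENNReal.ofReal (inner ℂ (g x) (f x (g x)) : ℂ).re ∂circ

/-- The linear span of `e^{ixj} (1 - e^{-ixτ})^d (ix)^{-d} δ_n`, `j ≤ -1`. -/
def pastSpan (S : Set ℕ+) (d τ : ℕ) : Submodule ℂ (ℝ → Vec S) :=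
  Submodule.span ℂ {g | ∃ (j : ℤ) (n : S), j ≤ -1 ∧
    g = fun x : ℝ => (exp (I * x * j) * incr d τ x) • unitVec n}

/-- The space `L_2^{0-}(f)`: the closure of `pastSpan` in `L_2(f)`. -/
def pastSpace {S : Set ℕ+} (d τ : ℕ) (f : ℝ → Op S) : Set (ℝ → Vec S) :=
  {h | AEStronglyMeasurable h circ ∧
    ∀ ε : ENNReal, 0 < ε → ∃ p ∈ pastSpan S d τ, specNormSq f (h - p) < ε}

/-- `Δ(h; f)`: the mean square error of the estimate with spectral characteristic `h` when the
spectral density is `f`. -/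
def mse {S : Set ℕ+} (d τ : ℕ) (b : ℕ → Vec S) (h : ℝ → Vec S) (f : ℝ → Op S) : ENNReal :=
  specNormSq f fun x => incr d τ x • bSymbol b x - h x

/-- `Δ(f)`: the mean square error of the optimal linear estimate. -/
def optMse {S : Set ℕ+} (d τ : ℕ) (b : ℕ → Vec S) (f : ℝ → Op S) : ENNReal :=
  ⨅ h ∈ pastSpace d τ f, mse d τ b h f

/-- `f₀` is least favourable in the class `D`. -/
def IsLeastFavorable {S : Set ℕ+} (d τ : ℕ) (b : ℕ → Vec S) (D : Set (ℝ → Op S))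
    (f₀ : ℝ → Op S) : Prop :=
  f₀ ∈ D ∧ ∀ f ∈ D, optMse d τ b f ≤ optMse d τ b f₀

/-- The set `H_D = ⋂_{f ∈ D} L_2^{0-}(f)`. -/
def robustSpace {S : Set ℕ+} (d τ : ℕ) (D : Set (ℝ → Op S)) : Set (ℝ → Vec S) :=
  ⋂ f ∈ D, pastSpace d τ f

/-- `h₀` is minimax-robust for the class `D`. -/
def IsMinimaxRobust {S : Set ℕ+} (d τ : ℕ) (b : ℕ → Vec S) (D : Set (ℝ → Op S))
    (h₀ : ℝ → Vec S) : Prop :=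
  h₀ ∈ robustSpace d τ D ∧
    ∀ h ∈ robustSpace d τ D, (⨆ f ∈ D, mse d τ b h₀ f) ≤ (⨆ f ∈ D, mse d τ b h f)

/-! ### The operator `F_τ` and the spectral characteristic -/

/-- Fourier coefficients of a vector function on `[-π, π)`. -/
def coef {S : Set ℕ+} (g : ℝ → Vec S) (n : ℤ) : Vec S :=
  (1 / (2 * Real.pi) : ℂ) • ∫ x, exp (-(I * n * x)) • g x ∂circ

/-- `C(x) = Σ_{j ≥ 0} c_j e^{ijx}` with convergence in the mean square; in particular `c` is
square-summable. -/
def IsSymbol {S : Set ℕ+} (c : ℕ → Vec S) (C : ℝ → Vec S) : Prop :=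
  MemLp C 2 circ ∧ (∀ j : ℕ, coef C j = c j) ∧ ∀ n : ℤ, n < 0 → coef C n = 0

/-- `x^{2d} |1 - e^{ixτ}|^{-2d} f(x)^{-1}`. -/
def invDensity {S : Set ℕ+} (d τ : ℕ) (f : ℝ → Op S) (x : ℝ) : Op S :=
  ((weight d τ x)⁻¹ : ℂ) • Ring.inverse (f x)

/-- The Fourier coefficients `F_{j,l}` of `invDensity`. -/
def fBlock {S : Set ℕ+} (d τ : ℕ) (f : ℝ → Op S) (j l : ℕ) : Op S :=
  (1 / (2 * Real.pi) : ℂ) • ∫ x, exp (-(I * x * ((j : ℂ) - l))) • invDensity d τ f x ∂circ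

/-- `F_τ c = b`, where `F_τ` is the operator in `ℓ_2` determined by the block matrix `F_{j,l}`,
that is, the Toeplitz operator with symbol `invDensity`: it multiplies `Σ_j c_j e^{ijx}` by
`invDensity` and takes the Fourier coefficients with numbers `l ≥ 0`; its domain consists of the
`c` in `ℓ_2` for which the product is integrable. On finitely supported sequences this is
multiplication by the matrix, see `fMaps_of_finite`. -/
def FMaps {S : Set ℕ+} (d τ : ℕ) (f : ℝ → Op S) (c b : ℕ → Vec S) : Prop :=
  ∃ C : ℝ → Vec S, IsSymbol c C ∧ Integrable (fun x => invDensity d τ f x (C x)) circ ∧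
    ∀ l : ℕ, coef (fun x => invDensity d τ f x (C x)) l = b l

/-- The formula for the spectral characteristic,
`B_τ(e^{ix}) (1 - e^{-ixτ})^d / (ix)^d - (-ix)^d / (1 - e^{ixτ})^d f(x)^{-1} C(x)`. -/
def specChar {S : Set ℕ+} (d τ : ℕ) (b : ℕ → Vec S) (f : ℝ → Op S) (C : ℝ → Vec S) (x : ℝ) :
    Vec S :=
  incr d τ x • bSymbol b x -
    ((-(I * x)) ^ d / (1 - exp (I * x * τ)) ^ d) • Ring.inverse (f x) (C x)

/-- `⟨b, c⟩ = Σ_j ⟨b_j, c_j⟩`. -/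
def pairing {S : Set ℕ+} (b c : ℕ → Vec S) : ℝ := (∑' j : ℕ, (inner ℂ (c j) (b j) : ℂ)).re

/-- The constrained optimization problem: `f₀ ∈ D` maximizes `⟨b, F_τ^{-1} b⟩` over the densities
`f ∈ D` for which `F_τ` is defined. -/
def SolvesOptimization {S : Set ℕ+} (d τ : ℕ) (b : ℕ → Vec S) (D : Set (ℝ → Op S))
    (f₀ : ℝ → Op S) : Prop :=
  f₀ ∈ D ∧ ∀ f ∈ D, Minimality d τ f → ∀ c c₀ : ℕ → Vec S,
    FMaps d τ f c b → FMaps d τ f₀ c₀ b → pairing b c ≤ pairing b c₀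

/-! ### The classes of densities and the equations -/

/-- `(1/2π) ∫ |1 - e^{ixτ}|^{2d} x^{-2d} f(x) dx = P`. -/
def D01 {S : Set ℕ+} (d τ : ℕ) (P : Op S) : Set (ℝ → Op S) :=
  {f | IsSpectralDensity d τ f ∧ ∀ k n : S,
    (1 / (2 * Real.pi) : ℂ) * ∫ x, (weight d τ x : ℂ) * entry (f x) k n ∂circ = entry P k n}

/-- `(1/2π) ∫ |1 - e^{ixτ}|^{2d} x^{-2d} Tr f(x) dx = p`. -/
def D02 {S : Set ℕ+} (d τ : ℕ) (p : ℝ) : Set (ℝ → Op S) :=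
  {f | IsSpectralDensity d τ f ∧
    (1 / (2 * Real.pi) : ℂ) * ∫ x, (weight d τ x : ℂ) * opTrace (f x) ∂circ = p}

/-- `(1/2π) ∫ |1 - e^{ixτ}|^{2d} x^{-2d} f_{kk}(x) dx = p_k` for all `k`. -/
def D03 {S : Set ℕ+} (d τ : ℕ) (p : S → ℝ) : Set (ℝ → Op S) :=
  {f | IsSpectralDensity d τ f ∧ ∀ k : S,
    (1 / (2 * Real.pi) : ℂ) * ∫ x, (weight d τ x : ℂ) * entry (f x) k k ∂circ = p k}

/-- `(1/2π) ∫ |1 - e^{ixτ}|^{2d} x^{-2d} ⟨B₁, f(x)⟩ dx = p`, where `⟨B₁, f⟩ = Tr (B₁ f)`. -/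
def D04 {S : Set ℕ+} (d τ : ℕ) (B₁ : Op S) (p : ℝ) : Set (ℝ → Op S) :=
  {f | IsSpectralDensity d τ f ∧
    (1 / (2 * Real.pi) : ℂ) * ∫ x, (weight d τ x : ℂ) * opTrace (B₁ ∘L f x) ∂circ = p}

/-- `C(x) C(x)^* = (w(x) f(x)) A (w(x) f(x))` for almost all `x`, where `w` is the weight. -/
def MultiplierEq {S : Set ℕ+} (d τ : ℕ) (f : ℝ → Op S) (C : ℝ → Vec S) (A : Op S) : Prop :=
  ∀ᵐ x ∂circ, InnerProductSpace.rankOne ℂ (C x) (C x) =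
    ((weight d τ x : ℂ) • f x) ∘L A ∘L ((weight d τ x : ℂ) • f x)

def Eq1 {S : Set ℕ+} (d τ : ℕ) (f : ℝ → Op S) (C : ℝ → Vec S) : Prop :=
  ∃ α : Vec S, MultiplierEq d τ f C (InnerProductSpace.rankOne ℂ α α)

def Eq2 {S : Set ℕ+} (d τ : ℕ) (f : ℝ → Op S) (C : ℝ → Vec S) : Prop :=
  ∃ α : ℝ, MultiplierEq d τ f C (((α ^ 2 : ℝ) : ℂ) • ContinuousLinearMap.id ℂ (Vec S))

def Eq3 {S : Set ℕ+} (d τ : ℕ) (f : ℝ → Op S) (C : ℝ → Vec S) : Prop :=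
  ∃ (α : S → ℝ) (A : Op S), (∀ k : S, A (unitVec k) = ((α k ^ 2 : ℝ) : ℂ) • unitVec k) ∧
    MultiplierEq d τ f C A

def Eq4 {S : Set ℕ+} (d τ : ℕ) (B₁ : Op S) (f : ℝ → Op S) (C : ℝ → Vec S) : Prop :=
  ∃ α : ℝ, MultiplierEq d τ f C (((α ^ 2 : ℝ) : ℂ) • B₁)

/-- The least favourable density in `D` is determined by the equation `E` and the restrictions of
the class, equivalently by the optimization problem and the restrictions of the class; and the
minimax-robust spectral characteristic is given by `specChar`. -/
def DeterminedBy {S : Set ℕ+} (d τ : ℕ) (b : ℕ → Vec S) (D : Set (ℝ → Op S))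
    (f₀ : ℝ → Op S) (C : ℝ → Vec S) (E : Prop) : Prop :=
  (IsLeastFavorable d τ b D f₀ ↔ f₀ ∈ D ∧ E) ∧
  (IsLeastFavorable d τ b D f₀ ↔ SolvesOptimization d τ b D f₀) ∧
  (IsLeastFavorable d τ b D f₀ → ∀ h : ℝ → Vec S,
    IsMinimaxRobust d τ b D h ↔ h =ᵐ[circ] specChar d τ b f₀ C)

/-! ### The operator `F_τ` acts on finitely supported sequences by its matrix -/

instance : IsFiniteMeasure circ := by unfold circ; infer_instance

theorem integral_exp_circ (n : ℤ) :
    ∫ x, exp (I * n * x) ∂circ = if n = 0 then (2 * Real.pi : ℂ) else 0 := by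
  have hle : -Real.pi ≤ Real.pi := by linarith [Real.pi_pos]
  unfold circ
  rw [integral_Ico_eq_integral_Ioc, ← intervalIntegral.integral_of_le hle]
  by_cases hn : n = 0
  · subst hn; simp; ring
  · have hc : I * (n : ℂ) ≠ 0 := mul_ne_zero I_ne_zero (by exact_mod_cast hn)
    rw [integral_exp_mul_complex hc, if_neg hn, div_eq_zero_iff]
    left
    rw [sub_eq_zero]
    apply Complex.exp_eq_exp_iff_exists_int.2
    exact ⟨n, by push_cast; ring⟩

theorem isSymbol_of_finite {S : Set ℕ+} (c : ℕ → Vec S) (N : ℕ) (hc : ∀ j, N ≤ j → c j = 0) :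
    IsSymbol c fun x => ∑ j ∈ Finset.range N, exp (I * j * x) • c j := by
  have hcoef : ∀ n : ℤ, coef (fun x => ∑ j ∈ Finset.range N, exp (I * j * x) • c j) n =
      ∑ j ∈ Finset.range N, if (j : ℤ) = n then c j else 0 := by
    intro n
    unfold coef
    have h1 : ∀ x : ℝ, exp (-(I * n * x)) • ∑ j ∈ Finset.range N, exp (I * j * x) • c j =
        ∑ j ∈ Finset.range N, exp (I * (((j : ℤ) - n : ℤ) : ℂ) * x) • c j := by
      intro x
      rw [Finset.smul_sum]
      refine Finset.sum_congr rfl fun j _ => ?_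
      rw [smul_smul, ← Complex.exp_add]
      congr 2
      push_cast; ring
    simp_rw [h1]
    rw [integral_finsetSum]
    · rw [Finset.smul_sum]
      refine Finset.sum_congr rfl fun j _ => ?_
      rw [integral_smul_const, integral_exp_circ, smul_smul]
      have hpi : (Real.pi : ℂ) ≠ 0 := by exact_mod_cast Real.pi_ne_zero
      by_cases h : (j : ℤ) = n
      · rw [if_pos h, if_pos (sub_eq_zero.2 h), one_div_mul_cancel (by simp [hpi]), one_smul]
      · rw [if_neg h, if_neg (fun h' => h (sub_eq_zero.1 h'))]; simp
    · intro j _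
      refine Integrable.smul_const ?_ _
      refine Integrable.of_bound (by fun_prop) 1 (Filter.Eventually.of_forall fun x => ?_)
      rw [show I * (((j : ℤ) - n : ℤ) : ℂ) * x = (((((j : ℤ) - n : ℤ) : ℝ) * x : ℝ) : ℂ) * I by
        push_cast; ring, Complex.norm_exp_ofReal_mul_I]
  refine ⟨?_, fun j => ?_, fun n hn => ?_⟩
  · refine MemLp.of_bound (by fun_prop) (∑ j ∈ Finset.range N, ‖c j‖)
      (Filter.Eventually.of_forall fun x => (norm_sum_le _ _).trans
        (Finset.sum_le_sum fun j _ => ?_))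
    rw [norm_smul, show I * (j : ℂ) * x = (((j : ℝ) * x : ℝ) : ℂ) * I by push_cast; ring,
      Complex.norm_exp_ofReal_mul_I, one_mul]
  · rw [hcoef]
    simp only [Nat.cast_inj, Finset.sum_ite_eq', Finset.mem_range]
    split_ifs with h
    · rfl
    · exact (hc j (not_lt.1 h)).symm
  · rw [hcoef]
    exact Finset.sum_eq_zero fun j _ => if_neg (by omega)

theorem fMaps_of_finite {S : Set ℕ+} (d τ : ℕ) (f : ℝ → Op S)
    (hf : Integrable (invDensity d τ f) circ) (c : ℕ → Vec S) (N : ℕ)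
    (hc : ∀ j, N ≤ j → c j = 0) :
    FMaps d τ f c fun l => ∑ j ∈ Finset.range N, fBlock d τ f l j (c j) := by
  have hexp : ∀ r : ℝ, ‖exp ((r : ℂ) * I)‖ = 1 := Complex.norm_exp_ofReal_mul_I
  have hI : ∀ g : ℝ → ℂ, AEStronglyMeasurable g circ → (∀ x, ‖g x‖ = 1) → ∀ v : Vec S,
      Integrable (fun x => g x • invDensity d τ f x v) circ := by
    intro g hg h1 v
    exact (hf.apply_continuousLinearMap v).bdd_smul 1 hg
      (Filter.Eventually.of_forall fun x => (h1 x).le)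
  refine ⟨_, isSymbol_of_finite c N hc, ?_, fun l => ?_⟩
  · simp only [map_sum, map_smul]
    refine integrable_finsetSum _ fun j _ => hI _ (by fun_prop) (fun x => ?_) _
    rw [show I * (j : ℂ) * x = (((j : ℝ) * x : ℝ) : ℂ) * I by push_cast; ring, hexp]
  · unfold coef fBlock
    have h1 : ∀ x : ℝ, exp (-(I * ((l : ℤ) : ℂ) * x)) • invDensity d τ f x
        (∑ j ∈ Finset.range N, exp (I * j * x) • c j) =
        ∑ j ∈ Finset.range N, exp (-(I * x * ((l : ℂ) - j))) • invDensity d τ f x (c j) := by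
      intro x
      rw [map_sum, Finset.smul_sum]
      refine Finset.sum_congr rfl fun j _ => ?_
      rw [map_smul, smul_smul, ← Complex.exp_add]
      congr 2
      push_cast; ring
    have hn : ∀ (j : ℕ) (x : ℝ), ‖exp (-(I * x * ((l : ℂ) - j)))‖ = 1 := by
      intro j x
      rw [show -(I * x * ((l : ℂ) - j)) = ((-(x * ((l : ℝ) - j)) : ℝ) : ℂ) * I by
        push_cast; ring, hexp]
    simp_rw [h1]
    rw [integral_finsetSum _ fun j _ => hI _ (by fun_prop) (hn j) _, Finset.smul_sum]
    refine Finset.sum_congr rfl fun j _ => ?_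
    rw [_root_.smul_apply, ContinuousLinearMap.integral_apply]
    · rfl
    · exact hf.bdd_smul 1 (by fun_prop) (Filter.Eventually.of_forall fun x => (hn j x).le)

end

/-! Write W = w f. Division by (1 - e^{-iλτ})^d / (iλ)^d, whose squared modulus is w, turns the
estimation problem into the prediction of B = `expSum b` in L_2(W) by trigonometric polynomials with
negative frequencies. Minimality forces the index set to be finite and makes W and W^{-1} integrable
(`IsRegularWeight`), so everything happens over a finite-dimensional space.

Let r be the component of W^{1/2} B orthogonal to the past and R = W^{-1/2} r the prediction error.
The crux is that r is bounded: a one-step innovation is orthogonal to its own shifts, so its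
pointwise norm is constant; j-step innovations are then bounded by a multiple of j + 1, and Σ
(j+1)‖b_j‖ < ∞ sums them. Hence R and WR are square-integrable. Orthogonality makes WR analytic, and
B - R lying in the closed past gives R the Fourier coefficients b_l for l ≥ 0. So C = WR solves F c
= b and Δ(f) = ⟨b, c⟩ (`IsRegularWeight.exists_isPredictionError`, `IsPredictionError.fMaps`). For
uniqueness (`FMaps.unique`), the difference C of two solutions is analytic while W^{-1} C is
antianalytic, so the nonnegative function ⟨W^{-1} C, C⟩ should integrate to zero. It need not be
integrable, and `re_inner_eq_zero_of_analytic` repairs this by dividing C by 1 + Φ, with Φ the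
analytic completion of ‖C‖.

Since C C^* = W (R R^*) W, each multiplier equation says that R R^* is a constant operator A from a
real space V: all self-adjoint operators, the real diagonal ones, or the real multiples of B₁ (of
the identity for k = 2). Each class fixes exactly the trace pairings of ∫ w f with V
(`momentClass`).

Sufficiency: if R R^* = A ∈ V, then R is bounded, B - R lies in the past of every spectral density,
and the resulting error (1/2π) Tr(A ∫ w f) is the same throughout the class. This is a saddle point,
and the Pythagorean identity at f₀ makes the robust characteristic unique.

Necessity: for ∫ Ψ orthogonal to V the perturbations W + tΨ stay in the class and stay minimal, so
optimality already in the constrained problem forces the first variation ∫ ⟨ΨR, R⟩ to vanish. The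
choice Ψ = ρ (R R^* - A), with ρ > 0 and A the projection onto V of the ρ-average of R R^*, makes
this variation equal to ∫ ρ Tr (R R^* - A)², whence R R^* = A (`IsRegularWeight.exists_rankOne_eq`).
-/

noncomputable section

/-! ### Characters and Fourier coefficients on `[-π, π)` -/

/-- The character `x ↦ e^{inx}`. -/
def character (n : ℤ) (x : ℝ) : ℂ := exp (I * n * x)

theorem character_eq (n : ℤ) (x : ℝ) : character n x = exp (((n * x : ℝ) : ℂ) * I) := by
  unfold character; push_cast; ring_nf

@[simp] theorem norm_character (n : ℤ) (x : ℝ) : ‖character n x‖ = 1 := by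
  rw [character_eq, Complex.norm_exp_ofReal_mul_I]

@[simp] theorem character_zero (x : ℝ) : character 0 x = 1 := by simp [character]

theorem character_add (m n : ℤ) (x : ℝ) :
    character (m + n) x = character m x * character n x := by
  unfold character; rw [← Complex.exp_add]; push_cast; ring_nf

theorem conj_character (n : ℤ) (x : ℝ) :
    (starRingEnd ℂ) (character n x) = character (-n) x := by
  unfold character; rw [← Complex.exp_conj]; simp

theorem character_neg_eq (n : ℤ) (x : ℝ) : character (-n) x = exp (-(I * n * x)) := by
  unfold character; push_cast; ring_nf

@[fun_prop] theorem continuous_character (n : ℤ) : Continuous (character n) := by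
  unfold character; fun_prop

theorem integral_character (n : ℤ) :
    ∫ x, character n x ∂circ = if n = 0 then (2 * Real.pi : ℂ) else 0 :=
  integral_exp_circ n

theorem circ_eq_Ioc : circ = volume.restrict (Ioc (-Real.pi) Real.pi) := by
  unfold circ; exact Measure.restrict_congr_set Ico_ae_eq_Ioc

section Normed

variable {F : Type*} [NormedAddCommGroup F] [NormedSpace ℂ F]

/-- The Fourier coefficients of a function on `[-π, π)`. -/
def fourierC (u : ℝ → F) (n : ℤ) : F :=
  (1 / (2 * Real.pi) : ℂ) • ∫ x, character (-n) x • u x ∂circ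

theorem coef_eq_fourierC {S : Set ℕ+} (g : ℝ → Vec S) (n : ℤ) : coef g n = fourierC g n := by
  unfold coef fourierC; simp_rw [character_neg_eq]; rfl

theorem integrable_character_smul {u : ℝ → F} (hu : Integrable u circ) (n : ℤ) :
    Integrable (fun x => character n x • u x) circ :=
  hu.bdd_smul 1 (continuous_character n).aestronglyMeasurable
    (Filter.Eventually.of_forall fun x => (norm_character n x).le)

theorem fourierC_congr {u v : ℝ → F} (h : u =ᵐ[circ] v) : fourierC u = fourierC v := by
  ext n; unfold fourierC; congr 1
  exact integral_congr_ae (h.mono fun x hx => by simp only [hx])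

theorem fourierC_sub {u v : ℝ → F} (hu : Integrable u circ) (hv : Integrable v circ) (n : ℤ) :
    fourierC (fun x => u x - v x) n = fourierC u n - fourierC v n := by
  unfold fourierC
  simp_rw [smul_sub]
  rw [integral_sub (integrable_character_smul hu _) (integrable_character_smul hv _), smul_sub]

theorem fourierC_smul (c : ℂ) (u : ℝ → F) (n : ℤ) :
    fourierC (fun x => c • u x) n = c • fourierC u n := by
  unfold fourierC
  simp_rw [smul_comm _ c]
  rw [integral_smul, smul_comm]

theorem fourierC_sum {ι : Type*} (s : Finset ι) {u : ι → ℝ → F}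
    (hu : ∀ i ∈ s, Integrable (u i) circ) (n : ℤ) :
    fourierC (fun x => ∑ i ∈ s, u i x) n = ∑ i ∈ s, fourierC (u i) n := by
  unfold fourierC
  simp_rw [Finset.smul_sum]
  rw [integral_finsetSum _ fun i hi => integrable_character_smul (hu i hi) _, Finset.smul_sum]

theorem fourierC_character_smul_const [CompleteSpace F] (m n : ℤ) (v : F) :
    fourierC (fun x => character m x • v) n = if m = n then v else 0 := by
  unfold fourierC
  simp_rw [smul_smul, ← character_add]
  rw [integral_smul_const, integral_character, smul_smul]
  have hpi : (Real.pi : ℂ) ≠ 0 := by exact_mod_cast Real.pi_ne_zero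
  by_cases h : m = n
  · rw [if_pos h, if_pos (by omega), one_div_mul_cancel (by simp [hpi]), one_smul]
  · rw [if_neg h, if_neg (by omega)]; simp

theorem fourierC_clm {G : Type*} [NormedAddCommGroup G] [NormedSpace ℂ G] [CompleteSpace F]
    [CompleteSpace G] (L : F →L[ℂ] G) {u : ℝ → F} (hu : Integrable u circ) (n : ℤ) :
    fourierC (fun x => L (u x)) n = L (fourierC u n) := by
  unfold fourierC
  rw [map_smul, ← L.integral_comp_comm (integrable_character_smul hu _)]
  simp

/-! ### Fejér means -/

/-- The Fejér means of the Fourier series of `u`. -/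
def fejer (u : ℝ → F) (N : ℕ) (x : ℝ) : F :=
  (N : ℂ)⁻¹ • ∑ a ∈ Finset.range N, ∑ b ∈ Finset.range N,
    character ((a : ℤ) - b) x • fourierC u ((a : ℤ) - b)

/-- The Fejér kernel. -/
def fejerKernel (N : ℕ) (s : ℝ) : ℝ :=
  (2 * Real.pi * N)⁻¹ * ‖∑ a ∈ Finset.range N, character a s‖ ^ 2

theorem fejerKernel_nonneg (N : ℕ) (s : ℝ) : 0 ≤ fejerKernel N s := by
  unfold fejerKernel; positivity

@[fun_prop] theorem continuous_fejerKernel (N : ℕ) : Continuous (fejerKernel N) := by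
  unfold fejerKernel; fun_prop

theorem fejerKernel_eq (N : ℕ) (s : ℝ) : (fejerKernel N s : ℂ) =
    (2 * Real.pi * N : ℂ)⁻¹ * ∑ a ∈ Finset.range N, ∑ b ∈ Finset.range N,
      character ((a : ℤ) - b) s := by
  unfold fejerKernel
  push_cast
  rw [← Complex.mul_conj', map_sum, Finset.sum_mul_sum]
  simp_rw [conj_character, ← character_add, sub_eq_add_neg]

@[fun_prop] theorem continuous_fejer (u : ℝ → F) (N : ℕ) : Continuous (fejer u N) := by
  unfold fejer; fun_prop

theorem character_sub_arg (n : ℤ) (x t : ℝ) :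
    character n (x - t) = character n x * character (-n) t := by
  unfold character; rw [← Complex.exp_add]; push_cast; ring_nf

theorem fejerKernel_le (N : ℕ) (s : ℝ) :
    fejerKernel N s ≤ (2 * Real.pi * N)⁻¹ * N ^ 2 := by
  unfold fejerKernel
  gcongr
  exact (norm_sum_le _ _).trans (by simp)

theorem integrable_fejerKernel_smul {u : ℝ → F} (hu : Integrable u circ) (N : ℕ) (x : ℝ) :
    Integrable (fun t => (fejerKernel N (x - t) : ℂ) • u t) circ := by
  refine hu.bdd_smul ((2 * Real.pi * N)⁻¹ * N ^ 2) (by fun_prop)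
    (Filter.Eventually.of_forall fun t => ?_)
  rw [Complex.norm_real, Real.norm_of_nonneg (fejerKernel_nonneg _ _)]
  exact fejerKernel_le _ _

theorem fejer_eq_integral {u : ℝ → F} (hu : Integrable u circ) (N : ℕ) (x : ℝ) :
    fejer u N x = ∫ t, (fejerKernel N (x - t) : ℂ) • u t ∂circ := by
  simp_rw [fejerKernel_eq, character_sub_arg, Finset.mul_sum, Finset.sum_smul]
  have hi : ∀ (a b : ℕ), Integrable (fun t => ((2 * Real.pi * N : ℂ)⁻¹ *
      (character ((a : ℤ) - b) x * character (-((a : ℤ) - b)) t)) • u t) circ := by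
    intro a b
    simp_rw [mul_smul]
    exact ((integrable_character_smul hu _).smul (character ((a : ℤ) - b) x)).smul
      (2 * Real.pi * N : ℂ)⁻¹
  rw [integral_finsetSum _ fun a _ => integrable_finsetSum _ fun b _ => hi a b]
  unfold fejer
  rw [Finset.smul_sum]
  refine Finset.sum_congr rfl fun a _ => ?_
  rw [integral_finsetSum _ fun b _ => hi a b, Finset.smul_sum]
  refine Finset.sum_congr rfl fun b _ => ?_
  unfold fourierC
  simp_rw [mul_smul]
  rw [integral_smul, integral_smul, smul_comm (character _ x), smul_smul, smul_smul, smul_smul]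
  congr 1
  rw [mul_inv]; ring

/-- Positivity of the kernel. The right-hand side is the Fejér mean of `‖u‖`; this domination is
what later lets an analytic completion of `‖C‖` control the means of `C`. -/
theorem norm_fejer_le {u : ℝ → F} (hu : Integrable u circ) (N : ℕ) (x : ℝ) :
    ‖fejer u N x‖ ≤ ∫ t, fejerKernel N (x - t) * ‖u t‖ ∂circ := by
  rw [fejer_eq_integral hu]
  refine (norm_integral_le_integral_norm _).trans (le_of_eq ?_)
  refine integral_congr_ae (Filter.Eventually.of_forall fun t => ?_)
  simp only [norm_smul, Complex.norm_real, Real.norm_of_nonneg (fejerKernel_nonneg _ _)]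

theorem fejer_ofReal {q : ℝ → ℝ} (hq : Integrable q circ) (N : ℕ) (x : ℝ) :
    fejer (fun t => (q t : ℂ)) N x = ((∫ t, fejerKernel N (x - t) * q t ∂circ : ℝ) : ℂ) := by
  rw [fejer_eq_integral hq.ofReal, ← integral_complex_ofReal]
  simp

/-- The integral is the Fejér mean of the constant 1, whose only nonzero coefficient has number 0.
-/
theorem integral_fejerKernel {N : ℕ} (hN : N ≠ 0) (x : ℝ) :
    ∫ t, fejerKernel N (x - t) ∂circ = 1 := by
  have h1 := fejer_ofReal (q := fun _ => (1 : ℝ)) (integrable_const _) N x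
  simp only [mul_one] at h1
  apply Complex.ofReal_injective
  rw [← h1]
  unfold fejer
  have h2 : ∀ n : ℤ, fourierC (fun _ => ((1 : ℝ) : ℂ)) n = if 0 = n then 1 else 0 := by
    intro n
    have := fourierC_character_smul_const 0 n (1 : ℂ)
    simpa using this
  simp_rw [h2]
  have : ∀ a ∈ Finset.range N, ∑ b ∈ Finset.range N,
      character ((a : ℤ) - b) x • (if 0 = (a : ℤ) - b then (1 : ℂ) else 0) = 1 := by
    intro a ha
    rw [Finset.sum_eq_single_of_mem a ha]
    · simp
    · intro b _ hb; rw [if_neg (by omega), smul_zero]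
  rw [Finset.sum_congr rfl this]
  simp [hN]

theorem norm_fejer_le_of_bound {u : ℝ → F} (hu : AEStronglyMeasurable u circ) {M : ℝ}
    (hM : ∀ᵐ x ∂circ, ‖u x‖ ≤ M) (N : ℕ) (x : ℝ) : ‖fejer u N x‖ ≤ M := by
  have hM0 : 0 ≤ M := by
    have : circ ≠ 0 := by
      unfold circ; rw [Ne, Measure.restrict_eq_zero]; simp [Real.pi_pos]
    have := ae_neBot.2 this
    obtain ⟨y, hy⟩ := hM.exists
    exact (norm_nonneg _).trans hy
  rcases eq_or_ne N 0 with rfl | hN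
  · simpa [fejer] using hM0
  have hi : Integrable u circ := Integrable.of_bound hu M hM
  refine (norm_fejer_le hi N x).trans ?_
  have hk : Integrable (fun t => fejerKernel N (x - t)) circ := by
    refine Integrable.of_bound (by fun_prop) ((2 * Real.pi * N)⁻¹ * N ^ 2)
      (Filter.Eventually.of_forall fun t => ?_)
    rw [Real.norm_of_nonneg (fejerKernel_nonneg _ _)]
    exact fejerKernel_le _ _
  calc _ ≤ ∫ t, fejerKernel N (x - t) * M ∂circ := by
        refine integral_mono_ae ?_ (hk.mul_const _) ?_
        · have := (integrable_fejerKernel_smul hi N x).norm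
          simpa only [norm_smul, Complex.norm_real,
            Real.norm_of_nonneg (fejerKernel_nonneg _ _)] using this
        · filter_upwards [hM] with t ht
          exact mul_le_mul_of_nonneg_left ht (fejerKernel_nonneg _ _)
    _ = M := by rw [integral_mul_const, integral_fejerKernel hN, one_mul]

theorem fourierC_fejer [CompleteSpace F] (u : ℝ → F) (N : ℕ) (n : ℤ) :
    fourierC (fejer u N) n = ((N : ℂ)⁻¹ *
      ∑ a ∈ Finset.range N, ∑ b ∈ Finset.range N, if (a : ℤ) - b = n then 1 else 0) •
        fourierC u n := by
  have hi : ∀ a b : ℕ, Integrable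
      (fun x => character ((a : ℤ) - b) x • fourierC u ((a : ℤ) - b)) circ := fun a b =>
    integrable_character_smul (integrable_const _) _
  unfold fejer
  rw [fourierC_smul, fourierC_sum _ fun a _ => integrable_finsetSum _ fun b _ => hi a b, mul_smul]
  congr 1
  rw [Finset.sum_smul]
  refine Finset.sum_congr rfl fun a _ => ?_
  rw [fourierC_sum _ fun b _ => hi a b, Finset.sum_smul]
  refine Finset.sum_congr rfl fun b _ => ?_
  rw [fourierC_character_smul_const]
  split_ifs with h
  · rw [h, one_smul]
  · rw [zero_smul]

theorem fejer_clm {G : Type*} [NormedAddCommGroup G] [NormedSpace ℂ G] [CompleteSpace F]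
    [CompleteSpace G] (L : F →L[ℂ] G) {u : ℝ → F} (hu : Integrable u circ) (N : ℕ) (x : ℝ) :
    fejer (fun x => L (u x)) N x = L (fejer u N x) := by
  unfold fejer
  simp [map_sum, fourierC_clm L hu]

/-- The deviation from `1` of the multipliers of the Fejér means. -/
def fejerDefect (N : ℕ) (n : ℤ) : ℝ :=
  1 - (N : ℝ)⁻¹ * ∑ a ∈ Finset.range N, ∑ b ∈ Finset.range N, if (a : ℤ) - b = n then 1 else 0

theorem fejerDefect_nonneg (N : ℕ) (n : ℤ) : 0 ≤ fejerDefect N n := by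
  unfold fejerDefect
  rcases eq_or_ne N 0 with rfl | hN
  · simp
  rw [sub_nonneg, inv_mul_le_iff₀ (by positivity), mul_one]
  calc _ ≤ ∑ a ∈ Finset.range N, (1 : ℝ) := by
        refine Finset.sum_le_sum fun a _ => ?_
        have : ∀ b : ℕ, (if (a : ℤ) - b = n then (1 : ℝ) else 0) =
            if b = ((a : ℤ) - n).toNat ∧ 0 ≤ (a : ℤ) - n then 1 else 0 := by
          intro b; congr 1; apply propext; constructor
          · intro h; omega
          · intro h; omega
        simp_rw [this, ite_and]
        rw [Finset.sum_ite_eq']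
        split_ifs <;> norm_num
    _ = N := by simp

theorem fejerDefect_le_one (N : ℕ) (n : ℤ) : fejerDefect N n ≤ 1 := by
  unfold fejerDefect
  rw [sub_le_self_iff]
  refine mul_nonneg (by positivity) (Finset.sum_nonneg fun a _ => Finset.sum_nonneg fun b _ => ?_)
  split_ifs <;> norm_num

/-- At least N - |n| pairs (a, b) in the N × N square have difference n. -/
theorem fejerDefect_le {N : ℕ} (hN : N ≠ 0) (n : ℤ) : fejerDefect N n ≤ |(n : ℝ)| / N := by
  have key : (N : ℝ) - |(n : ℝ)| ≤
      ∑ a ∈ Finset.range N, ∑ b ∈ Finset.range N, if (a : ℤ) - b = n then (1 : ℝ) else 0 := by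
    have h1 : (N : ℝ) - |(n : ℝ)| ≤ ((Finset.range (N - n.natAbs)).card : ℝ) := by
      rw [Finset.card_range]
      have : (N : ℤ) - |n| ≤ ((N - n.natAbs : ℕ) : ℤ) := by rw [Int.abs_eq_natAbs]; omega
      have := (Int.cast_le (R := ℝ)).2 this
      push_cast at this ⊢
      exact this
    refine h1.trans ?_
    rw [← Finset.sum_product' (Finset.range N) (Finset.range N)
      (fun a b : ℕ => if (a : ℤ) - b = n then (1 : ℝ) else 0), ← Finset.sum_filter,
      Finset.sum_const, nsmul_eq_mul, mul_one, Nat.cast_le]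
    -- The pairs on the diagonal a - b = n, started at (n⁺, n⁻) so that both entries are natural
    -- numbers.
    refine Finset.card_le_card_of_injOn (fun i => (i + n.toNat, i + (-n).toNat)) ?_ ?_
    · intro i hi
      simp only [Finset.coe_range, mem_Iio] at hi
      simp only [Finset.coe_filter, Finset.mem_product, Finset.mem_range, mem_ofPred_eq]
      omega
    · intro i _ j _ h
      simp only [Prod.mk.injEq] at h
      omega
  have hN' : (0 : ℝ) < N := by positivity
  unfold fejerDefect
  rw [sub_le_iff_le_add, ← sub_le_iff_le_add']
  calc 1 - |(n : ℝ)| / N = (N : ℝ)⁻¹ * (N - |(n : ℝ)|) := by field_simp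
    _ ≤ _ := by gcongr

theorem fourierC_fejer_sub [CompleteSpace F] {u : ℝ → F} (hu : Integrable u circ) (N : ℕ) (n : ℤ) :
    fourierC (fun x => u x - fejer u N x) n = (fejerDefect N n : ℂ) • fourierC u n := by
  have hf : Integrable (fejer u N) circ := by
    unfold fejer
    exact (integrable_finsetSum _ fun a _ => integrable_finsetSum _ fun b _ =>
      integrable_character_smul (integrable_const _) _).smul _
  rw [fourierC_sub hu hf, fourierC_fejer]
  unfold fejerDefect
  push_cast
  rw [sub_smul, one_smul]
  simp only [apply_ite Complex.ofReal, Complex.ofReal_one, Complex.ofReal_zero]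

end Normed

/-! ### Convergence of the Fejér means -/

/-- Parseval's identity, transported from `fourierCoeffOn` to the normalization used here. -/
theorem hasSum_sq_fourierC {u : ℝ → ℂ} (hu : MemLp u 2 circ) :
    HasSum (fun n => ‖fourierC u n‖ ^ 2) ((2 * Real.pi)⁻¹ * ∫ x, ‖u x‖ ^ 2 ∂circ) := by
  have hab : -Real.pi < Real.pi := by linarith [Real.pi_pos]
  have h := hasSum_sq_fourierCoeffOn hab (f := u) (circ_eq_Ioc ▸ hu)
  convert h using 1
  · ext n
    congr 2
    rw [fourierCoeffOn_eq_integral, intervalIntegral.integral_of_le hab.le, ← circ_eq_Ioc]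
    unfold fourierC
    rw [show (1 / (2 * Real.pi) : ℂ) = ((1 / (Real.pi - -Real.pi) : ℝ) : ℂ) by push_cast; ring,
      Complex.coe_smul]
    congr 2
    ext x
    rw [fourier_coe_apply]
    unfold character
    congr 2
    have : (Real.pi : ℂ) ≠ 0 := by exact_mod_cast Real.pi_ne_zero
    push_cast
    field_simp
    ring
  · rw [intervalIntegral.integral_of_le hab.le, ← circ_eq_Ioc, smul_eq_mul]
    congr 2; ring

theorem memLp_fejer {F : Type*} [NormedAddCommGroup F] [NormedSpace ℂ F] (u : ℝ → F) (N : ℕ)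
    (p : ENNReal) : MemLp (fejer u N) p circ := by
  refine MemLp.of_bound (continuous_fejer u N).aestronglyMeasurable
    (‖(N : ℂ)⁻¹‖ * ∑ a ∈ Finset.range N, ∑ b ∈ Finset.range N, ‖fourierC u ((a : ℤ) - b)‖)
    (Filter.Eventually.of_forall fun x => ?_)
  unfold fejer
  rw [norm_smul]
  gcongr
  refine (norm_sum_le _ _).trans (Finset.sum_le_sum fun a _ => (norm_sum_le _ _).trans
    (Finset.sum_le_sum fun b _ => ?_))
  rw [norm_smul, norm_character, one_mul]

theorem eLpNorm_two_sq {F : Type*} [NormedAddCommGroup F] {μ : Measure ℝ} {u : ℝ → F}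
    (hu : MemLp u 2 μ) :
    eLpNorm u 2 μ = ENNReal.ofReal (Real.sqrt (∫ x, ‖u x‖ ^ 2 ∂μ)) := by
  rw [hu.eLpNorm_eq_integral_rpow_norm (by norm_num) (by norm_num)]
  simp [Real.sqrt_eq_rpow]

/-- By Parseval the squared error is a constant times Σ (defect)² ‖û(n)‖². Each defect tends to 0
and is at most 1, so dominated convergence for series applies. -/
theorem tendsto_fejer_L2_complex {u : ℝ → ℂ} (hu : MemLp u 2 circ) :
    Filter.Tendsto (fun N => eLpNorm (fun x => u x - fejer u N x) 2 circ) Filter.atTop (nhds 0) := by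
  have hd : ∀ N, MemLp (fun x => u x - fejer u N x) 2 circ := fun N => hu.sub (memLp_fejer u N 2)
  have hs := (hasSum_sq_fourierC hu).summable
  have h1 : Filter.Tendsto (fun N => ∑' n : ℤ, ‖fourierC (fun x => u x - fejer u N x) n‖ ^ 2)
      Filter.atTop (nhds (∑' _ : ℤ, (0 : ℝ))) := by
    refine tendsto_tsum_of_dominated_convergence hs (fun n => ?_)
      (Filter.Eventually.of_forall fun N n => ?_)
    · have hz : Filter.Tendsto (fun N : ℕ => fejerDefect N n) Filter.atTop (nhds 0) := by
        refine squeeze_zero' (Filter.Eventually.of_forall fun N => fejerDefect_nonneg N n)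
          ((Filter.eventually_ne_atTop 0).mono fun N hN => fejerDefect_le hN n) ?_
        exact tendsto_const_div_atTop_nhds_zero_nat _
      simp_rw [fourierC_fejer_sub (hu.integrable (by norm_num)), norm_smul, Complex.norm_real]
      have := ((hz.norm).mul_const ‖fourierC u n‖).pow 2
      simpa using this
    · rw [fourierC_fejer_sub (hu.integrable (by norm_num)), norm_smul, Complex.norm_real,
        Real.norm_of_nonneg (fejerDefect_nonneg _ _), Real.norm_of_nonneg (by positivity)]
      exact pow_le_pow_left₀ (mul_nonneg (fejerDefect_nonneg _ _) (norm_nonneg _))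
        (mul_le_of_le_one_left (norm_nonneg (fourierC u n)) (fejerDefect_le_one _ _)) 2
  have h2 : ∀ N, ∫ x, ‖u x - fejer u N x‖ ^ 2 ∂circ =
      2 * Real.pi * ∑' n : ℤ, ‖fourierC (fun x => u x - fejer u N x) n‖ ^ 2 := by
    intro N
    rw [(hasSum_sq_fourierC (hd N)).tsum_eq, mul_inv_cancel_left₀ (by positivity)]
  simp_rw [fun N => eLpNorm_two_sq (hd N), h2]
  rw [tsum_zero] at h1
  have := (ENNReal.continuous_ofReal.tendsto _).comp
    ((Real.continuous_sqrt.tendsto _).comp (h1.const_mul (2 * Real.pi)))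
  simpa [Function.comp_def] using this

section FiniteDim

variable {F : Type*} [NormedAddCommGroup F] [NormedSpace ℂ F] [FiniteDimensional ℂ F]

theorem tendsto_fejer_L2 {u : ℝ → F} (hu : MemLp u 2 circ) :
    Filter.Tendsto (fun N => eLpNorm (fun x => u x - fejer u N x) 2 circ) Filter.atTop (nhds 0) := by
  have : CompleteSpace F := FiniteDimensional.complete ℂ F
  let B := Module.finBasis ℂ F
  let L : Fin (Module.finrank ℂ F) → F →L[ℂ] ℂ := fun k => LinearMap.toContinuousLinearMap (B.coord k)
  have hL : ∀ k, MemLp (fun x => L k (u x)) 2 circ := fun k => (L k).comp_memLp' hu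
  have hdec : ∀ N, (fun x => u x - fejer u N x) =
      ∑ k, fun x => (L k (u x) - fejer (fun x => L k (u x)) N x) • B k := by
    intro N
    ext x
    rw [Finset.sum_apply]
    simp_rw [fejer_clm _ (hu.integrable (by norm_num)), ← map_sub]
    exact (B.sum_repr _).symm
  refine tendsto_of_tendsto_of_tendsto_of_le_of_le (g := fun _ => 0)
    (h := fun N => ∑ k, eLpNorm (fun x => L k (u x) - fejer (fun x => L k (u x)) N x) 2 circ *
      ‖B k‖ₑ) tendsto_const_nhds ?_ (fun _ => zero_le) fun N => ?_
  · have : Filter.Tendsto (fun N => ∑ k,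
        eLpNorm (fun x => L k (u x) - fejer (fun x => L k (u x)) N x) 2 circ * ‖B k‖ₑ)
        Filter.atTop (nhds (∑ k, 0 * ‖B k‖ₑ)) :=
      tendsto_finsetSum _ fun k _ =>
        ENNReal.Tendsto.mul_const (tendsto_fejer_L2_complex (hL k)) (Or.inr (by simp))
    simpa using this
  · simp only
    rw [hdec]
    have hm : ∀ k, MemLp (fun x => L k (u x) - fejer (fun x => L k (u x)) N x) 2 circ := fun k =>
      (hL k).sub (memLp_fejer _ N 2)
    refine (eLpNorm_sum_le (fun k _ => (hm k).aestronglyMeasurable.smul_const _)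
      (by norm_num)).trans (Finset.sum_le_sum fun k _ => ?_)
    have := eLpNorm_le_nnreal_smul_eLpNorm_of_ae_le_mul (p := 2) (μ := circ) (c := ‖B k‖₊)
      (f := fun x => (L k (u x) - fejer (fun x => L k (u x)) N x) • B k)
      (g := fun x => L k (u x) - fejer (fun x => L k (u x)) N x)
      (Filter.Eventually.of_forall fun x => by rw [nnnorm_smul, mul_comm])
    refine this.trans (le_of_eq ?_)
    rw [ENNReal.smul_def, smul_eq_mul, mul_comm]; rfl

/-- Every sequence of Fejér means of a square-integrable function has a subsequence that converges
almost everywhere. -/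
theorem exists_fejer_comp_tendsto_ae {u : ℝ → F} (hu : MemLp u 2 circ) {ms : ℕ → ℕ}
    (hms : StrictMono ms) : ∃ ns : ℕ → ℕ, StrictMono ns ∧
      ∀ᵐ x ∂circ, Filter.Tendsto (fun i => fejer u (ms (ns i)) x) Filter.atTop (nhds (u x)) := by
  have hT : Filter.Tendsto (fun i => eLpNorm (fejer u (ms i) - u) 2 circ) Filter.atTop
      (nhds 0) := by
    refine ((tendsto_fejer_L2 hu).comp hms.tendsto_atTop).congr fun N => ?_
    rw [Function.comp_apply, ← eLpNorm_neg]
    congr 1; ext x; simp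
  have hM : TendstoInMeasure circ (fun i => fejer u (ms i)) Filter.atTop u :=
    tendstoInMeasure_of_tendsto_eLpNorm (by norm_num)
      (fun i => (continuous_fejer u (ms i)).aestronglyMeasurable) hu.aestronglyMeasurable hT
  exact hM.exists_seq_tendsto_ae

theorem exists_fejer_tendsto_ae {u : ℝ → F} (hu : MemLp u 2 circ) :
    ∃ ns : ℕ → ℕ, StrictMono ns ∧
      ∀ᵐ x ∂circ, Filter.Tendsto (fun i => fejer u (ns i) x) Filter.atTop (nhds (u x)) := by
  obtain ⟨ns, h1, h2⟩ := exists_fejer_comp_tendsto_ae hu (ms := fun n => n) fun _ _ h => h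
  exact ⟨ns, h1, h2⟩

/-- An integrable function with vanishing Fourier coefficients vanishes. -/
theorem ae_eq_zero_of_fourierC_eq_zero {g : ℝ → ℂ} (hg : Integrable g circ)
    (h : ∀ n, fourierC g n = 0) : g =ᵐ[circ] 0 := by
  have hchar : ∀ n, ∫ x, character n x * g x ∂circ = 0 := by
    intro n
    have := h (-n)
    unfold fourierC at this
    rw [smul_eq_zero] at this
    have hpi : (Real.pi : ℂ) ≠ 0 := by exact_mod_cast Real.pi_ne_zero
    simpa [hpi] using this
  refine ae_eq_zero_of_forall_setIntegral_eq_of_sigmaFinite (fun s _ _ => hg.integrableOn) ?_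
  intro s hs _
  -- The Fejér means of an indicator are bounded by 1, each integrates to zero against `g`, and a
  -- subsequence converges a.e.; dominated convergence with majorant `‖g‖` then gives the integral
  -- of `g` over `s`.
  let u : ℝ → ℂ := s.indicator fun _ => 1
  have hub : ∀ x, ‖u x‖ ≤ 1 := by
    intro x; by_cases hx : x ∈ s <;> simp [u, hx]
  have hum : AEStronglyMeasurable u circ := by
    exact (stronglyMeasurable_const.indicator hs).aestronglyMeasurable
  obtain ⟨ns, -, hns⟩ := exists_fejer_tendsto_ae
    (MemLp.of_bound hum 1 (Filter.Eventually.of_forall hub))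
  have hz : ∀ N, ∫ x, fejer u N x * g x ∂circ = 0 := by
    intro N
    have hi : ∀ a b : ℕ, Integrable
        (fun x => character ((a : ℤ) - b) x • fourierC u ((a : ℤ) - b) * g x) circ := by
      intro a b
      have := (integrable_character_smul hg ((a : ℤ) - b)).const_mul (fourierC u ((a : ℤ) - b))
      refine this.congr (Filter.Eventually.of_forall fun x => ?_)
      simp only [smul_eq_mul]; ring
    have h0 : ∀ a b : ℕ, ∫ x, character ((a : ℤ) - b) x • fourierC u ((a : ℤ) - b) * g x ∂circ
        = 0 := by
      intro a b
      have h1 : ∀ x, character ((a : ℤ) - b) x • fourierC u ((a : ℤ) - b) * g x =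
          fourierC u ((a : ℤ) - b) * (character ((a : ℤ) - b) x * g x) := by
        intro x; simp only [smul_eq_mul]; ring
      simp_rw [h1]
      rw [integral_const_mul, hchar, mul_zero]
    unfold fejer
    simp_rw [smul_mul_assoc, Finset.sum_mul]
    rw [integral_smul, integral_finsetSum _ fun a _ => integrable_finsetSum _ fun b _ => hi a b]
    simp_rw [fun a : ℕ => integral_finsetSum (μ := circ) (Finset.range N) fun b _ => hi a b, h0]
    simp
  have hlim : Filter.Tendsto (fun i => ∫ x, fejer u (ns i) x * g x ∂circ) Filter.atTop
      (nhds (∫ x, u x * g x ∂circ)) := by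
    refine tendsto_integral_of_dominated_convergence (fun x => ‖g x‖)
      (fun i => (continuous_fejer u _).aestronglyMeasurable.mul hg.aestronglyMeasurable) hg.norm
      (fun i => Filter.Eventually.of_forall fun x => ?_) ?_
    · rw [norm_mul]
      exact mul_le_of_le_one_left (norm_nonneg _)
        (norm_fejer_le_of_bound hum (Filter.Eventually.of_forall hub) _ _)
    · filter_upwards [hns] with x hx using hx.mul_const _
  simp_rw [hz] at hlim
  have := tendsto_nhds_unique hlim tendsto_const_nhds
  rw [← integral_indicator hs]
  convert this using 2
  ext x
  by_cases hx : x ∈ s <;> simp [u, hx]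

theorem ae_eq_zero_of_fourierC_eq_zero' {g : ℝ → F} (hg : Integrable g circ)
    (h : ∀ n, fourierC g n = 0) : g =ᵐ[circ] 0 := by
  have : CompleteSpace F := FiniteDimensional.complete ℂ F
  let B := Module.finBasis ℂ F
  have hk : ∀ k, ∀ᵐ x ∂circ, B.coord k (g x) = 0 := by
    intro k
    refine ae_eq_zero_of_fourierC_eq_zero
      (g := fun x => LinearMap.toContinuousLinearMap (B.coord k) (g x))
      (ContinuousLinearMap.integrable_comp _ hg) fun n => ?_
    rw [fourierC_clm _ hg, h, map_zero]
  filter_upwards [ae_all_iff.2 hk] with x hx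
  exact B.ext_elem fun k => by simpa using hx k

end FiniteDim

/-! ### Pairing of analytic and antianalytic functions -/

theorem character_natCast (n : ℕ) (x : ℝ) : character n x = character 1 x ^ n := by
  unfold character; rw [← Complex.exp_nat_mul]; push_cast; ring_nf

section Analytic

variable {F : Type*} [NormedAddCommGroup F] [InnerProductSpace ℂ F]

theorem integrable_inner_of_bound {g Z : ℝ → F} (hZ : Integrable Z circ)
    (hg : AEStronglyMeasurable g circ) {M : ℝ} (hM : ∀ᵐ x ∂circ, ‖g x‖ ≤ M) :
    Integrable (fun x => inner ℂ (g x) (Z x)) circ := by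
  refine (hZ.norm.const_mul M).mono' (hg.inner hZ.aestronglyMeasurable) ?_
  filter_upwards [hM] with x hx
  exact (norm_inner_le_norm _ _).trans (by gcongr)

theorem integrable_inner_character_smul {Z : ℝ → F} (hZ : Integrable Z circ) (n : ℤ) (v : F) :
    Integrable (fun x => inner ℂ (character n x • v) (Z x)) circ :=
  integrable_inner_of_bound (M := ‖v‖) hZ (by fun_prop)
    (Filter.Eventually.of_forall fun x => by rw [norm_smul, norm_character, one_mul])

theorem integral_inner_character_smul [CompleteSpace F] {Z : ℝ → F} (hZ : Integrable Z circ) (n : ℤ) (v : F) :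
    ∫ x, inner ℂ (character n x • v) (Z x) ∂circ = 2 * Real.pi * inner ℂ v (fourierC Z n) := by
  have h : ∀ x, inner ℂ (character n x • v) (Z x) = inner ℂ v (character (-n) x • Z x) := by
    intro x; rw [inner_smul_left, inner_smul_right, conj_character]
  simp_rw [h]
  have hpi : (Real.pi : ℂ) ≠ 0 := by exact_mod_cast Real.pi_ne_zero
  rw [integral_inner (integrable_character_smul hZ _)]
  unfold fourierC
  rw [inner_smul_right]
  field_simp

/-- The left factor is a trigonometric polynomial with frequencies ≥ 0 and `Z` has only negative
ones, so every term of the finite sum vanishes. -/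
theorem integral_inner_eval_smul_fejer [CompleteSpace F] {Z C : ℝ → F} (hZ : Integrable Z circ)
    (hZc : ∀ n : ℤ, 0 ≤ n → fourierC Z n = 0) (hCc : ∀ n : ℤ, n < 0 → fourierC C n = 0)
    (p : Polynomial ℂ) (N : ℕ) :
    ∫ x, inner ℂ (p.eval (character 1 x) • fejer C N x) (Z x) ∂circ = 0 := by
  have h1 : ∀ x, inner ℂ (p.eval (character 1 x) • fejer C N x) (Z x) =
      ∑ i ∈ Finset.range (p.natDegree + 1), ∑ a ∈ Finset.range N, ∑ b ∈ Finset.range N,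
        inner ℂ (character (i + ((a : ℤ) - b)) x •
          (p.coeff i * (N : ℂ)⁻¹) • fourierC C ((a : ℤ) - b)) (Z x) := by
    intro x
    simp_rw [← sum_inner]
    congr 1
    unfold fejer
    rw [Polynomial.eval_eq_sum_range, Finset.sum_smul]
    refine Finset.sum_congr rfl fun i _ => ?_
    simp_rw [Finset.smul_sum]
    refine Finset.sum_congr rfl fun a _ => Finset.sum_congr rfl fun b _ => ?_
    rw [smul_smul, smul_smul, smul_smul, character_add, character_natCast]
    congr 1; ring
  have hi := fun (i a b : ℕ) => integrable_inner_character_smul hZ (i + ((a : ℤ) - b))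
    ((p.coeff i * (N : ℂ)⁻¹) • fourierC C ((a : ℤ) - b))
  simp_rw [h1]
  rw [integral_finsetSum _ fun i _ => integrable_finsetSum _ fun a _ =>
    integrable_finsetSum _ fun b _ => hi i a b]
  refine Finset.sum_eq_zero fun i _ => ?_
  rw [integral_finsetSum _ fun a _ => integrable_finsetSum _ fun b _ => hi i a b]
  refine Finset.sum_eq_zero fun a _ => ?_
  rw [integral_finsetSum _ fun b _ => hi i a b]
  refine Finset.sum_eq_zero fun b _ => ?_
  rw [integral_inner_character_smul hZ]
  rcases lt_or_ge ((a : ℤ) - b) 0 with h | h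
  · rw [hCc _ h]; simp
  · rw [hZc _ (by omega)]; simp

end Analytic

/-- In |R - φ|² = R² - 2R Re φ + |φ|² the cross term has a favourable sign. -/
theorem norm_const_sub_le {φ : ℂ} (hre : 0 ≤ φ.re) {R L : ℝ} (hR : 0 ≤ R) (hL : ‖φ‖ ≤ L) :
    ‖(R : ℂ) - φ‖ ≤ Real.sqrt (R ^ 2 + L ^ 2) := by
  apply Real.le_sqrt_of_sq_le
  have h1 : ‖φ‖ ^ 2 ≤ L ^ 2 := pow_le_pow_left₀ (norm_nonneg _) hL 2
  rw [← Complex.normSq_eq_norm_sq] at h1 ⊢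
  simp only [Complex.normSq_apply, Complex.sub_re, Complex.sub_im, Complex.ofReal_re,
    Complex.ofReal_im] at h1 ⊢
  nlinarith [mul_nonneg hR hre]

theorem one_add_re_le_norm (φ : ℂ) : 1 + φ.re ≤ ‖1 + φ‖ := by
  refine le_trans ?_ (Complex.re_le_norm _)
  simp

section Analytic

variable {F : Type*} [NormedAddCommGroup F] [InnerProductSpace ℂ F] [CompleteSpace F]

/-- A Neumann series makes (1 + p)^{-1} a bounded limit of polynomials in e^{ix}: with φ = p(e^{ix})
and w = (R - φ)/(1 + R) one has 1/(1 + φ) = (1 + R)^{-1} Σ w^k, and Re φ ≥ 0 keeps |w| below a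
constant less than 1. -/
theorem integral_inner_inv_smul_fejer {Z C : ℝ → F} (hZ : Integrable Z circ)
    (hZc : ∀ n : ℤ, 0 ≤ n → fourierC Z n = 0) (hCc : ∀ n : ℤ, n < 0 → fourierC C n = 0)
    (p : Polynomial ℂ) (hp : ∀ x, 0 ≤ (p.eval (character 1 x)).re) (N : ℕ) :
    ∫ x, inner ℂ ((1 + p.eval (character 1 x))⁻¹ • fejer C N x) (Z x) ∂circ = 0 := by
  set φ : ℝ → ℂ := fun x => p.eval (character 1 x) with hφ
  have hφc : Continuous φ := p.continuous.comp (continuous_character 1)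
  obtain ⟨L, hL⟩ : ∃ L : ℝ, ∀ x, ‖φ x‖ ≤ L := by
    refine ⟨∑ i ∈ Finset.range (p.natDegree + 1), ‖p.coeff i‖, fun x => ?_⟩
    rw [hφ]
    simp only
    rw [Polynomial.eval_eq_sum_range]
    refine (norm_sum_le _ _).trans (Finset.sum_le_sum fun i _ => ?_)
    rw [norm_mul, norm_pow, norm_character, one_pow, mul_one]
  -- The ratio θ below is less than 1 exactly when R² + L² < (1 + R)², that is L² < 1 + 2R; R = L²
  -- suffices.
  set R : ℝ := L ^ 2 with hR
  have hR0 : 0 ≤ R := sq_nonneg _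
  set θ : ℝ := Real.sqrt (R ^ 2 + L ^ 2) / (1 + R) with hθ
  have hθ0 : 0 ≤ θ := by positivity
  have hθ1 : θ < 1 := by
    rw [hθ, div_lt_one (by positivity), Real.sqrt_lt' (by positivity)]
    nlinarith
  have hR1 : (1 + R : ℂ) ≠ 0 := by
    have : (1 + R : ℝ) ≠ 0 := by positivity
    exact_mod_cast this
  let w : ℝ → ℂ := fun x => (R - φ x) / (1 + R)
  have hw : ∀ x, ‖w x‖ ≤ θ := by
    intro x
    simp only [w]
    rw [norm_div, show (1 + R : ℂ) = ((1 + R : ℝ) : ℂ) by push_cast; rfl, Complex.norm_real,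
      Real.norm_of_nonneg (by positivity : (0 : ℝ) ≤ 1 + R)]
    exact div_le_div_of_nonneg_right (norm_const_sub_le (hp x) hR0 (hL x)) (by positivity)
  let q : ℕ → Polynomial ℂ := fun K => Polynomial.C ((1 + R : ℂ)⁻¹) *
    ∑ k ∈ Finset.range K, (Polynomial.C ((1 + R : ℂ)⁻¹) * (Polynomial.C (R : ℂ) - p)) ^ k
  have hq : ∀ K x, (q K).eval (character 1 x) = (1 + R : ℂ)⁻¹ * ∑ k ∈ Finset.range K, w x ^ k := by
    intro K x
    simp only [q, w, Polynomial.eval_mul, Polynomial.eval_C, Polynomial.eval_finsetSum,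
      Polynomial.eval_pow, Polynomial.eval_sub, div_eq_inv_mul]
    rfl
  have hlim : ∀ x, Filter.Tendsto (fun K => (q K).eval (character 1 x)) Filter.atTop
      (nhds (1 + φ x)⁻¹) := by
    intro x
    simp_rw [hq]
    have h1 := (hasSum_geometric_of_norm_lt_one ((hw x).trans_lt hθ1)).tendsto_sum_nat.const_mul
      (1 + R : ℂ)⁻¹
    convert h1 using 2
    rw [← mul_inv]
    congr 1
    simp only [w]
    field_simp
    ring
  have hbd : ∀ K x, ‖(q K).eval (character 1 x)‖ ≤ (1 + R)⁻¹ * (1 - θ)⁻¹ := by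
    intro K x
    rw [hq, norm_mul, norm_inv, show (1 + R : ℂ) = ((1 + R : ℝ) : ℂ) by push_cast; rfl,
      Complex.norm_real, Real.norm_of_nonneg (by positivity : (0 : ℝ) ≤ 1 + R)]
    gcongr
    refine (norm_sum_le _ _).trans ?_
    calc ∑ k ∈ Finset.range K, ‖w x ^ k‖ ≤ ∑ k ∈ Finset.range K, θ ^ k := by
          refine Finset.sum_le_sum fun k _ => ?_
          rw [norm_pow]
          exact pow_le_pow_left₀ (norm_nonneg _) (hw x) k
      _ ≤ (1 - θ)⁻¹ := by
          rw [← tsum_geometric_of_lt_one hθ0 hθ1]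
          exact (summable_geometric_of_lt_one hθ0 hθ1).sum_le_tsum _ fun _ _ => by positivity
  obtain ⟨M, hM⟩ : ∃ M : ℝ, ∀ x, ‖fejer C N x‖ ≤ M := by
    refine ⟨‖(N : ℂ)⁻¹‖ * ∑ a ∈ Finset.range N, ∑ b ∈ Finset.range N,
      ‖fourierC C ((a : ℤ) - b)‖, fun x => ?_⟩
    unfold fejer
    rw [norm_smul]
    gcongr
    refine (norm_sum_le _ _).trans (Finset.sum_le_sum fun a _ => (norm_sum_le _ _).trans
      (Finset.sum_le_sum fun b _ => ?_))
    rw [norm_smul, norm_character, one_mul]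
  have hT : Filter.Tendsto
      (fun K => ∫ x, inner ℂ ((q K).eval (character 1 x) • fejer C N x) (Z x) ∂circ)
      Filter.atTop (nhds (∫ x, inner ℂ ((1 + φ x)⁻¹ • fejer C N x) (Z x) ∂circ)) := by
    refine tendsto_integral_of_dominated_convergence
      (fun x => ((1 + R)⁻¹ * (1 - θ)⁻¹ * M) * ‖Z x‖) (fun K => ?_) (hZ.norm.const_mul _)
      (fun K => Filter.Eventually.of_forall fun x => ?_)
      (Filter.Eventually.of_forall fun x => ?_)
    · refine AEStronglyMeasurable.inner ?_ hZ.aestronglyMeasurable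
      have : Continuous fun x => (q K).eval (character 1 x) :=
        (q K).continuous.comp (continuous_character 1)
      exact (this.smul (continuous_fejer C N)).aestronglyMeasurable
    · refine (norm_inner_le_norm _ _).trans ?_
      rw [norm_smul]
      have : 0 ≤ (1 - θ)⁻¹ := inv_nonneg.2 (by linarith)
      exact mul_le_mul_of_nonneg_right (mul_le_mul (hbd K x) (hM x) (norm_nonneg _)
        (by positivity)) (norm_nonneg _)
    · exact ((hlim x).smul_const _).inner tendsto_const_nhds
  simp_rw [fun K => integral_inner_eval_smul_fejer hZ hZc hCc (q K) N] at hT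
  exact tendsto_nhds_unique hT tendsto_const_nhds

end Analytic

/-! ### Analytic completion -/

/-- The multipliers `2, 1, 0` of the analytic completion of a real function. -/
def analyticMult (n : ℤ) : ℂ := if 0 < n then 2 else if n = 0 then 1 else 0

theorem norm_analyticMult_le (n : ℤ) : ‖analyticMult n‖ ≤ 2 := by
  unfold analyticMult; split_ifs <;> simp

/-- The analytic completion of the Fejér means of `q`. -/
def analyticFejer (q : ℝ → ℂ) (N : ℕ) (x : ℝ) : ℂ :=
  (N : ℂ)⁻¹ * ∑ a ∈ Finset.range N, ∑ b ∈ Finset.range N,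
    character ((a : ℤ) - b) x * (analyticMult ((a : ℤ) - b) * fourierC q ((a : ℤ) - b))

theorem exists_polynomial_analyticFejer (q : ℝ → ℂ) (N : ℕ) :
    ∃ p : Polynomial ℂ, ∀ x, analyticFejer q N x = p.eval (character 1 x) := by
  -- The truncated subtraction a - b is harmless: for a < b the multiplier is 0.
  refine ⟨Polynomial.C (N : ℂ)⁻¹ * ∑ a ∈ Finset.range N, ∑ b ∈ Finset.range N,
    Polynomial.X ^ (a - b) *
      Polynomial.C (analyticMult ((a : ℤ) - b) * fourierC q ((a : ℤ) - b)), fun x => ?_⟩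
  unfold analyticFejer
  simp only [Polynomial.eval_mul, Polynomial.eval_C, Polynomial.eval_finsetSum,
    Polynomial.eval_pow, Polynomial.eval_X]
  congr 1
  refine Finset.sum_congr rfl fun a _ => Finset.sum_congr rfl fun b _ => ?_
  rcases lt_or_ge ((a : ℤ) - b) 0 with h | h
  · have : analyticMult ((a : ℤ) - b) = 0 := by
      unfold analyticMult; rw [if_neg (by omega), if_neg (by omega)]
    simp [this]
  · rw [← character_natCast, Nat.cast_sub (by omega)]

theorem continuous_analyticFejer (q : ℝ → ℂ) (N : ℕ) : Continuous (analyticFejer q N) := by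
  unfold analyticFejer; fun_prop

theorem fourierC_neg_ofReal (q : ℝ → ℝ) (n : ℤ) :
    fourierC (fun x => (q x : ℂ)) (-n) = (starRingEnd ℂ) (fourierC (fun x => (q x : ℂ)) n) := by
  unfold fourierC
  rw [smul_eq_mul, smul_eq_mul, map_mul, ← integral_conj]
  congr 1
  · simp [Complex.conj_ofNat]
  · simp [conj_character]

/-- The terms with indices (a, b) and (b, a) are conjugate for real `q`. Replacing their multipliers
1, 1 by 2, 0 leaves the real part of their sum unchanged. -/
theorem re_analyticFejer (q : ℝ → ℝ) (N : ℕ) (x : ℝ) :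
    (analyticFejer (fun x => (q x : ℂ)) N x).re = (fejer (fun x => (q x : ℂ)) N x).re := by
  set g := fourierC (fun x => (q x : ℂ)) with hg
  let s : ℕ → ℕ → ℂ := fun a b =>
    character ((a : ℤ) - b) x * (analyticMult ((a : ℤ) - b) * g ((a : ℤ) - b))
  let t : ℕ → ℕ → ℂ := fun a b => character ((a : ℤ) - b) x * g ((a : ℤ) - b)
  have hconj : ∀ a b, t b a = (starRingEnd ℂ) (t a b) := by
    intro a b
    simp only [t]
    rw [map_mul, conj_character, hg, ← fourierC_neg_ofReal, neg_sub]
  have hst : ∀ a b, s a b = analyticMult ((a : ℤ) - b) * t a b := by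
    intro a b; simp only [s, t]; ring
  have key : ∀ a b, (s a b).re + (s b a).re = 2 * (t a b).re := by
    intro a b
    rw [hst, hst, hconj a b]
    unfold analyticMult
    rcases lt_trichotomy a b with h | h | h
    · rw [if_neg (by omega), if_neg (by omega), if_pos (by omega)]; simp
    · subst h; simp; ring
    · rw [if_pos (by omega), if_neg (by omega), if_neg (by omega)]; simp
  have hsum : ∑ a ∈ Finset.range N, ∑ b ∈ Finset.range N, (s a b).re =
      ∑ a ∈ Finset.range N, ∑ b ∈ Finset.range N, (t a b).re := by
    have h1 : ∑ a ∈ Finset.range N, ∑ b ∈ Finset.range N, (s b a).re =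
        ∑ a ∈ Finset.range N, ∑ b ∈ Finset.range N, (s a b).re := Finset.sum_comm
    have h2 : ∑ a ∈ Finset.range N, ∑ b ∈ Finset.range N, ((s a b).re + (s b a).re) =
        ∑ a ∈ Finset.range N, ∑ b ∈ Finset.range N, 2 * (t a b).re := by simp_rw [key]
    simp_rw [Finset.sum_add_distrib, ← Finset.mul_sum] at h2
    linarith
  have h3 : analyticFejer (fun x => (q x : ℂ)) N x =
      ((N : ℝ)⁻¹ : ℝ) * ∑ a ∈ Finset.range N, ∑ b ∈ Finset.range N, s a b := by
    unfold analyticFejer; push_cast; rfl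
  have h4 : fejer (fun x => (q x : ℂ)) N x =
      ((N : ℝ)⁻¹ : ℝ) * ∑ a ∈ Finset.range N, ∑ b ∈ Finset.range N, t a b := by
    unfold fejer; push_cast; rfl
  rw [h3, h4, Complex.re_ofReal_mul, Complex.re_ofReal_mul]
  simp_rw [Complex.re_sum]
  rw [hsum]

theorem fourierC_analyticFejer (q : ℝ → ℂ) (N : ℕ) (n : ℤ) :
    fourierC (analyticFejer q N) n = analyticMult n * fourierC (fejer q N) n := by
  have hi : ∀ (a b : ℕ) (c : ℂ), Integrable
      (fun x => character ((a : ℤ) - b) x • c) circ := fun a b c =>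
    integrable_character_smul (integrable_const _) _
  have h1 : analyticFejer q N = fun x => (N : ℂ)⁻¹ • ∑ a ∈ Finset.range N, ∑ b ∈ Finset.range N,
    character ((a : ℤ) - b) x • (analyticMult ((a : ℤ) - b) * fourierC q ((a : ℤ) - b)) := rfl
  have h2 : fejer q N = fun x => (N : ℂ)⁻¹ • ∑ a ∈ Finset.range N, ∑ b ∈ Finset.range N,
    character ((a : ℤ) - b) x • fourierC q ((a : ℤ) - b) := rfl
  rw [h1, h2, fourierC_smul, fourierC_smul,
    fourierC_sum _ fun a _ => integrable_finsetSum _ fun b _ => hi a b _,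
    fourierC_sum _ fun a _ => integrable_finsetSum _ fun b _ => hi a b _, smul_eq_mul, smul_eq_mul,
    mul_left_comm]
  congr 1
  rw [Finset.mul_sum]
  refine Finset.sum_congr rfl fun a _ => ?_
  rw [fourierC_sum _ fun b _ => hi a b _, fourierC_sum _ fun b _ => hi a b _, Finset.mul_sum]
  refine Finset.sum_congr rfl fun b _ => ?_
  rw [fourierC_character_smul_const, fourierC_character_smul_const]
  split_ifs with h
  · rw [h]
  · rw [mul_zero]

theorem memLp_analyticFejer (q : ℝ → ℂ) (N : ℕ) : MemLp (analyticFejer q N) 2 circ := by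
  obtain ⟨p, hp⟩ := exists_polynomial_analyticFejer q N
  refine MemLp.of_bound (continuous_analyticFejer q N).aestronglyMeasurable
    (∑ i ∈ Finset.range (p.natDegree + 1), ‖p.coeff i‖) (Filter.Eventually.of_forall fun x => ?_)
  rw [hp, Polynomial.eval_eq_sum_range]
  refine (norm_sum_le _ _).trans (Finset.sum_le_sum fun i _ => ?_)
  rw [norm_mul, norm_pow, norm_character, one_pow, mul_one]

/-- Analytic completion multiplies Fourier coefficients by numbers of modulus at most 2, hence is
bounded in L_2 by Parseval. -/
theorem eLpNorm_analyticFejer_sub_le (q : ℝ → ℂ) (M N : ℕ) :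
    eLpNorm (fun x => analyticFejer q M x - analyticFejer q N x) 2 circ ≤
      2 * eLpNorm (fun x => fejer q M x - fejer q N x) 2 circ := by
  have hA : MemLp (fun x => analyticFejer q M x - analyticFejer q N x) 2 circ :=
    (memLp_analyticFejer q M).sub (memLp_analyticFejer q N)
  have hB : MemLp (fun x => fejer q M x - fejer q N x) 2 circ :=
    (memLp_fejer q M 2).sub (memLp_fejer q N 2)
  rw [eLpNorm_two_sq hA, eLpNorm_two_sq hB,
    show (2 : ENNReal) = ENNReal.ofReal 2 by simp, ← ENNReal.ofReal_mul (by norm_num)]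
  apply ENNReal.ofReal_le_ofReal
  rw [show (2 : ℝ) = Real.sqrt (2 ^ 2) by rw [Real.sqrt_sq (by norm_num)],
    ← Real.sqrt_mul (by positivity)]
  apply Real.sqrt_le_sqrt
  have h1 := hasSum_sq_fourierC hA
  have h2 := (hasSum_sq_fourierC hB).mul_left (2 ^ 2)
  have h3 : ∀ n, ‖fourierC (fun x => analyticFejer q M x - analyticFejer q N x) n‖ ^ 2 ≤
      2 ^ 2 * ‖fourierC (fun x => fejer q M x - fejer q N x) n‖ ^ 2 := by
    intro n
    rw [fourierC_sub ((memLp_analyticFejer q M).integrable (by norm_num))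
      ((memLp_analyticFejer q N).integrable (by norm_num)),
      fourierC_sub ((memLp_fejer q M 2).integrable (by norm_num))
      ((memLp_fejer q N 2).integrable (by norm_num)), fourierC_analyticFejer,
      fourierC_analyticFejer, ← mul_sub, norm_mul, mul_pow]
    gcongr
    exact norm_analyticMult_le n
  have h4 := hasSum_le h3 h1 h2
  rw [mul_left_comm] at h4
  exact le_of_mul_le_mul_left h4 (by positivity)

/-- The completions inherit the Cauchy property in L_2 from the convergent Fejér means. The limit Φ
is the analytic completion of `q`. -/
theorem exists_analyticFejer_tendsto_ae {q : ℝ → ℂ} (hq : MemLp q 2 circ) :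
    ∃ (ns : ℕ → ℕ) (Φ : ℝ → ℂ), StrictMono ns ∧ AEStronglyMeasurable Φ circ ∧
      ∀ᵐ x ∂circ, Filter.Tendsto (fun i => analyticFejer q (ns i) x) Filter.atTop
        (nhds (Φ x)) := by
  let A : ℕ → Lp ℂ 2 circ := fun N => (memLp_analyticFejer q N).toLp _
  let B : ℕ → Lp ℂ 2 circ := fun N => (memLp_fejer q N 2).toLp _
  have hB : Filter.Tendsto B Filter.atTop (nhds (hq.toLp q)) := by
    rw [tendsto_iff_edist_tendsto_0]
    refine (tendsto_fejer_L2 hq).congr fun N => ?_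
    rw [edist_comm, Lp.edist_toLp_toLp]
    rfl
  have hAB : ∀ M N, edist (A M) (A N) ≤ 2 * edist (B M) (B N) := by
    intro M N
    simp only [A, B, Lp.edist_toLp_toLp]
    exact eLpNorm_analyticFejer_sub_le q M N
  have hA : CauchySeq A := by
    have hBc := hB.cauchySeq
    rw [EMetric.cauchySeq_iff] at hBc ⊢
    intro ε hε
    obtain ⟨N, hN⟩ := hBc (ε / 2) (ENNReal.half_pos hε.ne')
    refine ⟨N, fun m hm n hn => (hAB m n).trans_lt ?_⟩
    rw [mul_comm]
    exact (ENNReal.lt_div_iff_mul_lt (by norm_num) (by norm_num)).1 (hN m hm n hn)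
  obtain ⟨Φ, hΦ⟩ := cauchySeq_tendsto_of_complete hA
  obtain ⟨ns, hns, hlim⟩ := (tendstoInMeasure_of_tendsto_Lp hΦ).exists_seq_tendsto_ae
  refine ⟨ns, Φ, hns, (Lp.memLp Φ).aestronglyMeasurable, ?_⟩
  filter_upwards [hlim, ae_all_iff.2 fun N => (memLp_analyticFejer q N).coeFn_toLp] with x hx h
  exact hx.congr fun i => h (ns i)

section Analytic

variable {F : Type*} [NormedAddCommGroup F] [InnerProductSpace ℂ F] [FiniteDimensional ℂ F]

/-- If `C` is square-integrable and analytic, `Z` is integrable and antianalytic, and the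
pointwise inner product of `C` and `Z` is nonnegative, then it vanishes. -/
theorem re_inner_eq_zero_of_analytic {Z C : ℝ → F} (hZ : Integrable Z circ)
    (hC : MemLp C 2 circ) (hZc : ∀ n : ℤ, 0 ≤ n → fourierC Z n = 0)
    (hCc : ∀ n : ℤ, n < 0 → fourierC C n = 0)
    (hre : ∀ᵐ x ∂circ, 0 ≤ (inner ℂ (C x) (Z x) : ℂ).re)
    (him : ∀ᵐ x ∂circ, (inner ℂ (C x) (Z x) : ℂ).im = 0) :
    ∀ᵐ x ∂circ, (inner ℂ (C x) (Z x) : ℂ).re = 0 := by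
  have : CompleteSpace F := FiniteDimensional.complete ℂ F
  let q : ℝ → ℝ := fun x => ‖C x‖
  have hq1 : MemLp q 2 circ := hC.norm
  have hq : MemLp (fun x => (q x : ℂ)) 2 circ := hq1.ofReal
  have hqi : Integrable q circ := hq1.integrable (by norm_num)
  -- Completion preserves the real part, which is the Fejér mean of ‖C‖ and dominates the norm of
  -- the Fejér mean of C.
  have hle : ∀ N x, ‖fejer C N x‖ ≤ (analyticFejer (fun x => (q x : ℂ)) N x).re := by
    intro N x
    rw [re_analyticFejer, fejer_ofReal hqi, Complex.ofReal_re]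
    exact norm_fejer_le (hC.integrable (by norm_num)) N x
  -- One subsequence has to serve both limits: the second is extracted from the first.
  obtain ⟨ms, Φ, hms, hΦm, hΦ⟩ := exists_analyticFejer_tendsto_ae hq
  obtain ⟨ns, hns, hCl⟩ := exists_fejer_comp_tendsto_ae hC hms
  have hΦ' : ∀ᵐ x ∂circ, Filter.Tendsto
      (fun i => analyticFejer (fun x => (q x : ℂ)) (ms (ns i)) x) Filter.atTop (nhds (Φ x)) :=
    hΦ.mono fun x hx => hx.comp hns.tendsto_atTop
  have hΦre : ∀ᵐ x ∂circ, 0 ≤ (Φ x).re := by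
    filter_upwards [hΦ'] with x hx
    exact ge_of_tendsto' ((Complex.continuous_re.tendsto _).comp hx)
      fun i => (norm_nonneg _).trans (hle _ x)
  have hz : ∀ N, ∫ x, inner ℂ ((1 + analyticFejer (fun x => (q x : ℂ)) N x)⁻¹ • fejer C N x)
      (Z x) ∂circ = 0 := by
    intro N
    obtain ⟨p, hp⟩ := exists_polynomial_analyticFejer (fun x => (q x : ℂ)) N
    simp_rw [hp]
    refine integral_inner_inv_smul_fejer hZ hZc hCc p (fun x => ?_) N
    rw [← hp]
    exact (norm_nonneg _).trans (hle N x)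
  -- Division by one plus the completion bounds the analytic factor by 1, which makes ‖Z‖ a majorant
  -- although ⟨C, Z⟩ itself may fail to be integrable.
  have hbound : ∀ N x,
      ‖(1 + analyticFejer (fun x => (q x : ℂ)) N x)⁻¹ • fejer C N x‖ ≤ 1 := by
    intro N x
    have h0 := (norm_nonneg _).trans (hle N x)
    have h1 := one_add_re_le_norm (analyticFejer (fun x => (q x : ℂ)) N x)
    rw [norm_smul, norm_inv, inv_mul_le_iff₀ (by linarith), mul_one]
    linarith [hle N x]
  have hlim : ∀ᵐ x ∂circ, Filter.Tendsto (fun i =>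
      (1 + analyticFejer (fun x => (q x : ℂ)) (ms (ns i)) x)⁻¹ • fejer C (ms (ns i)) x)
      Filter.atTop (nhds ((1 + Φ x)⁻¹ • C x)) := by
    filter_upwards [hΦ', hCl, hΦre] with x h1 h2 h3
    refine Filter.Tendsto.smul ((tendsto_const_nhds.add h1).inv₀ ?_) h2
    exact norm_pos_iff.1 (by linarith [one_add_re_le_norm (Φ x)])
  have hk : AEStronglyMeasurable (fun x => (1 + Φ x)⁻¹) circ := by
    exact (hΦm.aemeasurable.const_add 1).inv.aestronglyMeasurable
  have hI : ∫ x, inner ℂ ((1 + Φ x)⁻¹ • C x) (Z x) ∂circ = 0 := by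
    have hT : Filter.Tendsto (fun i => ∫ x, inner ℂ
        ((1 + analyticFejer (fun x => (q x : ℂ)) (ms (ns i)) x)⁻¹ • fejer C (ms (ns i)) x)
        (Z x) ∂circ) Filter.atTop (nhds (∫ x, inner ℂ ((1 + Φ x)⁻¹ • C x) (Z x) ∂circ)) := by
      refine tendsto_integral_of_dominated_convergence (fun x => ‖Z x‖) (fun i => ?_) hZ.norm
        (fun i => Filter.Eventually.of_forall fun x => ?_) ?_
      · refine AEStronglyMeasurable.inner ?_ hZ.aestronglyMeasurable
        refine AEStronglyMeasurable.smul ?_ (continuous_fejer _ _).aestronglyMeasurable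
        exact ((continuous_analyticFejer _ _).measurable.const_add 1).inv.aestronglyMeasurable
      · exact (norm_inner_le_norm _ _).trans
          (mul_le_of_le_one_left (norm_nonneg _) (hbound _ x))
      · filter_upwards [hlim] with x hx using hx.inner tendsto_const_nhds
    simp_rw [hz] at hT
    exact tendsto_nhds_unique hT tendsto_const_nhds
  have hint : Integrable (fun x => inner ℂ ((1 + Φ x)⁻¹ • C x) (Z x)) circ := by
    refine integrable_inner_of_bound (M := 1) hZ (hk.smul hC.aestronglyMeasurable) ?_
    filter_upwards [hlim] with x hx
    exact le_of_tendsto' hx.norm fun i => hbound _ x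
  -- As ⟨C, Z⟩ is real, only the positive number Re (1 + Φ)^{-1} multiplies it. The regularized
  -- integrand is therefore nonnegative with integral zero.
  have hre' : ∀ᵐ x ∂circ, (inner ℂ ((1 + Φ x)⁻¹ • C x) (Z x) : ℂ).re =
      ((1 + Φ x)⁻¹).re * (inner ℂ (C x) (Z x) : ℂ).re := by
    filter_upwards [him] with x hx
    rw [inner_smul_left, Complex.mul_re, hx, Complex.conj_re, mul_zero, sub_zero]
  have hpos : ∀ᵐ x ∂circ, 0 < ((1 + Φ x)⁻¹).re := by
    filter_upwards [hΦre] with x hx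
    rw [Complex.inv_re]
    refine div_pos (by simp; linarith) (Complex.normSq_pos.2 ?_)
    exact norm_pos_iff.1 (by linarith [one_add_re_le_norm (Φ x)])
  have hI2 : ∫ x, (inner ℂ ((1 + Φ x)⁻¹ • C x) (Z x) : ℂ).re ∂circ = 0 := by
    have := congrArg Complex.re hI
    rwa [← RCLike.re_eq_complex_re, ← integral_re hint] at this
  rw [integral_eq_zero_iff_of_nonneg_ae] at hI2
  · filter_upwards [hI2, hre', hpos] with x h1 h2 h3
    have h4 : ((1 + Φ x)⁻¹).re * (inner ℂ (C x) (Z x) : ℂ).re = 0 := by rw [← h2]; exact h1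
    exact (mul_eq_zero.1 h4).resolve_left h3.ne'
  · filter_upwards [hre', hpos, hre] with x h1 h2 h3
    rw [h1]; exact mul_nonneg h2.le h3
  · exact hint.re

end Analytic

/-! ### Measurability of functions of operators -/

/-- Meant for the operator square root, continuous on the closed cone of nonnegative operators, and
for inversion, continuous on the open set of units. -/
theorem aestronglyMeasurable_comp_of_continuousOn {α X Y : Type*} [MeasurableSpace α]
    {μ : Measure α} [TopologicalSpace X] [TopologicalSpace.PseudoMetrizableSpace X]
    [TopologicalSpace Y] [TopologicalSpace.PseudoMetrizableSpace Y]
    [SecondCountableTopology Y] [Inhabited Y] {g : α → X} {φ : X → Y} {s : Set X}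
    (hg : AEStronglyMeasurable g μ) (hφ : ContinuousOn φ s) (hs : IsOpen s ∨ IsClosed s)
    (hgs : ∀ᵐ x ∂μ, g x ∈ s) : AEStronglyMeasurable (fun x => φ (g x)) μ := by
  classical
  borelize X
  borelize Y
  have hsm : MeasurableSet s := hs.elim IsOpen.measurableSet IsClosed.measurableSet
  have hm : Measurable (s.piecewise φ fun _ => default) :=
    hφ.measurable_piecewise continuousOn_const hsm
  have h1 : AEMeasurable (fun x => s.piecewise φ (fun _ => default) (g x)) μ :=
    hm.comp_aemeasurable hg.aemeasurable
  refine h1.aestronglyMeasurable.congr ?_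
  filter_upwards [hgs] with x hx
  exact Set.piecewise_eq_of_mem _ _ _ hx

section Weight

variable {F : Type*} [NormedAddCommGroup F] [InnerProductSpace ℂ F]

theorem aestronglyMeasurable_apply {A : ℝ → F →L[ℂ] F} {u : ℝ → F}
    (hA : AEStronglyMeasurable A circ) (hu : AEStronglyMeasurable u circ) :
    AEStronglyMeasurable (fun x => A x (u x)) circ :=
  (isBoundedBilinearMap_apply (𝕜 := ℂ)).continuous.comp_aestronglyMeasurable (hA.prodMk hu)

/-- The squared norm in the space `L_2` with weight `W`. -/
def weightedNormSq (W : ℝ → F →L[ℂ] F) (g : ℝ → F) : ENNReal :=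
  ENNReal.ofReal (1 / (2 * Real.pi)) *
    ∫⁻ x, ENNReal.ofReal (inner ℂ (g x) (W x (g x)) : ℂ).re ∂circ

variable [FiniteDimensional ℂ F]

instance : SecondCountableTopology (F →L[ℂ] F) :=
  have : ProperSpace (F →L[ℂ] F) := FiniteDimensional.proper ℂ _
  inferInstance

variable [CompleteSpace F]

theorem aestronglyMeasurable_sqrt {A : ℝ → F →L[ℂ] F} (hA : AEStronglyMeasurable A circ)
    (hpos : ∀ᵐ x ∂circ, (A x).IsPositive) :
    AEStronglyMeasurable (fun x => CFC.sqrt (A x)) circ := by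
  refine aestronglyMeasurable_comp_of_continuousOn (s := {a | 0 ≤ a}) hA CFC.continuousOn_sqrt
    (Or.inr ?_) (hpos.mono fun x hx => (ContinuousLinearMap.nonneg_iff_isPositive _).2 hx)
  exact CStarAlgebra.isClosed_nonneg

theorem aestronglyMeasurable_inverse {A : ℝ → F →L[ℂ] F} (hA : AEStronglyMeasurable A circ)
    (hu : ∀ᵐ x ∂circ, IsUnit (A x)) :
    AEStronglyMeasurable (fun x => Ring.inverse (A x)) circ := by
  refine aestronglyMeasurable_comp_of_continuousOn (s := {a | IsUnit a}) hA ?_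
    (Or.inl Units.isOpen) hu
  rintro _ ⟨a, rfl⟩
  exact (NormedRing.inverse_continuousAt a).continuousWithinAt

/-- Weights with integrable positive values and integrable inverses. -/
structure IsRegularWeight (W : ℝ → F →L[ℂ] F) : Prop where
  integrable : Integrable W circ
  positive : ∀ᵐ x ∂circ, (W x).IsPositive
  isUnit : ∀ᵐ x ∂circ, IsUnit (W x)
  integrable_inverse : Integrable (fun x => Ring.inverse (W x)) circ

end Weight

section Weight

variable {F : Type*} [NormedAddCommGroup F] [InnerProductSpace ℂ F]

/-! ### Multiplication by characters -/

theorem memLp_character_smul {u : ℝ → F} {p : ENNReal} (hu : MemLp u p circ) (n : ℤ) :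
    MemLp (fun x => character n x • u x) p circ :=
  hu.of_le ((continuous_character n).aestronglyMeasurable.smul hu.aestronglyMeasurable)
    (Filter.Eventually.of_forall fun x => by rw [norm_smul, norm_character, one_mul])

/-- Multiplication by a character in `L_2`. -/
def charMul (n : ℤ) : Lp F 2 circ →L[ℂ] Lp F 2 circ :=
  LinearMap.mkContinuous
    { toFun := fun f => (memLp_character_smul (Lp.memLp f) n).toLp _
      map_add' := fun f g => by
        rw [← MemLp.toLp_add]
        refine MemLp.toLp_congr _ _ ?_
        filter_upwards [Lp.coeFn_add f g] with x hx
        exact (congrArg (character n x • ·) hx).trans (smul_add _ _ _)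
      map_smul' := fun c f => by
        rw [RingHom.id_apply, ← MemLp.toLp_const_smul]
        refine MemLp.toLp_congr _ _ ?_
        filter_upwards [Lp.coeFn_smul c f] with x hx
        exact (congrArg (character n x • ·) hx).trans (smul_comm _ _ _) } 1 fun f => by
      simp only [LinearMap.coe_mk, AddHom.coe_mk, one_mul]
      refine Lp.norm_le_norm_of_ae_le ?_
      filter_upwards [(memLp_character_smul (Lp.memLp f) n).coeFn_toLp] with x hx
      rw [hx, norm_smul, norm_character, one_mul]

theorem coeFn_charMul (n : ℤ) (f : Lp F 2 circ) :
    charMul n f =ᵐ[circ] fun x => character n x • f x :=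
  (memLp_character_smul (Lp.memLp f) n).coeFn_toLp

theorem inner_charMul_left (n : ℤ) (f g : Lp F 2 circ) :
    inner ℂ (charMul n f) g = inner ℂ f (charMul (-n) g) := by
  rw [L2.inner_def, L2.inner_def]
  refine integral_congr_ae ?_
  filter_upwards [coeFn_charMul n f, coeFn_charMul (-n) g] with x h1 h2
  rw [h1, h2, inner_smul_left, inner_smul_right, conj_character]

theorem le_norm_of_coercive {A : F →L[ℂ] F} {c : ℝ}
    (h : ∀ u, c * ‖u‖ ^ 2 ≤ (inner ℂ u (A u) : ℂ).re) (u : F) : c * ‖u‖ ≤ ‖A u‖ := by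
  rcases (norm_nonneg u).eq_or_lt with h0 | h0
  · rw [← h0, mul_zero]; exact norm_nonneg _
  · have h1 : (inner ℂ u (A u) : ℂ).re ≤ ‖u‖ * ‖A u‖ :=
      (Complex.re_le_norm _).trans (norm_inner_le_norm _ _)
    have h2 := (h u).trans h1
    refine le_of_mul_le_mul_left ?_ h0
    linarith [h2, show c * ‖u‖ ^ 2 = ‖u‖ * (c * ‖u‖) by ring]

variable [CompleteSpace F]

/-! ### Square roots of positive operators -/

theorem inner_eq_inner_sqrt {A : F →L[ℂ] F} (hA : A.IsPositive) (u v : F) :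
    inner ℂ u (A v) = inner ℂ (CFC.sqrt A u) (CFC.sqrt A v) := by
  have h0 : 0 ≤ A := (ContinuousLinearMap.nonneg_iff_isPositive _).2 hA
  have h1 := CFC.sqrt_mul_sqrt_self A h0
  have h2 : (CFC.sqrt A).IsPositive :=
    (ContinuousLinearMap.nonneg_iff_isPositive _).1 (CFC.sqrt_nonneg A)
  conv_lhs => rw [← h1]
  exact (h2.isSymmetric u _).symm

theorem re_inner_eq_norm_sqrt_sq {A : F →L[ℂ] F} (hA : A.IsPositive) (u : F) :
    (inner ℂ u (A u) : ℂ).re = ‖CFC.sqrt A u‖ ^ 2 := by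
  rw [inner_eq_inner_sqrt hA, inner_self_eq_norm_sq_to_K]
  norm_cast

theorem norm_sqrt_sq {A : F →L[ℂ] F} (hA : A.IsPositive) : ‖CFC.sqrt A‖ ^ 2 = ‖A‖ := by
  have h0 : 0 ≤ A := (ContinuousLinearMap.nonneg_iff_isPositive _).2 hA
  rw [CFC.norm_sqrt A h0, Real.sq_sqrt (norm_nonneg _)]

theorem isUnit_sqrt {A : F →L[ℂ] F} (hA : A.IsPositive) (hu : IsUnit A) : IsUnit (CFC.sqrt A) := by
  have h0 : 0 ≤ A := (ContinuousLinearMap.nonneg_iff_isPositive _).2 hA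
  rw [← CFC.sqrt_mul_sqrt_self A h0] at hu
  exact ((Commute.refl _).isUnit_mul_iff.1 hu).1

theorem isPositive_inverse {A : F →L[ℂ] F} (hA : A.IsPositive) (hu : IsUnit A) :
    (Ring.inverse A).IsPositive := by
  have h1 : A * Ring.inverse A = 1 := Ring.mul_inverse_cancel A hu
  have h2 : ∀ v, A (Ring.inverse A v) = v := fun v =>
    congrArg (fun B : F →L[ℂ] F => B v) h1
  rw [ContinuousLinearMap.isPositive_def']
  refine ⟨?_, fun v => ?_⟩
  · exact hA.isSelfAdjoint.ringInverse
  · have := hA.re_inner_nonneg_right (Ring.inverse A v)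
    rw [ContinuousLinearMap.reApplyInnerSelf_apply]
    rwa [h2] at this

theorem norm_inverse_sqrt_sq {A : F →L[ℂ] F} (hA : A.IsPositive) (hu : IsUnit A) :
    ‖Ring.inverse (CFC.sqrt A)‖ ^ 2 = ‖Ring.inverse A‖ := by
  have hsp : (CFC.sqrt A).IsPositive :=
    (ContinuousLinearMap.nonneg_iff_isPositive _).1 (CFC.sqrt_nonneg A)
  have h1 : Ring.inverse (CFC.sqrt A) * Ring.inverse (CFC.sqrt A) = Ring.inverse A := by
    rw [← Ring.mul_inverse_rev' (Commute.refl _),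
      CFC.sqrt_mul_sqrt_self _ ((ContinuousLinearMap.nonneg_iff_isPositive _).2 hA)]
  rw [← h1, sq, ← CStarRing.norm_star_mul_self,
    (isPositive_inverse hsp (isUnit_sqrt hA hu)).isSelfAdjoint.star_eq]

/-- Write u = A^{-1/2} (A^{1/2} u) and use ‖A^{-1/2}‖² = ‖A^{-1}‖. -/
theorem norm_sq_le_mul_re_inner {A : F →L[ℂ] F} (hA : A.IsPositive) (hu : IsUnit A) (u : F) :
    ‖u‖ ^ 2 ≤ ‖Ring.inverse A‖ * (inner ℂ u (A u) : ℂ).re := by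
  have h : Ring.inverse (CFC.sqrt A) (CFC.sqrt A u) = u :=
    congrArg (fun B : F →L[ℂ] F => B u) (Ring.inverse_mul_cancel _ (isUnit_sqrt hA hu))
  rw [re_inner_eq_norm_sqrt_sq hA, ← norm_inverse_sqrt_sq hA hu, ← mul_pow]
  refine pow_le_pow_left₀ (norm_nonneg _) ?_ 2
  conv_lhs => rw [← h]
  exact (Ring.inverse (CFC.sqrt A)).le_opNorm _

theorem re_inner_sub_le {A : F →L[ℂ] F} (hA : A.IsPositive) (u v : F) :
    (inner ℂ (u - v) (A (u - v)) : ℂ).re ≤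
      2 * (inner ℂ u (A u) : ℂ).re + 2 * (inner ℂ v (A v) : ℂ).re := by
  rw [re_inner_eq_norm_sqrt_sq hA, re_inner_eq_norm_sqrt_sq hA, re_inner_eq_norm_sqrt_sq hA,
    map_sub]
  have h1 := norm_sub_le (CFC.sqrt A u) (CFC.sqrt A v)
  have h2 := pow_le_pow_left₀ (norm_nonneg _) h1 2
  nlinarith [sq_nonneg (‖CFC.sqrt A u‖ - ‖CFC.sqrt A v‖)]

theorem isPositive_of_coercive {A : F →L[ℂ] F} (hA : IsSelfAdjoint A) {c : ℝ} (hc : 0 < c)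
    (h : ∀ u, c * ‖u‖ ^ 2 ≤ (inner ℂ u (A u) : ℂ).re) : A.IsPositive := by
  rw [ContinuousLinearMap.isPositive_def']
  refine ⟨hA, fun u => ?_⟩
  rw [ContinuousLinearMap.reApplyInnerSelf_apply, ← inner_conj_symm, RCLike.conj_re]
  exact le_trans (by positivity) (h u)

theorem isUnit_of_coercive [FiniteDimensional ℂ F] {A : F →L[ℂ] F} {c : ℝ} (hc : 0 < c)
    (h : ∀ u, c * ‖u‖ ^ 2 ≤ (inner ℂ u (A u) : ℂ).re) : IsUnit A := by
  have hinj : Function.Injective A := by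
    rw [injective_iff_map_eq_zero]
    intro u hu
    have := le_norm_of_coercive h u
    rw [hu, norm_zero] at this
    exact norm_le_zero_iff.1 (nonpos_of_mul_nonpos_right this hc)
  rw [ContinuousLinearMap.isUnit_iff_bijective]
  exact ⟨hinj, LinearMap.injective_iff_surjective.1 hinj⟩

theorem norm_inverse_le_of_coercive [FiniteDimensional ℂ F] {A : F →L[ℂ] F} {c : ℝ} (hc : 0 < c)
    (h : ∀ u, c * ‖u‖ ^ 2 ≤ (inner ℂ u (A u) : ℂ).re) : ‖Ring.inverse A‖ ≤ c⁻¹ := by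
  refine ContinuousLinearMap.opNorm_le_bound _ (by positivity) fun v => ?_
  have h1 : A (Ring.inverse A v) = v :=
    congrArg (fun B : F →L[ℂ] F => B v) (Ring.mul_inverse_cancel _ (isUnit_of_coercive hc h))
  have h2 := le_norm_of_coercive h (Ring.inverse A v)
  rw [h1] at h2
  rwa [← div_eq_inv_mul, le_div_iff₀ hc, mul_comm]

end Weight

section Weight

variable {F : Type*} [NormedAddCommGroup F] [InnerProductSpace ℂ F] [CompleteSpace F]

/-! ### The space `L_2` with a regular weight -/

theorem weightedNormSq_eq {W : ℝ → F →L[ℂ] F} (hW : ∀ᵐ x ∂circ, (W x).IsPositive) (g : ℝ → F) :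
    weightedNormSq W g = ENNReal.ofReal (1 / (2 * Real.pi)) *
      eLpNorm (fun x => CFC.sqrt (W x) (g x)) 2 circ ^ 2 := by
  unfold weightedNormSq
  congr 1
  rw [eLpNorm_eq_lintegral_rpow_enorm_toReal (by norm_num) (by norm_num), ← ENNReal.rpow_natCast,
    ← ENNReal.rpow_mul]
  norm_num
  refine lintegral_congr_ae ?_
  filter_upwards [hW] with x hx
  rw [re_inner_eq_norm_sqrt_sq hx, ENNReal.ofReal_pow (norm_nonneg _), ofReal_norm]

variable [FiniteDimensional ℂ F]

namespace IsRegularWeight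

variable {W : ℝ → F →L[ℂ] F} (hW : IsRegularWeight W)

include hW

theorem aestronglyMeasurable_sqrt_apply {u : ℝ → F} (hu : AEStronglyMeasurable u circ) :
    AEStronglyMeasurable (fun x => CFC.sqrt (W x) (u x)) circ :=
  aestronglyMeasurable_apply
    (aestronglyMeasurable_sqrt hW.integrable.aestronglyMeasurable hW.positive) hu

theorem memLp_sqrt_apply {u : ℝ → F} (hu : AEStronglyMeasurable u circ) {M : ℝ}
    (hM : ∀ᵐ x ∂circ, ‖u x‖ ≤ M) : MemLp (fun x => CFC.sqrt (W x) (u x)) 2 circ := by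
  rw [memLp_two_iff_integrable_sq_norm (hW.aestronglyMeasurable_sqrt_apply hu)]
  refine (hW.integrable.norm.mul_const (M ^ 2)).mono'
    ((hW.aestronglyMeasurable_sqrt_apply hu).norm.pow 2) ?_
  filter_upwards [hM, hW.positive] with x hx hp
  rw [Real.norm_of_nonneg (by positivity), ← norm_sqrt_sq hp, ← mul_pow]
  gcongr
  exact ((CFC.sqrt (W x)).le_opNorm _).trans (by gcongr)

theorem memLp_sqrt_character (n : ℤ) (v : F) :
    MemLp (fun x => CFC.sqrt (W x) (character n x • v)) 2 circ :=
  hW.memLp_sqrt_apply (M := ‖v‖) (by fun_prop)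
    (Filter.Eventually.of_forall fun x => by rw [norm_smul, norm_character, one_mul])

theorem memLp_inverse_sqrt {u : ℝ → F} (hu : AEStronglyMeasurable u circ) {M : ℝ}
    (hM : ∀ᵐ x ∂circ, ‖u x‖ ≤ M) :
    MemLp (fun x => Ring.inverse (CFC.sqrt (W x)) (u x)) 2 circ := by
  have hm : AEStronglyMeasurable (fun x => Ring.inverse (CFC.sqrt (W x)) (u x)) circ := by
    refine aestronglyMeasurable_apply (aestronglyMeasurable_inverse
      (aestronglyMeasurable_sqrt hW.integrable.aestronglyMeasurable hW.positive) ?_) hu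
    filter_upwards [hW.positive, hW.isUnit] with x h1 h2 using isUnit_sqrt h1 h2
  rw [memLp_two_iff_integrable_sq_norm hm]
  refine (hW.integrable_inverse.norm.mul_const (M ^ 2)).mono' (hm.norm.pow 2) ?_
  filter_upwards [hM, hW.positive, hW.isUnit] with x hx hp hunit
  rw [Real.norm_of_nonneg (by positivity), ← norm_inverse_sqrt_sq hp hunit, ← mul_pow]
  gcongr
  exact ((Ring.inverse (CFC.sqrt (W x))).le_opNorm _).trans (by gcongr)

omit hW in
/-- The weighted exponentials as elements of `L_2`. -/
def weightedExp (hW : IsRegularWeight W) (n : ℤ) : F →ₗ[ℂ] Lp F 2 circ where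
  toFun v := (hW.memLp_sqrt_character n v).toLp _
  map_add' u v := by
    rw [← MemLp.toLp_add]
    refine MemLp.toLp_congr _ _ (Filter.Eventually.of_forall fun x => ?_)
    simp
  map_smul' c v := by
    rw [RingHom.id_apply, ← MemLp.toLp_const_smul]
    refine MemLp.toLp_congr _ _ (Filter.Eventually.of_forall fun x => ?_)
    simp only [Pi.smul_apply, map_smul]
    exact smul_comm _ _ _

theorem coeFn_weightedExp (n : ℤ) (v : F) :
    hW.weightedExp n v =ᵐ[circ] fun x => CFC.sqrt (W x) (character n x • v) :=
  (hW.memLp_sqrt_character n v).coeFn_toLp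

theorem charMul_weightedExp (m n : ℤ) (v : F) :
    charMul m (hW.weightedExp n v) = hW.weightedExp (m + n) v := by
  refine Lp.ext ?_
  filter_upwards [coeFn_charMul m (hW.weightedExp n v), hW.coeFn_weightedExp n v,
    hW.coeFn_weightedExp (m + n) v] with x h1 h2 h3
  rw [h1, h2, h3, character_add, mul_smul]
  simp only [map_smul]

theorem exists_norm_weightedExp_le : ∃ K : ℝ, 0 ≤ K ∧ ∀ n v, ‖hW.weightedExp n v‖ ≤ K * ‖v‖ := by
  let L : F →L[ℂ] Lp F 2 circ := LinearMap.toContinuousLinearMap (hW.weightedExp 0)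
  refine ⟨‖L‖, L.opNorm_nonneg, fun n v => ?_⟩
  have h : ‖hW.weightedExp n v‖ ≤ ‖hW.weightedExp 0 v‖ := by
    refine Lp.norm_le_norm_of_ae_le ?_
    filter_upwards [hW.coeFn_weightedExp n v, hW.coeFn_weightedExp 0 v] with x h1 h2
    rw [h1, h2]
    simp [norm_smul]
  exact h.trans (L.le_opNorm v)

omit hW in
/-- The span of the weighted exponentials with negative frequencies. -/
def pastSubmodule (hW : IsRegularWeight W) : Submodule ℂ (Lp F 2 circ) :=
  Submodule.span ℂ {g | ∃ (n : ℤ) (v : F), n < 0 ∧ g = hW.weightedExp n v}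

omit hW in
/-- The closed span of the weighted exponentials with negative frequencies. -/
def pastClosure (hW : IsRegularWeight W) : Submodule ℂ (Lp F 2 circ) :=
  hW.pastSubmodule.topologicalClosure

instance : CompleteSpace hW.pastClosure :=
  (Submodule.isClosed_topologicalClosure _).completeSpace_coe

theorem weightedExp_mem_pastClosure {n : ℤ} (hn : n < 0) (v : F) :
    hW.weightedExp n v ∈ hW.pastClosure :=
  Submodule.le_topologicalClosure _ (Submodule.subset_span ⟨n, v, hn, rfl⟩)

/-- A closed submodule that contains the generators contains the past. -/
theorem pastClosure_le {V : Submodule ℂ (Lp F 2 circ)} (hV : IsClosed (V : Set (Lp F 2 circ)))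
    (h : ∀ (n : ℤ) (v : F), n < 0 → hW.weightedExp n v ∈ V) : hW.pastClosure ≤ V := by
  refine Submodule.topologicalClosure_minimal _ (Submodule.span_le.2 ?_) hV
  rintro _ ⟨n, v, hn, rfl⟩
  exact h n v hn

/-- Backward shifts send generators to generators, and the preimage of a closed subspace is closed.
-/
theorem charMul_neg_mem {m : ℤ} (hm : m ≤ 0) {y : Lp F 2 circ} (hy : y ∈ hW.pastClosure) :
    charMul m y ∈ hW.pastClosure := by
  have : hW.pastClosure ≤ hW.pastClosure.comap (charMul m : Lp F 2 circ →L[ℂ] _).toLinearMap := by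
    refine hW.pastClosure_le ?_ fun n v hn => ?_
    · exact (Submodule.isClosed_topologicalClosure _).preimage (charMul m).continuous
    · rw [Submodule.mem_comap]
      change charMul m _ ∈ _
      rw [hW.charMul_weightedExp]
      exact hW.weightedExp_mem_pastClosure (by omega) v
  exact this hy

omit hW in
/-- The orthogonal projection along the past. -/
def innovation (hW : IsRegularWeight W) : Lp F 2 circ →L[ℂ] Lp F 2 circ :=
  (hW.pastClosure)ᗮ.starProjection

theorem innovation_mem (y : Lp F 2 circ) : hW.innovation y ∈ (hW.pastClosure)ᗮ :=
  Submodule.starProjection_apply_mem _ y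

theorem innovation_eq_self {y : Lp F 2 circ} (hy : y ∈ (hW.pastClosure)ᗮ) :
    hW.innovation y = y := Submodule.starProjection_eq_self_iff.2 hy

theorem innovation_eq_zero {y : Lp F 2 circ} (hy : y ∈ hW.pastClosure) : hW.innovation y = 0 :=
  (Submodule.starProjection_apply_eq_zero_iff _).2 (Submodule.le_orthogonal_orthogonal _ hy)

theorem sub_innovation_mem (y : Lp F 2 circ) : y - hW.innovation y ∈ hW.pastClosure := by
  have := Submodule.sub_starProjection_mem_orthogonal (K := (hW.pastClosure)ᗮ) y
  rwa [Submodule.orthogonal_orthogonal] at this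

theorem norm_innovation_le (y : Lp F 2 circ) : ‖hW.innovation y‖ ≤ ‖y‖ :=
  Submodule.norm_starProjection_apply_le _ y

theorem inner_eq_zero_of_mem {r y : Lp F 2 circ} (hr : r ∈ (hW.pastClosure)ᗮ)
    (hy : y ∈ hW.pastClosure) : inner ℂ r y = 0 :=
  (Submodule.mem_orthogonal' _ _).1 hr y hy

/-- The one-step innovation has constant norm. -/
theorem norm_innovation_zero_sq (v : F) :
    ∀ᵐ x ∂circ, ‖hW.innovation (hW.weightedExp 0 v) x‖ ^ 2 ≤
      ‖hW.innovation (hW.weightedExp 0 v)‖ ^ 2 := by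
  set r := hW.innovation (hW.weightedExp 0 v) with hr
  have hrL : MemLp r 2 circ := Lp.memLp r
  have hsq : Integrable (fun x => ‖r x‖ ^ 2) circ :=
    (memLp_two_iff_integrable_sq_norm hrL.aestronglyMeasurable).1 hrL
  set g : ℝ → ℂ := fun x => ((‖r x‖ ^ 2 : ℝ) : ℂ) with hg
  have hgi : Integrable g circ := hsq.ofReal
  have hinner : ∀ n : ℤ, inner ℂ r (charMul n r) = ∫ x, character n x * g x ∂circ := by
    intro n
    rw [L2.inner_def]
    refine integral_congr_ae ?_
    filter_upwards [coeFn_charMul n r] with x hx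
    rw [hx, inner_smul_right, inner_self_eq_norm_sq_to_K, hg]
    simp
  -- The innovation is the exponential with number 0 minus a past element, so its strictly backward
  -- shifts lie in the past and are orthogonal to it. These inner products are the Fourier
  -- coefficients of ‖r‖², which is thus constant.
  have hpos : ∀ n : ℤ, 0 < n → fourierC g n = 0 := by
    intro n hn
    have h1 : charMul (-n) r ∈ hW.pastClosure := by
      have h2 : r = hW.weightedExp 0 v - (hW.weightedExp 0 v - r) := by abel
      rw [h2, map_sub, hW.charMul_weightedExp]
      exact sub_mem (hW.weightedExp_mem_pastClosure (by omega) v)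
        (hW.charMul_neg_mem (by omega) (hW.sub_innovation_mem _))
    have h2 := hinner (-n)
    rw [hW.inner_eq_zero_of_mem (hW.innovation_mem _) h1] at h2
    unfold fourierC
    simp only [smul_eq_mul]
    rw [← h2, mul_zero]
  have hneg : ∀ n : ℤ, n < 0 → fourierC g n = 0 := by
    intro n hn
    have := fourierC_neg_ofReal (fun x => ‖r x‖ ^ 2) (-n)
    rw [neg_neg, hpos (-n) (by omega), map_zero] at this
    exact this
  have hz : (fun x => g x - fourierC g 0) =ᵐ[circ] 0 := by
    refine ae_eq_zero_of_fourierC_eq_zero (hgi.sub (integrable_const _)) fun n => ?_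
    rw [fourierC_sub hgi (integrable_const _)]
    have hc : fourierC (fun _ => fourierC g 0) n = if 0 = n then fourierC g 0 else 0 := by
      simpa using fourierC_character_smul_const 0 n (fourierC g 0)
    rw [hc]
    rcases lt_trichotomy n 0 with h | rfl | h
    · rw [hneg n h, if_neg (by omega), sub_zero]
    · simp
    · rw [hpos n h, if_neg (by omega), sub_zero]
  have hval : fourierC g 0 = (((2 * Real.pi)⁻¹ * ‖r‖ ^ 2 : ℝ) : ℂ) := by
    have h0 := hinner 0
    have h1 : charMul 0 r = r := by
      refine Lp.ext ?_
      filter_upwards [coeFn_charMul 0 r] with x hx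
      rw [hx, character_zero, one_smul]
    rw [h1, inner_self_eq_norm_sq_to_K] at h0
    unfold fourierC
    simp only [smul_eq_mul, neg_zero]
    rw [← h0]
    push_cast
    simp
  filter_upwards [hz] with x hx
  have h1 : g x = fourierC g 0 := sub_eq_zero.1 hx
  rw [hval, hg] at h1
  have h2 : ‖r x‖ ^ 2 = (2 * Real.pi)⁻¹ * ‖r‖ ^ 2 := Complex.ofReal_injective h1
  rw [h2]
  -- The constant value is ‖r‖²/(2π); dropping the factor 1/(2π) ≤ 1 is enough for an upper bound.
  refine mul_le_of_le_one_left (by positivity) (inv_le_one_of_one_le₀ ?_)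
  linarith [Real.pi_gt_three]

/-- The innovations of consecutive exponentials differ by a one-step innovation. -/
theorem exists_innovation_succ (n : ℕ) (v : F) : ∃ u : F,
    hW.innovation (hW.weightedExp (n + 1 : ℕ) v) =
      charMul 1 (hW.innovation (hW.weightedExp n v)) + hW.innovation (hW.weightedExp 0 u) := by
  -- Shifting the past forward by one adds only frequency 0. Modulo the past it lands in the space
  -- of one-step innovations, which is finite-dimensional and hence closed, so the inclusion passes
  -- to the closure.
  set R₀ : Submodule ℂ (Lp F 2 circ) :=
    LinearMap.range (hW.innovation.toLinearMap ∘ₗ hW.weightedExp 0) with hR₀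
  have hle : hW.pastClosure ≤ R₀.comap (hW.innovation ∘L charMul 1).toLinearMap := by
    refine hW.pastClosure_le ?_ fun m w hm => ?_
    · exact (Submodule.closed_of_finiteDimensional R₀).preimage
        (hW.innovation ∘L charMul 1).continuous
    · rw [Submodule.mem_comap]
      change hW.innovation (charMul 1 _) ∈ _
      rw [hW.charMul_weightedExp]
      rcases eq_or_ne (1 + m) 0 with h | h
      · rw [h]; exact ⟨w, rfl⟩
      · rw [hW.innovation_eq_zero (hW.weightedExp_mem_pastClosure (by omega) w)]
        exact zero_mem _
  obtain ⟨u, hu⟩ := hle (hW.sub_innovation_mem (hW.weightedExp n v))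
  refine ⟨u, ?_⟩
  have h1 : hW.innovation (hW.weightedExp 0 u) = hW.innovation (charMul 1
      (hW.weightedExp n v - hW.innovation (hW.weightedExp n v))) := hu
  -- A forward shift of a vector orthogonal to the past is still orthogonal to it, because the past
  -- is invariant under backward shifts.
  have h2 : charMul 1 (hW.innovation (hW.weightedExp n v)) ∈ (hW.pastClosure)ᗮ := by
    rw [Submodule.mem_orthogonal']
    intro y hy
    rw [inner_charMul_left]
    exact hW.inner_eq_zero_of_mem (hW.innovation_mem _) (hW.charMul_neg_mem (by norm_num) hy)
  rw [h1, map_sub, map_sub, hW.innovation_eq_self h2, hW.charMul_weightedExp]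
  rw [add_sub_cancel, show (1 + (n : ℤ)) = ((n + 1 : ℕ) : ℤ) by push_cast; ring]

/-- Each further step adds a one-step innovation, whose L_2 norm is at most 2K‖v‖ and which is
pointwise bounded by that norm. The linear growth in n is the source of the weight j + 1 in the
summability condition. -/
theorem exists_norm_innovation_le : ∃ K : ℝ, 0 ≤ K ∧ ∀ (n : ℕ) (v : F),
    ∀ᵐ x ∂circ, ‖hW.innovation (hW.weightedExp n v) x‖ ≤ K * (n + 1) * ‖v‖ := by
  obtain ⟨K, hK, hle⟩ := hW.exists_norm_weightedExp_le
  have h0 : ∀ u : F, ∀ᵐ x ∂circ, ‖hW.innovation (hW.weightedExp 0 u) x‖ ≤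
      ‖hW.innovation (hW.weightedExp 0 u)‖ := fun u =>
    (hW.norm_innovation_zero_sq u).mono fun x hx =>
      (pow_le_pow_iff_left₀ (norm_nonneg _) (norm_nonneg _) two_ne_zero).1 hx
  have hr : ∀ (n : ℤ) (v : F), ‖hW.innovation (hW.weightedExp n v)‖ ≤ K * ‖v‖ := fun n v =>
    (hW.norm_innovation_le _).trans (hle n v)
  refine ⟨2 * K, by positivity, fun n v => ?_⟩
  induction n with
  | zero =>
    filter_upwards [h0 v] with x hx
    have := hx.trans (hr 0 v)
    have h2 : 0 ≤ K * ‖v‖ := by positivity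
    simp only [Nat.cast_zero]
    linarith
  | succ n ih =>
    obtain ⟨u, hu⟩ := hW.exists_innovation_succ n v
    have hnu : ‖hW.innovation (hW.weightedExp 0 u)‖ ≤ 2 * K * ‖v‖ := by
      have h1 : hW.innovation (hW.weightedExp 0 u) =
          hW.innovation (hW.weightedExp (n + 1 : ℕ) v) -
            charMul 1 (hW.innovation (hW.weightedExp n v)) := by rw [hu]; abel
      have h2 : ‖charMul 1 (hW.innovation (hW.weightedExp n v))‖ ≤
          ‖hW.innovation (hW.weightedExp n v)‖ := by
        refine Lp.norm_le_norm_of_ae_le ?_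
        filter_upwards [coeFn_charMul 1 (hW.innovation (hW.weightedExp n v))] with x hx
        rw [hx, norm_smul, norm_character, one_mul]
      rw [h1]
      refine (norm_sub_le _ _).trans ?_
      linarith [hr (n + 1 : ℕ) v, hr n v]
    rw [hu]
    filter_upwards [ih, h0 u, coeFn_charMul 1 (hW.innovation (hW.weightedExp n v)),
      Lp.coeFn_add (charMul 1 (hW.innovation (hW.weightedExp n v)))
        (hW.innovation (hW.weightedExp 0 u))] with x h1 h2 h3 h4
    rw [h4, Pi.add_apply, h3]
    refine (norm_add_le _ _).trans ?_
    rw [norm_smul, norm_character, one_mul]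
    push_cast
    linarith

end IsRegularWeight

end Weight

theorem exists_seq_tendsto_ae_of_hasSum {F : Type*} [NormedAddCommGroup F]
    {f : ℕ → Lp F 2 circ} {s : Lp F 2 circ} (h : HasSum f s) :
    ∃ ns : ℕ → ℕ, StrictMono ns ∧ ∀ᵐ x ∂circ,
      Filter.Tendsto (fun i => ∑ j ∈ Finset.range (ns i), f j x) Filter.atTop (nhds (s x)) := by
  obtain ⟨ns, hns, hlim⟩ := (tendstoInMeasure_of_tendsto_Lp h.tendsto_sum_nat).exists_seq_tendsto_ae
  refine ⟨ns, hns, ?_⟩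
  have hsum : ∀ᵐ x ∂circ, ∀ N, (∑ j ∈ Finset.range N, f j : Lp F 2 circ) x =
      ∑ j ∈ Finset.range N, f j x := by
    refine ae_all_iff.2 fun N => ?_
    induction N with
    | zero =>
      filter_upwards [Lp.coeFn_zero F 2 circ] with x hx
      simpa using hx
    | succ N ih =>
      filter_upwards [ih, Lp.coeFn_add (∑ j ∈ Finset.range N, f j) (f N)] with x h1 h2
      rw [Finset.sum_range_succ, h2, Pi.add_apply, h1, Finset.sum_range_succ]
  filter_upwards [hlim, hsum] with x h1 h2
  exact h1.congr fun i => h2 (ns i)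

/-! ### Existence of the prediction error and its properties -/

section Weight

variable {F : Type*} [NormedAddCommGroup F] [InnerProductSpace ℂ F]

/-- The sum of the Fourier series `∑ b_j e^{ijx}`. -/
def expSum (b : ℕ → F) (x : ℝ) : F := ∑' j : ℕ, character j x • b j

variable (F) in
/-- Trigonometric polynomials with negative frequencies. -/
def pastPoly : Submodule ℂ (ℝ → F) :=
  Submodule.span ℂ {g | ∃ (n : ℤ) (v : F), n < 0 ∧ g = fun x => character n x • v}

theorem summable_character_smul [CompleteSpace F] {b : ℕ → F} (hb : Summable fun j => ‖b j‖)
    (x : ℝ) : Summable fun j : ℕ => character j x • b j :=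
  Summable.of_norm (by simpa [norm_smul] using hb)

theorem norm_expSum_le {b : ℕ → F} (hb : Summable fun j => ‖b j‖)
    (x : ℝ) : ‖expSum b x‖ ≤ ∑' j, ‖b j‖ := by
  refine (norm_tsum_le_tsum_norm (by simpa [norm_smul] using hb)).trans (le_of_eq ?_)
  simp [norm_smul]

theorem continuous_expSum [CompleteSpace F] {b : ℕ → F} (hb : Summable fun j => ‖b j‖) :
    Continuous (expSum b) := by
  refine continuous_tsum (fun j => by fun_prop) hb fun j x => ?_
  rw [norm_smul, norm_character, one_mul]

theorem fourierC_expSum [CompleteSpace F] {b : ℕ → F} (hb : Summable fun j => ‖b j‖) (l : ℕ) :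
    fourierC (expSum b) l = b l := by
  have h1 : HasSum (fun j : ℕ => ∫ x, character (-(l : ℤ)) x • character j x • b j ∂circ)
      (∫ x, ∑' j : ℕ, character (-(l : ℤ)) x • character j x • b j ∂circ) := by
    refine hasSum_integral_of_summable_integral_norm
      (fun j => integrable_character_smul (integrable_character_smul (integrable_const _) _) _) ?_
    simp only [norm_smul, norm_character, one_mul, integral_const]
    exact hb.mul_left _
  have h2 : ∀ x, ∑' j : ℕ, character (-(l : ℤ)) x • character j x • b j =
      character (-(l : ℤ)) x • expSum b x := fun x =>
    (summable_character_smul hb x).tsum_const_smul _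
  simp_rw [h2] at h1
  have h3 := h1.const_smul (1 / (2 * Real.pi) : ℂ)
  have h4 : ∀ j : ℕ, (1 / (2 * Real.pi) : ℂ) •
      ∫ x, character (-(l : ℤ)) x • character j x • b j ∂circ = if j = l then b l else 0 := by
    intro j
    have := fourierC_character_smul_const (j : ℤ) (l : ℤ) (b j)
    unfold fourierC at this
    rw [this]
    simp only [Nat.cast_inj]
    split_ifs with h
    · rw [h]
    · rfl
  simp_rw [h4] at h3
  exact h3.unique (hasSum_ite_eq l (b l))

variable [CompleteSpace F] [FiniteDimensional ℂ F]

/-- `R` is the error of the best prediction of `∑ b_j e^{ijx}` by functions with negative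
frequencies in the space `L_2` with weight `W`. -/
structure IsPredictionError (W : ℝ → F →L[ℂ] F) (b : ℕ → F) (R : ℝ → F) : Prop where
  memLp : MemLp R 2 circ
  bounded : ∃ M : ℝ, ∀ᵐ x ∂circ, (inner ℂ (R x) (W x (R x)) : ℂ).re ≤ M
  memLp_weight : MemLp (fun x => W x (R x)) 2 circ
  analytic : ∀ n : ℤ, n < 0 → fourierC (fun x => W x (R x)) n = 0
  coeff : ∀ l : ℕ, fourierC R l = b l
  approx : ∀ ε : ENNReal, 0 < ε → ∃ p ∈ pastPoly F, weightedNormSq W (expSum b - R - p) < ε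
  pythagoras : ∀ u : ℝ → F, AEStronglyMeasurable u circ →
    (∀ ε : ENNReal, 0 < ε → ∃ p ∈ pastPoly F, weightedNormSq W (u - p) < ε) →
    weightedNormSq W (expSum b - u) = weightedNormSq W R + weightedNormSq W (expSum b - R - u)
  energy_nonneg : 0 ≤ (∑' j : ℕ, inner ℂ (fourierC (fun x => W x (R x)) j) (b j) : ℂ).re
  energy : weightedNormSq W R =
    ENNReal.ofReal (∑' j : ℕ, inner ℂ (fourierC (fun x => W x (R x)) j) (b j) : ℂ).re

namespace IsRegularWeight

variable {W : ℝ → F →L[ℂ] F} (hW : IsRegularWeight W)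

include hW

omit [FiniteDimensional ℂ F] in
theorem weightedNormSq_eq_norm {g : ℝ → F} {y : Lp F 2 circ}
    (hg : (fun x => CFC.sqrt (W x) (g x)) =ᵐ[circ] y) :
    weightedNormSq W g = ENNReal.ofReal ((2 * Real.pi)⁻¹ * ‖y‖ ^ 2) := by
  rw [weightedNormSq_eq hW.positive, eLpNorm_congr_ae hg, ← Lp.enorm_def, ← ofReal_norm,
    ← ENNReal.ofReal_pow (norm_nonneg _), ← ENNReal.ofReal_mul (by positivity), one_div]

theorem exists_mem_pastSubmodule {p : ℝ → F} (hp : p ∈ pastPoly F) :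
    ∃ s ∈ hW.pastSubmodule, (fun x => CFC.sqrt (W x) (p x)) =ᵐ[circ] s := by
  induction hp using Submodule.span_induction with
  | mem g hg =>
    obtain ⟨n, v, hn, rfl⟩ := hg
    exact ⟨hW.weightedExp n v, Submodule.subset_span ⟨n, v, hn, rfl⟩,
      (hW.coeFn_weightedExp n v).symm⟩
  | zero =>
    refine ⟨0, zero_mem _, ?_⟩
    filter_upwards [Lp.coeFn_zero F 2 circ] with x hx
    rw [hx, Pi.zero_apply, map_zero]
  | add p q _ _ ihp ihq =>
    obtain ⟨s, hs, h1⟩ := ihp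
    obtain ⟨t, ht, h2⟩ := ihq
    refine ⟨s + t, add_mem hs ht, ?_⟩
    filter_upwards [h1, h2, Lp.coeFn_add s t] with x h1 h2 h3
    rw [h3, Pi.add_apply, Pi.add_apply, map_add, h1, h2]
  | smul c p _ ih =>
    obtain ⟨s, hs, h1⟩ := ih
    refine ⟨c • s, Submodule.smul_mem _ c hs, ?_⟩
    filter_upwards [h1, Lp.coeFn_smul c s] with x h1 h2
    rw [h2, Pi.smul_apply, Pi.smul_apply, map_smul, h1]

theorem exists_mem_pastPoly {s : Lp F 2 circ} (hs : s ∈ hW.pastSubmodule) :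
    ∃ p ∈ pastPoly F, (fun x => CFC.sqrt (W x) (p x)) =ᵐ[circ] s := by
  induction hs using Submodule.span_induction with
  | mem g hg =>
    obtain ⟨n, v, hn, rfl⟩ := hg
    exact ⟨fun x => character n x • v, Submodule.subset_span ⟨n, v, hn, rfl⟩,
      (hW.coeFn_weightedExp n v).symm⟩
  | zero =>
    refine ⟨0, zero_mem _, ?_⟩
    filter_upwards [Lp.coeFn_zero F 2 circ] with x hx
    rw [hx, Pi.zero_apply, map_zero]
  | add s t _ _ ihs iht =>
    obtain ⟨p, hp, h1⟩ := ihs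
    obtain ⟨q, hq, h2⟩ := iht
    refine ⟨p + q, add_mem hp hq, ?_⟩
    filter_upwards [h1, h2, Lp.coeFn_add s t] with x h1 h2 h3
    rw [h3, Pi.add_apply, Pi.add_apply, map_add, h1, h2]
  | smul c s _ ih =>
    obtain ⟨p, hp, h1⟩ := ih
    refine ⟨c • p, Submodule.smul_mem _ c hp, ?_⟩
    filter_upwards [h1, Lp.coeFn_smul c s] with x h1 h2
    rw [h2, Pi.smul_apply, Pi.smul_apply, map_smul, h1]

/-- Functions approximable by trigonometric polynomials with negative frequencies belong to the
closed past. -/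
theorem exists_mem_pastClosure {u : ℝ → F} (hu : AEStronglyMeasurable u circ)
    (happ : ∀ ε : ENNReal, 0 < ε → ∃ p ∈ pastPoly F, weightedNormSq W (u - p) < ε) :
    ∃ y ∈ hW.pastClosure, (fun x => CFC.sqrt (W x) (u x)) =ᵐ[circ] y := by
  have hm : AEStronglyMeasurable (fun x => CFC.sqrt (W x) (u x)) circ :=
    hW.aestronglyMeasurable_sqrt_apply hu
  have hc : ENNReal.ofReal (1 / (2 * Real.pi)) ≠ 0 := by
    rw [Ne, ENNReal.ofReal_eq_zero, not_le]; positivity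
  have key : ∀ δ : ENNReal, 0 < δ → ∃ s ∈ hW.pastSubmodule,
      eLpNorm (fun x => CFC.sqrt (W x) (u x) - s x) 2 circ < δ := by
    intro δ hδ
    have hε : 0 < ENNReal.ofReal (1 / (2 * Real.pi)) * (min δ 1) ^ 2 :=
      ENNReal.mul_pos hc (pow_ne_zero _ (lt_min hδ one_pos).ne')
    obtain ⟨p, hp, hlt⟩ := happ _ hε
    obtain ⟨s, hs, hps⟩ := hW.exists_mem_pastSubmodule hp
    refine ⟨s, hs, ?_⟩
    rw [weightedNormSq_eq hW.positive, ENNReal.mul_lt_mul_iff_right hc ENNReal.ofReal_ne_top] at hlt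
    have h1 : eLpNorm (fun x => CFC.sqrt (W x) ((u - p) x)) 2 circ =
        eLpNorm (fun x => CFC.sqrt (W x) (u x) - s x) 2 circ := by
      refine eLpNorm_congr_ae ?_
      filter_upwards [hps] with x hx
      rw [Pi.sub_apply, map_sub, hx]
    rw [h1] at hlt
    exact (lt_of_not_ge fun h => hlt.not_ge (pow_le_pow_left' h 2)).trans_le (min_le_left _ _)
  have hL : MemLp (fun x => CFC.sqrt (W x) (u x)) 2 circ := by
    obtain ⟨s, -, hs⟩ := key 1 one_pos
    have h1 : MemLp (fun x => CFC.sqrt (W x) (u x) - s x) 2 circ :=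
      ⟨hm.sub (Lp.memLp s).aestronglyMeasurable, hs.trans ENNReal.one_lt_top⟩
    have := h1.add (Lp.memLp s)
    exact this.ae_eq (Filter.Eventually.of_forall fun x => by simp)
  refine ⟨hL.toLp _, ?_, hL.coeFn_toLp.symm⟩
  unfold pastClosure
  rw [← SetLike.mem_coe, Submodule.topologicalClosure_coe, EMetric.mem_closure_iff]
  intro δ hδ
  obtain ⟨s, hs, hlt⟩ := key δ hδ
  refine ⟨s, hs, ?_⟩
  rw [Lp.edist_def]
  refine lt_of_eq_of_lt (eLpNorm_congr_ae ?_) hlt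
  filter_upwards [hL.coeFn_toLp] with x hx
  rw [Pi.sub_apply, hx]

theorem hasSum_weightedExp {b : ℕ → F} (hb : Summable fun j => ‖b j‖) {wB : Lp F 2 circ}
    (hwB : (fun x => CFC.sqrt (W x) (expSum b x)) =ᵐ[circ] wB) :
    HasSum (fun j : ℕ => hW.weightedExp j (b j)) wB := by
  obtain ⟨K, hK, hle⟩ := hW.exists_norm_weightedExp_le
  have hs : Summable fun j : ℕ => hW.weightedExp j (b j) :=
    Summable.of_norm_bounded (hb.mul_left K) fun j => hle _ _
  obtain ⟨s, hs⟩ := hs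
  obtain ⟨ns, hns, hlim⟩ := exists_seq_tendsto_ae_of_hasSum hs
  have : s = wB := by
    refine Lp.ext ?_
    filter_upwards [hlim, hwB, ae_all_iff.2 fun j : ℕ => hW.coeFn_weightedExp j (b j)]
      with x h1 h2 h3
    rw [← h2]
    refine tendsto_nhds_unique h1 ?_
    simp_rw [h3, ← map_sum]
    have := ((summable_character_smul hb x).hasSum.tendsto_sum_nat).comp hns.tendsto_atTop
    exact ((CFC.sqrt (W x)).continuous.tendsto _).comp this
  exact this ▸ hs

/-- The linear growth of the pointwise bounds is absorbed by the weight j + 1. This bound on the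
innovation makes all later integrability statements work. -/
theorem norm_innovation_le_of_summable {b : ℕ → F} (hb : Summable fun j : ℕ => ((j : ℝ) + 1) * ‖b j‖)
    {wB : Lp F 2 circ} (h : HasSum (fun j : ℕ => hW.weightedExp j (b j)) wB) :
    ∃ M : ℝ, ∀ᵐ x ∂circ, ‖hW.innovation wB x‖ ≤ M := by
  obtain ⟨K, hK, hle⟩ := hW.exists_norm_innovation_le
  obtain ⟨ns, -, hlim⟩ := exists_seq_tendsto_ae_of_hasSum (h.mapL hW.innovation)
  refine ⟨∑' j : ℕ, K * (((j : ℝ) + 1) * ‖b j‖), ?_⟩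
  filter_upwards [hlim, ae_all_iff.2 fun j : ℕ => hle j (b j)] with x h1 h2
  refine le_of_tendsto' h1.norm fun i => (norm_sum_le _ _).trans ?_
  refine le_trans (Finset.sum_le_sum fun j _ => (h2 j).trans_eq (mul_assoc _ _ _)) ?_
  exact (hb.mul_left K).sum_le_tsum _ fun j _ => by positivity

omit [FiniteDimensional ℂ F] in
theorem inverse_sqrt_apply : ∀ᵐ x ∂circ, ∀ v,
    Ring.inverse (CFC.sqrt (W x)) (CFC.sqrt (W x) v) = v ∧
    CFC.sqrt (W x) (Ring.inverse (CFC.sqrt (W x)) v) = v ∧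
    CFC.sqrt (W x) (CFC.sqrt (W x) v) = W x v := by
  filter_upwards [hW.positive, hW.isUnit] with x h1 h2 v
  have hu := isUnit_sqrt h1 h2
  refine ⟨?_, ?_, ?_⟩
  · exact congrArg (fun B : F →L[ℂ] F => B v) (Ring.inverse_mul_cancel _ hu)
  · exact congrArg (fun B : F →L[ℂ] F => B v) (Ring.mul_inverse_cancel _ hu)
  · exact congrArg (fun B : F →L[ℂ] F => B v) (CFC.sqrt_mul_sqrt_self (W x)
      ((ContinuousLinearMap.nonneg_iff_isPositive _).2 h1))

theorem inner_weightedExp {R : ℝ → F} {r : Lp F 2 circ}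
    (hr : (fun x => CFC.sqrt (W x) (R x)) =ᵐ[circ] r)
    (hi : Integrable (fun x => W x (R x)) circ) (n : ℤ) (v : F) :
    inner ℂ (hW.weightedExp n v) r =
      2 * Real.pi * inner ℂ v (fourierC (fun x => W x (R x)) n) := by
  rw [← integral_inner_character_smul hi, L2.inner_def]
  refine integral_congr_ae ?_
  filter_upwards [hW.coeFn_weightedExp n v, hr, hW.positive] with x h1 h2 h3
  rw [h1, ← h2, inner_eq_inner_sqrt h3]

/-- The coefficient is, up to a constant, the L_2 inner product of y with W^{-1/2} e^{inx} v, which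
is square-integrable because W^{-1} is integrable. This continuous functional kills the generators,
hence the closed past. -/
theorem fourierC_eq_zero_of_mem {H : ℝ → F} (hH : Integrable H circ) {y : Lp F 2 circ}
    (hy : y ∈ hW.pastClosure) (hHy : (fun x => CFC.sqrt (W x) (H x)) =ᵐ[circ] y)
    {n : ℤ} (hn : 0 ≤ n) : fourierC H n = 0 := by
  refine ext_inner_left ℂ fun v => ?_
  rw [inner_zero_right]
  have hg := hW.memLp_inverse_sqrt (u := fun x => character n x • v) (M := ‖v‖) (by fun_prop)
    (Filter.Eventually.of_forall fun x => by rw [norm_smul, norm_character, one_mul])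
  have hsymm : ∀ᵐ x ∂circ, ∀ u w : F,
      inner ℂ (Ring.inverse (CFC.sqrt (W x)) u) (CFC.sqrt (W x) w) = inner ℂ u w := by
    filter_upwards [hW.inverse_sqrt_apply] with x hx u w
    have hp : (CFC.sqrt (W x)).IsPositive :=
      (ContinuousLinearMap.nonneg_iff_isPositive _).1 (CFC.sqrt_nonneg (W x))
    refine (hp.isSymmetric (Ring.inverse (CFC.sqrt (W x)) u) w).symm.trans ?_
    exact congrArg (inner ℂ · w) (hx u).2.1
  have h1 : inner ℂ (hg.toLp _) y = 2 * Real.pi * inner ℂ v (fourierC H n) := by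
    rw [← integral_inner_character_smul hH, L2.inner_def]
    refine integral_congr_ae ?_
    filter_upwards [hg.coeFn_toLp, hHy, hsymm] with x h1 h2 h3
    rw [h1, ← h2, h3]
  have h2 : hW.pastClosure ≤ (ℂ ∙ hg.toLp _)ᗮ := by
    refine hW.pastClosure_le (Submodule.isClosed_orthogonal _) fun m w hm => ?_
    rw [Submodule.mem_orthogonal_singleton_iff_inner_right, L2.inner_def]
    have : ∫ x, inner ℂ (hg.toLp _ x) (hW.weightedExp m w x) ∂circ =
        ∫ x, inner ℂ (character n x • v) (character m x • w) ∂circ := by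
      refine integral_congr_ae ?_
      filter_upwards [hg.coeFn_toLp, hW.coeFn_weightedExp m w, hsymm] with x h1 h2 h3
      rw [h1, h2, h3]
    rw [this, integral_inner_character_smul (integrable_character_smul (integrable_const _) _),
      fourierC_character_smul_const, if_neg (by omega), inner_zero_right, mul_zero]
  have h3 := Submodule.mem_orthogonal_singleton_iff_inner_right.1 (h2 hy)
  rw [h1] at h3
  have hpi : (Real.pi : ℂ) ≠ 0 := by exact_mod_cast Real.pi_ne_zero
  simpa [hpi] using h3

/-- The projection residual r of W^{1/2} B is bounded, so R = W^{-1/2} r and WR = W^{1/2} r inherit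
square-integrability from the integrability of W^{-1} and W. -/
theorem exists_isPredictionError {b : ℕ → F}
    (hb : Summable fun j : ℕ => ((j : ℝ) + 1) * ‖b j‖) : ∃ R, IsPredictionError W b R := by
  have hb1 : Summable fun j => ‖b j‖ :=
    hb.of_nonneg_of_le (fun _ => norm_nonneg _) fun j =>
      le_mul_of_one_le_left (norm_nonneg _) (by linarith [Nat.cast_nonneg (α := ℝ) j])
  have hBm : AEStronglyMeasurable (expSum b) circ := (continuous_expSum hb1).aestronglyMeasurable
  have hBb : ∀ᵐ x ∂circ, ‖expSum b x‖ ≤ ∑' j, ‖b j‖ :=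
    Filter.Eventually.of_forall (norm_expSum_le hb1)
  have hBi : Integrable (expSum b) circ := Integrable.of_bound hBm _ hBb
  have hQB := hW.memLp_sqrt_apply hBm hBb
  set wB := hQB.toLp _ with hwB
  have hwBe : (fun x => CFC.sqrt (W x) (expSum b x)) =ᵐ[circ] wB := hQB.coeFn_toLp.symm
  have hsum := hW.hasSum_weightedExp hb1 hwBe
  obtain ⟨M, hM⟩ := hW.norm_innovation_le_of_summable hb hsum
  set r := hW.innovation wB with hr
  have hrm : AEStronglyMeasurable r circ := (Lp.memLp r).aestronglyMeasurable
  have hrK : r ∈ (hW.pastClosure)ᗮ := hW.innovation_mem _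
  have hyK : wB - r ∈ hW.pastClosure := hW.sub_innovation_mem _
  set R : ℝ → F := fun x => Ring.inverse (CFC.sqrt (W x)) (r x) with hR
  have hRL : MemLp R 2 circ := hW.memLp_inverse_sqrt hrm hM
  have hRi : Integrable R circ := hRL.integrable (by norm_num)
  have hQR : (fun x => CFC.sqrt (W x) (R x)) =ᵐ[circ] r := by
    filter_upwards [hW.inverse_sqrt_apply] with x hx using (hx (r x)).2.1
  have hWR : (fun x => CFC.sqrt (W x) (r x)) =ᵐ[circ] fun x => W x (R x) := by
    filter_upwards [hW.inverse_sqrt_apply, hQR] with x hx h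
    rw [← h, (hx (R x)).2.2]
  have hWRL : MemLp (fun x => W x (R x)) 2 circ := (hW.memLp_sqrt_apply hrm hM).ae_eq hWR
  have hWRi := hWRL.integrable (q := 2) (by norm_num)
  have hQy : (fun x => CFC.sqrt (W x) ((expSum b - R) x)) =ᵐ[circ] (wB - r : Lp F 2 circ) := by
    filter_upwards [hwBe, hQR, Lp.coeFn_sub wB r] with x h1 h2 h3
    rw [h3, Pi.sub_apply, Pi.sub_apply, map_sub, h1, h2]
  have hpi : (Real.pi : ℂ) ≠ 0 := by exact_mod_cast Real.pi_ne_zero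
  -- Since r is orthogonal to W^{1/2} B - r, its squared norm equals ⟨r, W^{1/2} B⟩; expanding B in
  -- exponentials turns this into the pairing of the coefficients of WR with b.
  have henergy : (∑' j : ℕ, inner ℂ (fourierC (fun x => W x (R x)) j) (b j) : ℂ).re =
      (2 * Real.pi)⁻¹ * ‖r‖ ^ 2 := by
    have h1 : inner ℂ r wB = inner ℂ r r := by
      have := hW.inner_eq_zero_of_mem hrK hyK
      rwa [inner_sub_right, sub_eq_zero] at this
    have h2 := hsum.mapL (innerSL ℂ r)
    simp only [innerSL_apply_apply] at h2
    have h3 : ∀ j : ℕ, inner ℂ r (hW.weightedExp j (b j)) =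
        2 * Real.pi * inner ℂ (fourierC (fun x => W x (R x)) j) (b j) := by
      intro j
      rw [← inner_conj_symm, hW.inner_weightedExp hQR hWRi, map_mul, inner_conj_symm]
      congr 1
      simp [Complex.conj_ofNat]
    simp_rw [h3] at h2
    have h4 := h2.mul_left (2 * Real.pi : ℂ)⁻¹
    have h5 : ∀ j : ℕ, (2 * Real.pi : ℂ)⁻¹ * (2 * Real.pi *
        inner ℂ (fourierC (fun x => W x (R x)) j) (b j)) =
        inner ℂ (fourierC (fun x => W x (R x)) j) (b j) := fun j =>
      inv_mul_cancel_left₀ (by simp [hpi]) _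
    simp_rw [h5] at h4
    have h6 : inner ℂ r r = ((‖r‖ ^ 2 : ℝ) : ℂ) := by
      rw [inner_self_eq_norm_sq_to_K]; simp
    rw [h4.tsum_eq, h1, h6, show (2 * Real.pi : ℂ)⁻¹ * ((‖r‖ ^ 2 : ℝ) : ℂ) =
      (((2 * Real.pi)⁻¹ * ‖r‖ ^ 2 : ℝ) : ℂ) by push_cast; rfl, Complex.ofReal_re]
  refine ⟨R, ⟨hRL, ⟨M ^ 2, ?_⟩, hWRL, fun n hn => ?_, fun l => ?_, fun ε hε => ?_,
    fun u hu happ => ?_, ?_, ?_⟩⟩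
  · filter_upwards [hM, hQR, hW.positive] with x h1 h2 h3
    rw [re_inner_eq_norm_sqrt_sq h3, h2]
    exact pow_le_pow_left₀ (norm_nonneg _) h1 2
  · refine ext_inner_left ℂ fun v => ?_
    have h1 := hW.inner_weightedExp hQR hWRi n v
    rw [Submodule.inner_right_of_mem_orthogonal (hW.weightedExp_mem_pastClosure hn v) hrK] at h1
    simpa [hpi] using h1.symm
  · have h1 := hW.fourierC_eq_zero_of_mem (hBi.sub hRi) hyK hQy (n := l) (by omega)
    have h2 : fourierC (expSum b - R) l = fourierC (expSum b) l - fourierC R l :=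
      fourierC_sub hBi hRi l
    rw [h2, fourierC_expSum hb1, sub_eq_zero] at h1
    exact h1.symm
  · have h1 : wB - r ∈ closure (hW.pastSubmodule : Set (Lp F 2 circ)) := hyK
    rw [Metric.mem_closure_iff] at h1
    obtain ⟨δ, hδ, hlt⟩ : ∃ δ : ℝ, 0 < δ ∧ ENNReal.ofReal ((2 * Real.pi)⁻¹ * δ ^ 2) < ε := by
      have h2 : Filter.Tendsto (fun δ : ℝ => ENNReal.ofReal ((2 * Real.pi)⁻¹ * δ ^ 2))
          (nhdsWithin 0 (Ioi 0)) (nhds 0) := by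
        have : Continuous fun δ : ℝ => ENNReal.ofReal ((2 * Real.pi)⁻¹ * δ ^ 2) :=
          ENNReal.continuous_ofReal.comp (by fun_prop)
        have := this.tendsto 0
        simp only [ne_eq, OfNat.ofNat_ne_zero, not_false_eq_true, zero_pow, mul_zero,
          ENNReal.ofReal_zero] at this
        exact this.mono_left nhdsWithin_le_nhds
      obtain ⟨δ, h3, h4⟩ := ((h2.eventually (gt_mem_nhds hε)).and self_mem_nhdsWithin).exists
      exact ⟨δ, h4, h3⟩
    obtain ⟨s, hs, hds⟩ := h1 δ hδ
    obtain ⟨p, hp, hps⟩ := hW.exists_mem_pastPoly hs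
    refine ⟨p, hp, lt_of_le_of_lt ?_ hlt⟩
    rw [hW.weightedNormSq_eq_norm (y := wB - r - s)]
    · refine ENNReal.ofReal_le_ofReal ?_
      rw [dist_eq_norm] at hds
      gcongr
    · filter_upwards [hQy, hps, Lp.coeFn_sub (wB - r) s] with x h1 h2 h3
      rw [h3, Pi.sub_apply (expSum b - R), map_sub, h1, h2]
      rfl
  · obtain ⟨q, hq, hqe⟩ := hW.exists_mem_pastClosure hu happ
    rw [hW.weightedNormSq_eq_norm (g := expSum b - u) (y := wB - q),
      hW.weightedNormSq_eq_norm hQR, hW.weightedNormSq_eq_norm (g := expSum b - R - u)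
      (y := wB - r - q), ← ENNReal.ofReal_add (by positivity) (by positivity), ← mul_add]
    · congr 2
      have h1 : wB - q = r + (wB - r - q) := by abel
      rw [h1, sq, sq, sq]
      exact norm_add_sq_eq_norm_sq_add_norm_sq_of_inner_eq_zero (𝕜 := ℂ) _ _
        (hW.inner_eq_zero_of_mem hrK (sub_mem hyK hq))
    · filter_upwards [hQy, hqe, Lp.coeFn_sub (wB - r) q] with x h1 h2 h3
      rw [h3, Pi.sub_apply (expSum b - R), map_sub, h1, h2]
      rfl
    · filter_upwards [hwBe, hqe, Lp.coeFn_sub wB q] with x h1 h2 h3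
      rw [h3, Pi.sub_apply, Pi.sub_apply, map_sub, h1, h2]
  · rw [henergy]; positivity
  · rw [hW.weightedNormSq_eq_norm hQR, henergy]

end IsRegularWeight

end Weight

/-! ### Approximation in weighted spaces and the first variation of the prediction error -/

section Weight

variable {F : Type*} [NormedAddCommGroup F] [InnerProductSpace ℂ F]

theorem fejer_mem_pastPoly {H : ℝ → F} (hH : ∀ n : ℤ, 0 ≤ n → fourierC H n = 0) (N : ℕ) :
    fejer H N ∈ pastPoly F := by
  have h : fejer H N = (N : ℂ)⁻¹ • ∑ a ∈ Finset.range N, ∑ b ∈ Finset.range N,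
      fun x => character ((a : ℤ) - b) x • fourierC H ((a : ℤ) - b) := by
    ext x
    simp [fejer, Finset.sum_apply]
  rw [h]
  refine Submodule.smul_mem _ _ (Submodule.sum_mem _ fun a _ => Submodule.sum_mem _ fun b _ => ?_)
  rcases lt_or_ge ((a : ℤ) - b) 0 with hab | hab
  · exact Submodule.subset_span ⟨_, _, hab, rfl⟩
  · rw [hH _ hab]
    simp only [smul_zero]
    exact zero_mem _

theorem re_inner_apply_le (A : F →L[ℂ] F) (u : F) :
    |(inner ℂ u (A u) : ℂ).re| ≤ ‖A‖ * ‖u‖ ^ 2 := by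
  calc _ ≤ ‖(inner ℂ u (A u) : ℂ)‖ := Complex.abs_re_le_norm _
    _ ≤ ‖u‖ * ‖A u‖ := norm_inner_le_norm _ _
    _ ≤ ‖u‖ * (‖A‖ * ‖u‖) := by gcongr; exact A.le_opNorm u
    _ = _ := by ring

theorem re_inner_apply_nonneg {A : F →L[ℂ] F} (hA : A.IsPositive) (u : F) :
    0 ≤ (inner ℂ u (A u) : ℂ).re :=
  hA.re_inner_nonneg_right u

theorem aestronglyMeasurable_re_inner {A : ℝ → F →L[ℂ] F} {u : ℝ → F}
    (hA : AEStronglyMeasurable A circ) (hu : AEStronglyMeasurable u circ) :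
    AEStronglyMeasurable (fun x => (inner ℂ (u x) (A x (u x)) : ℂ).re) circ :=
  Complex.continuous_re.comp_aestronglyMeasurable (hu.inner (aestronglyMeasurable_apply hA hu))

/-- Bounded functions with negative frequencies are approximable by trigonometric polynomials in
every weighted space. -/
theorem exists_pastPoly_lt_of_bounded [FiniteDimensional ℂ F] {W : ℝ → F →L[ℂ] F}
    (hW : Integrable W circ) {H : ℝ → F} (hH : AEStronglyMeasurable H circ) {M : ℝ}
    (hM : ∀ᵐ x ∂circ, ‖H x‖ ≤ M) (hc : ∀ n : ℤ, 0 ≤ n → fourierC H n = 0)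
    {ε : ENNReal} (hε : 0 < ε) : ∃ p ∈ pastPoly F, weightedNormSq W (H - p) < ε := by
  -- Fejér means keep the negative spectrum and the bound M, so ‖W‖ (2M)² dominates the weighted
  -- errors; no inverse of W is involved.
  obtain ⟨ns, -, hns⟩ := exists_fejer_tendsto_ae (MemLp.of_bound (p := 2) hH M hM)
  have hlim : Filter.Tendsto (fun i => ∫⁻ x, ENNReal.ofReal
      (inner ℂ ((H - fejer H (ns i)) x) (W x ((H - fejer H (ns i)) x)) : ℂ).re ∂circ)
      Filter.atTop (nhds (∫⁻ _, 0 ∂circ)) := by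
    refine tendsto_lintegral_of_dominated_convergence'
      (fun x => ENNReal.ofReal (‖W x‖ * (2 * M) ^ 2)) (fun i => ?_) (fun i => ?_) ?_ ?_
    · exact (aestronglyMeasurable_re_inner hW.aestronglyMeasurable
        (hH.sub (continuous_fejer H _).aestronglyMeasurable)).aemeasurable.ennreal_ofReal
    · filter_upwards [hM] with x hx
      refine ENNReal.ofReal_le_ofReal ((le_abs_self _).trans ((re_inner_apply_le _ _).trans ?_))
      gcongr
      refine (norm_sub_le _ _).trans ?_
      have := norm_fejer_le_of_bound hH hM (ns i) x
      linarith
    · rw [← lt_top_iff_ne_top]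
      exact (hW.norm.mul_const _).lintegral_lt_top
    · filter_upwards [hns] with x hx
      have h1 : Filter.Tendsto (fun i => (H - fejer H (ns i)) x) Filter.atTop (nhds 0) := by
        have := (tendsto_const_nhds (x := H x)).sub hx
        rwa [sub_self] at this
      have h2 : Continuous fun u : F => ENNReal.ofReal (inner ℂ u (W x u) : ℂ).re :=
        ENNReal.continuous_ofReal.comp (Complex.continuous_re.comp
          (continuous_id.inner (W x).continuous))
      have := (h2.tendsto 0).comp h1
      simpa [Function.comp_def] using this
  have h3 := ENNReal.Tendsto.const_mul (a := ENNReal.ofReal (1 / (2 * Real.pi))) hlim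
    (Or.inr ENNReal.ofReal_ne_top)
  rw [lintegral_zero, mul_zero] at h3
  obtain ⟨i, hi⟩ := (h3.eventually (gt_mem_nhds hε)).exists
  exact ⟨fejer H (ns i), fejer_mem_pastPoly hc _, hi⟩

theorem weightedNormSq_eq_ofReal {W : ℝ → F →L[ℂ] F} (hW : ∀ᵐ x ∂circ, (W x).IsPositive)
    {g : ℝ → F} (hg : Integrable (fun x => (inner ℂ (g x) (W x (g x)) : ℂ).re) circ) :
    weightedNormSq W g = ENNReal.ofReal
      (1 / (2 * Real.pi) * ∫ x, (inner ℂ (g x) (W x (g x)) : ℂ).re ∂circ) := by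
  unfold weightedNormSq
  rw [ENNReal.ofReal_mul (by positivity), ofReal_integral_eq_lintegral_ofReal hg]
  exact hW.mono fun x hx => hx.re_inner_nonneg_right _

variable [CompleteSpace F] [FiniteDimensional ℂ F]

/-- A lower bound for the values of a regular weight. -/
def weightFloor (W : ℝ → F →L[ℂ] F) (x : ℝ) : ℝ := (1 + ‖Ring.inverse (W x)‖)⁻¹

omit [CompleteSpace F] [FiniteDimensional ℂ F] in
theorem weightFloor_pos (W : ℝ → F →L[ℂ] F) (x : ℝ) : 0 < weightFloor W x := by
  unfold weightFloor; positivity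

omit [CompleteSpace F] [FiniteDimensional ℂ F] in
theorem weightFloor_le_one (W : ℝ → F →L[ℂ] F) (x : ℝ) : weightFloor W x ≤ 1 :=
  inv_le_one_of_one_le₀ (by linarith [norm_nonneg (Ring.inverse (W x))])

omit [FiniteDimensional ℂ F] in
-- W is bounded below by 1/‖W^{-1}‖; the added 1 in the denominator keeps the floor in (0, 1], hence
-- bounded.
theorem weightFloor_mul_le {W : ℝ → F →L[ℂ] F} {x : ℝ} (hp : (W x).IsPositive)
    (hu : IsUnit (W x)) (u : F) :
    weightFloor W x * ‖u‖ ^ 2 ≤ (inner ℂ u (W x u) : ℂ).re := by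
  unfold weightFloor
  rw [inv_mul_le_iff₀ (by positivity)]
  have h1 := norm_sq_le_mul_re_inner hp hu u
  have h2 : 0 ≤ (inner ℂ u (W x u) : ℂ).re := hp.re_inner_nonneg_right u
  linarith

namespace IsRegularWeight

variable {W : ℝ → F →L[ℂ] F} (hW : IsRegularWeight W)

include hW

omit [CompleteSpace F] [FiniteDimensional ℂ F] in
theorem aestronglyMeasurable_weightFloor : AEStronglyMeasurable (weightFloor W) circ := by
  have : AEMeasurable (fun x => ‖Ring.inverse (W x)‖) circ :=
    hW.integrable_inverse.aestronglyMeasurable.norm.aemeasurable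
  exact ((this.const_add 1).inv).aestronglyMeasurable

omit [FiniteDimensional ℂ F] in
-- The perturbation is at most κ times the floor of W, so for |t|κ ≤ 1/2 it consumes at most half of
-- the form of W.
theorem coercive_add_smul {Ψ : ℝ → F →L[ℂ] F} {κ : ℝ}
    (hκ : ∀ᵐ x ∂circ, ‖Ψ x‖ ≤ κ * weightFloor W x) {t : ℝ} (ht : |t| * κ ≤ 1 / 2) :
    ∀ᵐ x ∂circ, ∀ u, 1 / 2 * (inner ℂ u (W x u) : ℂ).re ≤
      (inner ℂ u ((W x + (t : ℂ) • Ψ x) u) : ℂ).re := by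
  filter_upwards [hκ, hW.positive, hW.isUnit] with x h1 h2 h3 u
  have h4 := weightFloor_mul_le h2 h3 u
  have h5 := (re_inner_apply_le (Ψ x) u).trans
    (mul_le_mul_of_nonneg_right h1 (sq_nonneg ‖u‖))
  rw [_root_.add_apply, _root_.smul_apply, inner_add_right,
    inner_smul_right, Complex.add_re, Complex.re_ofReal_mul]
  have h6 : |t * (inner ℂ u (Ψ x u) : ℂ).re| ≤ 1 / 2 * (weightFloor W x * ‖u‖ ^ 2) := by
    rw [abs_mul]
    calc _ ≤ |t| * (κ * weightFloor W x * ‖u‖ ^ 2) := by gcongr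
      _ = (|t| * κ) * (weightFloor W x * ‖u‖ ^ 2) := by ring
      _ ≤ _ := mul_le_mul_of_nonneg_right ht
        (mul_nonneg (weightFloor_pos W x).le (sq_nonneg _))
  have h7 := (abs_le.1 h6).1
  linarith

theorem add_smul {Ψ : ℝ → F →L[ℂ] F} (hΨm : AEStronglyMeasurable Ψ circ)
    (hΨ : ∀ᵐ x ∂circ, IsSelfAdjoint (Ψ x)) {κ : ℝ} (hκ0 : 0 ≤ κ)
    (hκ : ∀ᵐ x ∂circ, ‖Ψ x‖ ≤ κ * weightFloor W x) {t : ℝ} (ht : |t| * κ ≤ 1 / 2) :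
    IsRegularWeight fun x => W x + (t : ℂ) • Ψ x := by
  have hco : ∀ᵐ x ∂circ, ∀ u, (1 / 2 * weightFloor W x) * ‖u‖ ^ 2 ≤
      (inner ℂ u ((W x + (t : ℂ) • Ψ x) u) : ℂ).re := by
    filter_upwards [hW.coercive_add_smul hκ ht, hW.positive, hW.isUnit] with x h1 h2 h3 u
    refine le_trans ?_ (h1 u)
    rw [mul_assoc]
    exact mul_le_mul_of_nonneg_left (weightFloor_mul_le h2 h3 u) (by norm_num)
  have hc : ∀ x, 0 < 1 / 2 * weightFloor W x := fun x =>
    mul_pos (by norm_num) (weightFloor_pos W x)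
  have hint : Integrable (fun x => W x + (t : ℂ) • Ψ x) circ := by
    have hΨi : Integrable Ψ circ := by
      refine Integrable.of_bound hΨm κ ?_
      filter_upwards [hκ] with x hx
      exact hx.trans (mul_le_of_le_one_right hκ0 (weightFloor_le_one W x))
    exact hW.integrable.add (hΨi.smul (t : ℂ))
  have hunit : ∀ᵐ x ∂circ, IsUnit (W x + (t : ℂ) • Ψ x) := by
    filter_upwards [hco] with x hx using isUnit_of_coercive (hc x) hx
  refine ⟨hint, ?_, hunit, ?_⟩
  · filter_upwards [hco, hΨ, hW.positive] with x h1 h2 h3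
    refine isPositive_of_coercive (h3.isSelfAdjoint.add ?_) (hc x) h1
    exact IsSelfAdjoint.smul (by simp [IsSelfAdjoint]) h2
  · refine (((integrable_const (1 : ℝ)).add hW.integrable_inverse.norm).const_mul 2).mono'
      (aestronglyMeasurable_inverse hint.aestronglyMeasurable hunit) ?_
    filter_upwards [hco] with x hx
    refine (norm_inverse_le_of_coercive (hc x) hx).trans (le_of_eq ?_)
    unfold weightFloor
    rw [mul_inv, inv_inv]
    norm_num [Pi.add_apply]

omit hW [CompleteSpace F] [FiniteDimensional ℂ F] in
theorem _root_.IsPredictionError.integrable_energy {b : ℕ → F} {R : ℝ → F}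
    (hR : IsPredictionError W b R) (hW : IsRegularWeight W) :
    Integrable (fun x => (inner ℂ (R x) (W x (R x)) : ℂ).re) circ := by
  obtain ⟨M, hM⟩ := hR.bounded
  refine Integrable.of_bound (aestronglyMeasurable_re_inner hW.integrable.aestronglyMeasurable
    hR.memLp.aestronglyMeasurable) M ?_
  filter_upwards [hM, hW.positive] with x h1 h2
  rwa [Real.norm_of_nonneg (re_inner_apply_nonneg h2 _)]

/-- A first-order expansion without differentiating the optimal error. With u = Rt - R,
orthogonality in L_2(W) gives ‖Rt‖² = ‖R‖² + ‖u‖², so the assumed inequality becomes ‖u‖² + t∫⟨Rt,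
ΨRt⟩ ≤ 0. Replacing Rt by R in the second term costs at most ‖u‖² plus a quantity of order t². -/
theorem le_of_weightedNormSq_le {b : ℕ → F} {R : ℝ → F} (hR : IsPredictionError W b R)
    (hb : Summable fun j => ‖b j‖)
    {Ψ : ℝ → F →L[ℂ] F} (hΨm : AEStronglyMeasurable Ψ circ)
    (hΨ : ∀ᵐ x ∂circ, IsSelfAdjoint (Ψ x)) {κ : ℝ} (hκ0 : 0 ≤ κ)
    (hκ : ∀ᵐ x ∂circ, ‖Ψ x‖ ≤ κ * weightFloor W x) {t : ℝ} (ht : |t| * κ ≤ 1 / 2)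
    {Rt : ℝ → F} (hRt : IsPredictionError (fun x => W x + (t : ℂ) • Ψ x) b Rt)
    (hle : weightedNormSq (fun x => W x + (t : ℂ) • Ψ x) Rt ≤ weightedNormSq W R) :
    t * ∫ x, (inner ℂ (R x) (Ψ x (R x)) : ℂ).re ∂circ ≤
      2 * t ^ 2 * κ ^ 2 * ∫ x, (inner ℂ (R x) (W x (R x)) : ℂ).re ∂circ := by
  have hWt := hW.add_smul hΨm hΨ hκ0 hκ ht
  have hco := hW.coercive_add_smul hκ ht
  have hWm := hW.integrable.aestronglyMeasurable
  have hRtm := hRt.memLp.aestronglyMeasurable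
  have hRm := hR.memLp.aestronglyMeasurable
  have iR := hR.integrable_energy hW
  have iRt' := hRt.integrable_energy hWt
  have iRt : Integrable (fun x => (inner ℂ (Rt x) (W x (Rt x)) : ℂ).re) circ := by
    refine (iRt'.const_mul 2).mono' (aestronglyMeasurable_re_inner hWm hRtm) ?_
    filter_upwards [hco, hW.positive] with x h1 h2
    rw [Real.norm_of_nonneg (re_inner_apply_nonneg h2 _)]
    linarith [h1 (Rt x)]
  have iu : Integrable
      (fun x => (inner ℂ ((Rt - R) x) (W x ((Rt - R) x)) : ℂ).re) circ := by
    refine ((iRt.const_mul 2).add (iR.const_mul 2)).mono'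
      (aestronglyMeasurable_re_inner hWm (hRtm.sub hRm)) ?_
    filter_upwards [hW.positive] with x h2
    rw [Real.norm_of_nonneg (re_inner_apply_nonneg h2 _)]
    exact re_inner_sub_le h2 _ _
  have iΨ : ∀ {g : ℝ → F}, AEStronglyMeasurable g circ →
      Integrable (fun x => (inner ℂ (g x) (W x (g x)) : ℂ).re) circ →
      Integrable (fun x => (inner ℂ (g x) (Ψ x (g x)) : ℂ).re) circ := by
    intro g hg hi
    refine (hi.const_mul κ).mono' (aestronglyMeasurable_re_inner hΨm hg) ?_
    filter_upwards [hκ, hW.positive, hW.isUnit] with x h1 h2 h3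
    refine (re_inner_apply_le _ _).trans ?_
    calc _ ≤ κ * weightFloor W x * ‖g x‖ ^ 2 := by gcongr
      _ = κ * (weightFloor W x * ‖g x‖ ^ 2) := by ring
      _ ≤ _ := by gcongr; exact weightFloor_mul_le h2 h3 _
  -- The predictor B - Rt of the perturbed problem is also in the past for W, because W is at most
  -- twice the perturbed weight.
  have hpyth := hR.pythagoras (expSum b - Rt)
    ((continuous_expSum hb).aestronglyMeasurable.sub hRtm) ?_
  swap
  · intro ε hε
    obtain ⟨p, hp, hlt⟩ := hRt.approx (ε / 2) (ENNReal.half_pos hε.ne')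
    refine ⟨p, hp, lt_of_le_of_lt ?_ ((ENNReal.lt_div_iff_mul_lt (by norm_num) (by norm_num)).1 hlt)⟩
    unfold weightedNormSq
    rw [mul_assoc]
    gcongr
    rw [← lintegral_mul_const' _ _ (by norm_num)]
    refine lintegral_mono_ae ?_
    filter_upwards [hco] with x hx
    rw [show (2 : ENNReal) = ENNReal.ofReal 2 by simp, ← ENNReal.ofReal_mul' (by norm_num)]
    refine ENNReal.ofReal_le_ofReal ?_
    linarith [hx ((expSum b - Rt - p) x)]
  rw [show expSum b - (expSum b - Rt) = Rt by abel,
    show expSum b - R - (expSum b - Rt) = Rt - R by abel,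
    weightedNormSq_eq_ofReal hW.positive iR, weightedNormSq_eq_ofReal hW.positive iRt,
    weightedNormSq_eq_ofReal hW.positive iu] at hpyth
  have nn : ∀ g : ℝ → F, 0 ≤ ∫ x, (inner ℂ (g x) (W x (g x)) : ℂ).re ∂circ := fun g =>
    integral_nonneg_of_ae (hW.positive.mono fun x hx => hx.re_inner_nonneg_right _)
  have hpi : 0 < 1 / (2 * Real.pi) := by positivity
  rw [← ENNReal.ofReal_add (mul_nonneg hpi.le (nn _)) (mul_nonneg hpi.le (nn _)), ← mul_add,
    ENNReal.ofReal_eq_ofReal_iff (mul_nonneg hpi.le (nn _))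
      (mul_nonneg hpi.le (add_nonneg (nn _) (nn _)))] at hpyth
  have hp := mul_left_cancel₀ hpi.ne' hpyth
  rw [weightedNormSq_eq_ofReal hW.positive iR, weightedNormSq_eq_ofReal hWt.positive iRt',
    ENNReal.ofReal_le_ofReal_iff (mul_nonneg hpi.le (nn _))] at hle
  have hle' := le_of_mul_le_mul_left hle hpi
  have hsplit : ∫ x, (inner ℂ (Rt x) ((W x + (t : ℂ) • Ψ x) (Rt x)) : ℂ).re ∂circ =
      (∫ x, (inner ℂ (Rt x) (W x (Rt x)) : ℂ).re ∂circ) +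
        t * ∫ x, (inner ℂ (Rt x) (Ψ x (Rt x)) : ℂ).re ∂circ := by
    rw [← integral_const_mul, ← integral_add iRt ((iΨ hRtm iRt).const_mul t)]
    refine integral_congr_ae (Filter.Eventually.of_forall fun x => ?_)
    simp only [_root_.add_apply, _root_.smul_apply, inner_add_right,
      inner_smul_right, Complex.add_re, Complex.re_ofReal_mul]
  rw [hsplit, hp] at hle'
  -- The form of W at u is spent in two halves, one on the quadratic term in u and one on the cross
  -- term; completing the square in the latter leaves 2t²κ²⟨R, WR⟩.
  have hpt : ∀ᵐ x ∂circ, t * (inner ℂ (R x) (Ψ x (R x)) : ℂ).re ≤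
      t * (inner ℂ (Rt x) (Ψ x (Rt x)) : ℂ).re +
      ((inner ℂ ((Rt - R) x) (W x ((Rt - R) x)) : ℂ).re +
        2 * t ^ 2 * κ ^ 2 * (inner ℂ (R x) (W x (R x)) : ℂ).re) := by
    filter_upwards [hκ, hW.positive, hW.isUnit, hΨ] with x h1 h2 h3 h4
    set u := (Rt - R) x with hu
    have hRtx : Rt x = R x + u := by rw [hu, Pi.sub_apply]; abel
    have e1 : (inner ℂ (Rt x) (Ψ x (Rt x)) : ℂ).re = (inner ℂ (R x) (Ψ x (R x)) : ℂ).re +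
        2 * (inner ℂ u (Ψ x (R x)) : ℂ).re + (inner ℂ u (Ψ x u) : ℂ).re := by
      have hs : (inner ℂ (R x) (Ψ x u) : ℂ).re = (inner ℂ u (Ψ x (R x)) : ℂ).re := by
        have h5 : inner ℂ (Ψ x (R x)) u = inner ℂ (R x) (Ψ x u) :=
          ContinuousLinearMap.isSelfAdjoint_iff_isSymmetric.1 h4 (R x) u
        rw [← h5, ← inner_conj_symm, Complex.conj_re]
      rw [hRtx, map_add, inner_add_left, inner_add_right, inner_add_right]
      simp only [Complex.add_re]
      rw [hs]; ring
    have hω := weightFloor_pos W x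
    have e2 := re_inner_apply_le (Ψ x) u
    have e3 : |(inner ℂ u (Ψ x (R x)) : ℂ).re| ≤ ‖Ψ x‖ * (‖u‖ * ‖R x‖) := by
      calc _ ≤ ‖(inner ℂ u (Ψ x (R x)) : ℂ)‖ := Complex.abs_re_le_norm _
        _ ≤ ‖u‖ * ‖Ψ x (R x)‖ := norm_inner_le_norm _ _
        _ ≤ ‖u‖ * (‖Ψ x‖ * ‖R x‖) := by gcongr; exact (Ψ x).le_opNorm _
        _ = _ := by ring
    have e4 := weightFloor_mul_le h2 h3 u
    have e5 := weightFloor_mul_le h2 h3 (R x)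
    have e6 : |t * (inner ℂ u (Ψ x u) : ℂ).re| ≤ 1 / 2 * (weightFloor W x * ‖u‖ ^ 2) := by
      rw [abs_mul]
      calc _ ≤ |t| * (κ * weightFloor W x * ‖u‖ ^ 2) :=
            mul_le_mul_of_nonneg_left (e2.trans (by gcongr)) (abs_nonneg _)
        _ = (|t| * κ) * (weightFloor W x * ‖u‖ ^ 2) := by ring
        _ ≤ _ := mul_le_mul_of_nonneg_right ht (by positivity)
    have e7 : |t * (2 * (inner ℂ u (Ψ x (R x)) : ℂ).re)| ≤ weightFloor W x *
        (1 / 2 * ‖u‖ ^ 2 + 2 * t ^ 2 * κ ^ 2 * ‖R x‖ ^ 2) := by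
      rw [abs_mul, abs_mul, abs_two]
      calc _ ≤ |t| * (2 * (κ * weightFloor W x * (‖u‖ * ‖R x‖))) :=
            mul_le_mul_of_nonneg_left (mul_le_mul_of_nonneg_left (e3.trans (by gcongr))
              (by norm_num)) (abs_nonneg _)
        _ = weightFloor W x * (2 * (|t| * κ * ‖R x‖) * ‖u‖) := by ring
        _ ≤ _ := by
            gcongr
            rw [← sq_abs t]
            nlinarith [sq_nonneg (‖u‖ - 2 * (|t| * κ * ‖R x‖))]
    have e8 : 2 * t ^ 2 * κ ^ 2 * (weightFloor W x * ‖R x‖ ^ 2) ≤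
        2 * t ^ 2 * κ ^ 2 * (inner ℂ (R x) (W x (R x)) : ℂ).re :=
      mul_le_mul_of_nonneg_left e5 (by positivity)
    rw [e1]
    have e9 := (abs_le.1 e6).1
    have e10 := (abs_le.1 e7).1
    nlinarith
  have hmono := integral_mono_ae ((iΨ hRm iR).const_mul t)
    (((iΨ hRtm iRt).const_mul t).add (iu.add (iR.const_mul (2 * t ^ 2 * κ ^ 2)))) hpt
  rw [integral_add' ((iΨ hRtm iRt).const_mul t) (iu.add (iR.const_mul _)),
    integral_add' iu (iR.const_mul _), integral_const_mul, integral_const_mul,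
    integral_const_mul] at hmono
  linarith

/-- If no small multiple of a perturbation increases the prediction error, then the derivative of
the prediction error along the perturbation vanishes. -/
theorem integral_eq_zero_of_weightedNormSq_le {b : ℕ → F} {R : ℝ → F}
    (hR : IsPredictionError W b R) (hb : Summable fun j => ‖b j‖)
    {Ψ : ℝ → F →L[ℂ] F} (hΨm : AEStronglyMeasurable Ψ circ)
    (hΨ : ∀ᵐ x ∂circ, IsSelfAdjoint (Ψ x)) {κ : ℝ} (hκ0 : 0 ≤ κ)
    (hκ : ∀ᵐ x ∂circ, ‖Ψ x‖ ≤ κ * weightFloor W x)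
    (hle : ∀ t : ℝ, |t| * κ ≤ 1 / 2 →
      ∃ Rt, IsPredictionError (fun x => W x + (t : ℂ) • Ψ x) b Rt ∧
        weightedNormSq (fun x => W x + (t : ℂ) • Ψ x) Rt ≤ weightedNormSq W R) :
    ∫ x, (inner ℂ (R x) (Ψ x (R x)) : ℂ).re ∂circ = 0 := by
  set D := ∫ x, (inner ℂ (R x) (Ψ x (R x)) : ℂ).re ∂circ
  set c := 2 * κ ^ 2 * ∫ x, (inner ℂ (R x) (W x (R x)) : ℂ).re ∂circ with hc
  have key : ∀ t : ℝ, |t| * κ ≤ 1 / 2 → t * D ≤ c * t ^ 2 := by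
    intro t ht
    obtain ⟨Rt, h1, h2⟩ := hle t ht
    have := hW.le_of_weightedNormSq_le hR hb hΨm hΨ hκ0 hκ ht h1 h2
    rw [hc]; linarith
  -- Using t = s and t = -s bounds the derivative on both sides by a multiple of s.
  have h1 : ∀ s : ℝ, 0 < s → s * κ ≤ 1 / 2 → |D| ≤ c * s := by
    intro s hs hsκ
    have h2 := key s (by rwa [abs_of_pos hs])
    have h3 := key (-s) (by rwa [abs_neg, abs_of_pos hs])
    rw [abs_le]
    constructor
    · refine le_of_mul_le_mul_left ?_ hs; linarith
    · refine le_of_mul_le_mul_left ?_ hs; linarith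
  have h2 : Filter.Tendsto (fun s : ℝ => c * s) (nhdsWithin 0 (Ioi 0)) (nhds 0) := by
    have : Continuous fun s : ℝ => c * s := by fun_prop
    have := this.tendsto 0
    rw [mul_zero] at this
    exact this.mono_left nhdsWithin_le_nhds
  have h3 : ∀ᶠ s in nhdsWithin (0 : ℝ) (Ioi 0), s * κ ≤ 1 / 2 := by
    have : Continuous fun s : ℝ => s * κ := by fun_prop
    have := this.tendsto 0
    rw [zero_mul] at this
    exact (this.mono_left nhdsWithin_le_nhds).eventually (ge_mem_nhds (by norm_num))
  have h4 : |D| ≤ 0 := by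
    refine ge_of_tendsto h2 ?_
    filter_upwards [h3, self_mem_nhdsWithin] with s h5 h6 using h1 s h6 h5
  exact abs_nonpos_iff.1 h4

end IsRegularWeight

end Weight

/-! ### Trace pairing and constancy of R R^* -/

section Trace

variable {F : Type*} [NormedAddCommGroup F] [InnerProductSpace ℂ F] [FiniteDimensional ℂ F]

/-- The real part of the trace of `B M`. -/
def tracePairing (B : F →L[ℂ] F) : (F →L[ℂ] F) →L[ℝ] ℝ :=
  Complex.reCLM ∘L ((LinearMap.toContinuousLinearMap
    (LinearMap.trace ℂ F ∘ₗ ContinuousLinearMap.coeLM ℂ ∘ₗ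
      LinearMap.mulLeft ℂ B)).restrictScalars ℝ)

theorem tracePairing_apply (B M : F →L[ℂ] F) :
    tracePairing B M = (LinearMap.trace ℂ F ((B ∘L M : F →L[ℂ] F) : F →ₗ[ℂ] F)).re := rfl

theorem tracePairing_eq_sum {ι : Type*} [Fintype ι] (e : OrthonormalBasis ι ℂ F)
    (B M : F →L[ℂ] F) :
    tracePairing B M = ∑ i, (inner ℂ (e i) (B (M (e i))) : ℂ).re := by
  rw [tracePairing_apply, LinearMap.trace_eq_sum_inner _ e, Complex.re_sum]
  rfl

/-- Expresses quadratic forms at u as pairings with u u^*, so that the variation becomes linear in R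
R^*. -/
theorem tracePairing_rankOne (u : F) (M : F →L[ℂ] F) :
    tracePairing (InnerProductSpace.rankOne ℂ u u) M = (inner ℂ u (M u) : ℂ).re := by
  rw [tracePairing_apply, ContinuousLinearMap.toLinearMap_comp, LinearMap.trace_comp_comm',
    ← ContinuousLinearMap.toLinearMap_comp, InnerProductSpace.comp_rankOne,
    InnerProductSpace.trace_rankOne]

theorem tracePairing_comm (B M : F →L[ℂ] F) : tracePairing B M = tracePairing M B := by
  rw [tracePairing_apply, ContinuousLinearMap.toLinearMap_comp, LinearMap.trace_comp_comm',
    ← ContinuousLinearMap.toLinearMap_comp, tracePairing_apply]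

/-- On self-adjoint operators the pairing is the Hilbert–Schmidt inner product; positivity and
definiteness follow. -/
theorem tracePairing_self [CompleteSpace F] {ι : Type*} [Fintype ι] (e : OrthonormalBasis ι ℂ F)
    {X : F →L[ℂ] F} (hX : IsSelfAdjoint X) : tracePairing X X = ∑ i, ‖X (e i)‖ ^ 2 := by
  rw [tracePairing_eq_sum e]
  refine Finset.sum_congr rfl fun i _ => ?_
  have h : inner ℂ (X (e i)) (X (e i)) = inner ℂ (e i) (X (X (e i))) :=
    ContinuousLinearMap.isSelfAdjoint_iff_isSymmetric.1 hX (e i) (X (e i))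
  rw [← h, inner_self_eq_norm_sq_to_K]
  norm_cast

theorem tracePairing_self_nonneg [CompleteSpace F] {X : F →L[ℂ] F} (hX : IsSelfAdjoint X) :
    0 ≤ tracePairing X X := by
  rw [tracePairing_self (stdOrthonormalBasis ℂ F) hX]; positivity

theorem eq_zero_of_tracePairing_self [CompleteSpace F] {X : F →L[ℂ] F} (hX : IsSelfAdjoint X)
    (h : tracePairing X X = 0) : X = 0 := by
  rw [tracePairing_self (stdOrthonormalBasis ℂ F) hX,
    Finset.sum_eq_zero_iff_of_nonneg fun i _ => by positivity] at h
  apply ContinuousLinearMap.coe_injective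
  refine (stdOrthonormalBasis ℂ F).toBasis.ext fun i => ?_
  simpa using h i (Finset.mem_univ i)

omit [FiniteDimensional ℂ F] in
theorem isSelfAdjoint_rankOne [CompleteSpace F] (u : F) :
    IsSelfAdjoint (InnerProductSpace.rankOne ℂ u u) :=
  (InnerProductSpace.isPositive_rankOne_self u).isSelfAdjoint

omit [FiniteDimensional ℂ F] in
theorem continuous_rankOne_self :
    Continuous fun u : F => InnerProductSpace.rankOne ℂ u u := by
  have h : Continuous fun u : F => ContinuousLinearMap.smulRightL ℂ F F (innerSL ℂ u) :=
    (ContinuousLinearMap.smulRightL ℂ F F).continuous.comp (innerSL ℂ).continuous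
  exact h.clm_apply continuous_id

omit [FiniteDimensional ℂ F] in
theorem isSelfAdjoint_integral [CompleteSpace F] {G : ℝ → F →L[ℂ] F}
    (h : ∀ᵐ x ∂circ, IsSelfAdjoint (G x)) : IsSelfAdjoint (∫ x, G x ∂circ) := by
  have h1 := (starL' ℝ : (F →L[ℂ] F) ≃L[ℝ] (F →L[ℂ] F)).integral_comp_comm (μ := circ) G
  rw [IsSelfAdjoint]
  refine Eq.trans h1.symm (integral_congr_ae ?_)
  filter_upwards [h] with x hx using hx

theorem tracePairing_smul_self (B M : F →L[ℂ] F) (c : ℝ) :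
    tracePairing B ((c : ℂ) • M) = c * tracePairing B M := by
  have : (c : ℂ) • M = c • M := by ext v; simp
  rw [this, map_smul, smul_eq_mul]

/-- If the prediction error cannot be increased by perturbations with integral orthogonal to `V`,
then `R R^*` is constant and belongs to `V`. -/
theorem IsRegularWeight.exists_rankOne_eq [CompleteSpace F] {W : ℝ → F →L[ℂ] F}
    (hW : IsRegularWeight W) {b : ℕ → F} {R : ℝ → F} (hR : IsPredictionError W b R)
    (hb : Summable fun j => ‖b j‖) {V : Set (F →L[ℂ] F)} (hV : ∀ A ∈ V, IsSelfAdjoint A)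
    (hproj : ∀ N : F →L[ℂ] F, IsSelfAdjoint N →
      ∃ A ∈ V, ∀ B ∈ V, tracePairing B (N - A) = 0)
    (hopt : ∀ Ψ : ℝ → F →L[ℂ] F, Integrable Ψ circ → (∀ᵐ x ∂circ, IsSelfAdjoint (Ψ x)) →
      (∀ B ∈ V, tracePairing B (∫ x, Ψ x ∂circ) = 0) →
      ∀ t : ℝ, IsRegularWeight (fun x => W x + (t : ℂ) • Ψ x) →
      ∃ Rt, IsPredictionError (fun x => W x + (t : ℂ) • Ψ x) b Rt ∧
        weightedNormSq (fun x => W x + (t : ℂ) • Ψ x) Rt ≤ weightedNormSq W R) :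
    ∃ A ∈ V, ∀ᵐ x ∂circ, InnerProductSpace.rankOne ℂ (R x) (R x) = A := by
  obtain ⟨M, hM⟩ := hR.bounded
  -- One factor of the floor absorbs ‖R‖², as floor · ‖R‖² ≤ ⟨R, WR⟩ ≤ M; the other leaves the
  -- perturbation small relative to W.
  set ρ : ℝ → ℝ := fun x => weightFloor W x ^ 2 with hρ
  have hω := hW.aestronglyMeasurable_weightFloor
  have hω0 := weightFloor_pos W
  have hω1 := weightFloor_le_one W
  have hρ0 : ∀ x, 0 < ρ x := fun x => pow_pos (hω0 x) 2
  have hρm : AEStronglyMeasurable ρ circ := hω.pow 2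
  have hρω : ∀ x, ρ x ≤ weightFloor W x := fun x => by
    rw [hρ]; simp only [sq]; exact mul_le_of_le_one_left (hω0 x).le (hω1 x)
  have hρi : Integrable ρ circ := Integrable.of_bound hρm 1 (Filter.Eventually.of_forall fun x => by
    rw [Real.norm_of_nonneg (hρ0 x).le]; exact (hρω x).trans (hω1 x))
  have hI : 0 < ∫ x, ρ x ∂circ := by
    rw [integral_pos_iff_support_of_nonneg (fun x => (hρ0 x).le) hρi]
    have : Function.support ρ = univ := by
      ext x; simp [(hρ0 x).ne']
    rw [this]
    unfold circ
    rw [Measure.restrict_apply_univ]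
    simp [Real.pi_pos]
  set G : ℝ → F →L[ℂ] F := fun x => (ρ x : ℂ) • InnerProductSpace.rankOne ℂ (R x) (R x) with hG
  have hRR : AEStronglyMeasurable (fun x => InnerProductSpace.rankOne ℂ (R x) (R x)) circ :=
    continuous_rankOne_self.comp_aestronglyMeasurable hR.memLp.aestronglyMeasurable
  have hρc : AEStronglyMeasurable (fun x => (ρ x : ℂ)) circ :=
    Complex.continuous_ofReal.comp_aestronglyMeasurable hρm
  have hGn : ∀ᵐ x ∂circ, ‖G x‖ ≤ |M| * weightFloor W x := by
    filter_upwards [hM, hW.positive, hW.isUnit] with x h1 h2 h3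
    rw [hG]
    simp only [norm_smul, InnerProductSpace.norm_rankOne, Complex.norm_real]
    rw [Real.norm_of_nonneg (hρ0 x).le]
    have h4 := (weightFloor_mul_le h2 h3 (R x)).trans (h1.trans (le_abs_self M))
    calc _ = weightFloor W x * ‖R x‖ ^ 2 * weightFloor W x := by rw [hρ]; ring
      _ ≤ _ := mul_le_mul_of_nonneg_right h4 (hω0 x).le
  have hGi : Integrable G circ := by
    refine Integrable.of_bound (hρc.smul hRR) |M| ?_
    filter_upwards [hGn] with x hx
    exact hx.trans (mul_le_of_le_one_right (abs_nonneg M) (hω1 x))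
  have hsmul : ∀ (c : ℝ) {A : F →L[ℂ] F}, IsSelfAdjoint A → IsSelfAdjoint ((c : ℂ) • A) :=
    fun c A hA => IsSelfAdjoint.smul (by simp [IsSelfAdjoint]) hA
  -- The ρ-weighted average of R R^*; its projection A is the candidate constant value.
  have hN : IsSelfAdjoint (((∫ x, ρ x ∂circ)⁻¹ : ℝ) • ∫ x, G x ∂circ) := by
    refine IsSelfAdjoint.smul (by simp [IsSelfAdjoint]) (isSelfAdjoint_integral ?_)
    exact Filter.Eventually.of_forall fun x => hsmul _ (isSelfAdjoint_rankOne _)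
  obtain ⟨A, hA, hAV⟩ := hproj _ hN
  refine ⟨A, hA, ?_⟩
  set X : ℝ → F →L[ℂ] F := fun x => InnerProductSpace.rankOne ℂ (R x) (R x) - A with hX
  have hXs : ∀ x, IsSelfAdjoint (X x) := fun x => (isSelfAdjoint_rankOne _).sub (hV A hA)
  set Ψ : ℝ → F →L[ℂ] F := fun x => (ρ x : ℂ) • X x with hΨ
  have hΨs : ∀ x, IsSelfAdjoint (Ψ x) := fun x => hsmul _ (hXs x)
  have hΨn : ∀ᵐ x ∂circ, ‖Ψ x‖ ≤ (|M| + ‖A‖) * weightFloor W x := by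
    filter_upwards [hGn] with x hx
    have h1 : Ψ x = G x - (ρ x : ℂ) • A := smul_sub _ _ _
    rw [h1, add_mul]
    refine (norm_sub_le _ _).trans (add_le_add hx ?_)
    rw [norm_smul, Complex.norm_real, Real.norm_of_nonneg (hρ0 x).le, mul_comm]
    exact mul_le_mul_of_nonneg_left (hρω x) (norm_nonneg _)
  have hρA : Integrable (fun x => (ρ x : ℂ) • A) circ := hρi.ofReal.smul_const A
  have hΨe : Ψ = fun x => G x - (ρ x : ℂ) • A := funext fun x => smul_sub _ _ _
  have hΨi : Integrable Ψ circ := by rw [hΨe]; exact hGi.sub hρA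
  -- The integral of Ψ is ∫ ρ times (average - A), which is orthogonal to V by the choice of A, so Ψ
  -- is an admissible direction.
  have hΨI : ∫ x, Ψ x ∂circ = (∫ x, ρ x ∂circ) • (((∫ x, ρ x ∂circ)⁻¹ : ℝ) • (∫ x, G x ∂circ) - A) := by
    rw [smul_sub, smul_smul, mul_inv_cancel₀ hI.ne', one_smul, hΨe, integral_sub hGi hρA,
      integral_smul_const, integral_complex_ofReal]
    congr 1
  have hΨV : ∀ B ∈ V, tracePairing B (∫ x, Ψ x ∂circ) = 0 := by
    intro B hB
    rw [hΨI, map_smul, hAV B hB, smul_zero]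
  have hzero : ∫ x, (inner ℂ (R x) (Ψ x (R x)) : ℂ).re ∂circ = 0 := by
    refine hW.integral_eq_zero_of_weightedNormSq_le hR hb hΨi.aestronglyMeasurable
      (Filter.Eventually.of_forall hΨs) (κ := |M| + ‖A‖) (by positivity) hΨn fun t ht => ?_
    exact hopt Ψ hΨi (Filter.Eventually.of_forall hΨs) hΨV t
      (hW.add_smul hΨi.aestronglyMeasurable (Filter.Eventually.of_forall hΨs) (by positivity)
        hΨn ht)
  -- The extra term pairing A with Ψ integrates to zero because A ∈ V. The vanishing variation is
  -- thus the integral of ρ times a squared Hilbert–Schmidt norm.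
  have hpt : ∀ x, ρ x * tracePairing (X x) (X x) =
      (inner ℂ (R x) (Ψ x (R x)) : ℂ).re - tracePairing A (Ψ x) := by
    intro x
    rw [← tracePairing_rankOne, hΨ]
    simp only []
    rw [tracePairing_smul_self, tracePairing_smul_self, ← mul_sub, 
      tracePairing_comm (InnerProductSpace.rankOne ℂ (R x) (R x)) (X x),
      tracePairing_comm A (X x), ← map_sub]
  have hnorm : Integrable (fun x => (inner ℂ (R x) (Ψ x (R x)) : ℂ).re) circ := by
    refine ((hR.integrable_energy hW).const_mul (|M| + ‖A‖)).mono' (aestronglyMeasurable_re_inner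
      hΨi.aestronglyMeasurable hR.memLp.aestronglyMeasurable) ?_
    filter_upwards [hΨn, hW.positive, hW.isUnit] with x h1 h2 h3
    refine (re_inner_apply_le _ _).trans ?_
    calc _ ≤ (|M| + ‖A‖) * weightFloor W x * ‖R x‖ ^ 2 := by gcongr
      _ = (|M| + ‖A‖) * (weightFloor W x * ‖R x‖ ^ 2) := by ring
      _ ≤ _ := by gcongr; exact weightFloor_mul_le h2 h3 _
  have hAi : Integrable (fun x => tracePairing A (Ψ x)) circ :=
    (tracePairing A).integrable_comp hΨi
  have hint : ∫ x, ρ x * tracePairing (X x) (X x) ∂circ = 0 := by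
    simp_rw [hpt]
    rw [integral_sub hnorm hAi, hzero, (tracePairing A).integral_comp_comm hΨi, hΨV A hA, sub_zero]
  have hi : Integrable (fun x => ρ x * tracePairing (X x) (X x)) circ := by
    simp_rw [hpt]; exact hnorm.sub hAi
  rw [integral_eq_zero_iff_of_nonneg
    (fun x => mul_nonneg (hρ0 x).le (tracePairing_self_nonneg (hXs x))) hi] at hint
  filter_upwards [hint] with x hx
  have h1 : tracePairing (X x) (X x) = 0 := by
    have : ρ x * tracePairing (X x) (X x) = 0 := hx
    exact (mul_eq_zero.1 this).resolve_left (hρ0 x).ne'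
  exact sub_eq_zero.1 (eq_zero_of_tracePairing_self (hXs x) h1)

end Trace

/-! ### The weight -/

theorem weight_nonneg (d τ : ℕ) (x : ℝ) : 0 ≤ weight d τ x := by
  unfold weight
  rw [pow_mul x]
  positivity

theorem measurable_weight (d τ : ℕ) : Measurable (weight d τ) := by
  unfold weight; fun_prop

theorem measurable_incr (d τ : ℕ) : Measurable (incr d τ) := by
  unfold incr; fun_prop

theorem conj_incr (d τ : ℕ) (x : ℝ) :
    (starRingEnd ℂ) (incr d τ x) = (1 - exp (I * x * τ)) ^ d / (-(I * x)) ^ d := by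
  unfold incr
  rw [map_div₀, map_pow, map_pow, map_sub, map_one, ← Complex.exp_conj]
  simp

theorem norm_incr_sq (d τ : ℕ) (x : ℝ) : ‖incr d τ x‖ ^ 2 = weight d τ x := by
  rw [← Complex.norm_conj, conj_incr]
  unfold weight
  rw [norm_div, norm_pow, norm_pow, norm_neg, norm_mul, norm_I, one_mul, Complex.norm_real, div_pow,
    ← pow_mul, ← pow_mul, mul_comm d 2, pow_mul ‖x‖, Real.norm_eq_abs, sq_abs, ← pow_mul]

theorem ae_weight_pos {d τ : ℕ} (hτ : 0 < τ) : ∀ᵐ x ∂circ, 0 < weight d τ x := by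
  -- The zeros of 1 - e^{ixτ}; n = 0 gives x = 0, which also excludes the zero denominator.
  have hc : (range fun n : ℤ => (2 * Real.pi * n / τ : ℝ)).Countable := countable_range _
  have h0 : ∀ᵐ x ∂circ, x ∉ range fun n : ℤ => (2 * Real.pi * n / τ : ℝ) :=
    ae_restrict_of_ae (hc.ae_notMem volume)
  filter_upwards [h0] with x hx
  have hτ' : (τ : ℝ) ≠ 0 := by exact_mod_cast hτ.ne'
  have hx0 : x ≠ 0 := fun h => hx ⟨0, by simp [h]⟩
  have hx1 : 1 - exp (I * x * τ) ≠ 0 := by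
    intro h
    obtain ⟨n, hn⟩ := Complex.exp_eq_one_iff.1 (sub_eq_zero.1 h).symm
    refine hx ⟨n, ?_⟩
    have h2 : I * ((x * τ : ℝ) : ℂ) = I * ((2 * Real.pi * n : ℝ) : ℂ) := by
      push_cast; linear_combination hn
    have h3 := Complex.ofReal_injective (mul_left_cancel₀ I_ne_zero h2)
    rw [eq_comm]
    simp only
    rw [← h3]; field_simp
  unfold weight
  rw [pow_mul x]
  positivity

theorem norm_inner_apply_le_of_isPositive {F : Type*} [NormedAddCommGroup F]
    [InnerProductSpace ℂ F] [CompleteSpace F] {A : F →L[ℂ] F} (hA : A.IsPositive) (u v : F) :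
    ‖(inner ℂ u (A v) : ℂ)‖ ≤ (inner ℂ v (A v) : ℂ).re + (inner ℂ u (A u) : ℂ).re := by
  rw [inner_eq_inner_sqrt hA, re_inner_eq_norm_sqrt_sq hA, re_inner_eq_norm_sqrt_sq hA]
  refine (norm_inner_le_norm _ _).trans ?_
  nlinarith [sq_nonneg (‖CFC.sqrt A u‖ - ‖CFC.sqrt A v‖),
    sq_nonneg ‖CFC.sqrt A u‖, sq_nonneg ‖CFC.sqrt A v‖]

theorem ae_exists {p : ℝ → Prop} (h : ∀ᵐ x ∂circ, p x) : ∃ x, p x := by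
  have : circ ≠ 0 := by
    unfold circ; rw [Ne, Measure.restrict_eq_zero]; simp [Real.pi_pos]
  have : (ae circ).NeBot := ae_neBot.2 this
  exact h.exists

/-! ### Matrices of operators, weighted densities and finiteness of the index set -/

section Vec

variable {S : Set ℕ+}

instance [Finite S] : FiniteDimensional ℂ (Vec S) :=
  have := Fintype.ofFinite S
  (lpPiLpₗᵢ (E := fun _ : S => ℂ) (p := 2) (𝕜 := ℂ)).toLinearEquiv.symm.finiteDimensional

@[simp] theorem norm_unitVec (k : S) : ‖unitVec k‖ = 1 := by
  unfold unitVec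
  rw [lp.norm_single (by norm_num)]; simp

theorem unitVec_ne_zero (k : S) : unitVec k ≠ 0 := fun h => by
  have := norm_unitVec k
  rw [h, norm_zero] at this
  exact zero_ne_one this

/-- The basis of unit vectors. -/
def unitBasis (S : Set ℕ+) [Fintype S] : OrthonormalBasis S ℂ (Vec S) :=
  (HilbertBasis.ofRepr (LinearIsometryEquiv.refl ℂ (Vec S))).toOrthonormalBasis

theorem unitBasis_apply [Fintype S] (k : S) : unitBasis S k = unitVec k := by
  unfold unitBasis unitVec
  rw [HilbertBasis.coe_toOrthonormalBasis, ← HilbertBasis.repr_symm_single]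
  rfl

theorem opTrace_eq_trace [Finite S] (A : Op S) : opTrace A = LinearMap.trace ℂ (Vec S) A := by
  have := Fintype.ofFinite S
  unfold opTrace entry
  rw [tsum_fintype, LinearMap.trace_eq_sum_inner _ (unitBasis S)]
  simp [unitBasis_apply]

theorem eq_sum_entry [Fintype S] (A : Op S) :
    A = ∑ k : S, ∑ n : S, entry A k n • InnerProductSpace.rankOne ℂ (unitVec n) (unitVec k) := by
  apply ContinuousLinearMap.coe_injective
  refine (unitBasis S).toBasis.ext fun j => ?_
  have h1 := (unitBasis S).sum_repr' (A (unitVec j))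
  have h2 : ∀ k : S, inner ℂ (unitVec k) (unitVec j) = if k = j then (1 : ℂ) else 0 := by
    intro k
    rw [← unitBasis_apply, ← unitBasis_apply]
    exact orthonormal_iff_ite.1 (unitBasis S).orthonormal k j
  simp only [unitBasis_apply] at h1
  simp only [OrthonormalBasis.coe_toBasis, unitBasis_apply, ContinuousLinearMap.coe_coe,
    FunLike.coe_sum, Finset.sum_apply, FunLike.coe_smul, Pi.smul_apply,
    InnerProductSpace.rankOne_apply, h2]
  rw [Finset.sum_eq_single j (fun k _ hk => by simp [hk]) (by simp)]
  simp only [if_true, one_smul]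
  exact h1.symm

theorem norm_le_sum_entry [Fintype S] (A : Op S) : ‖A‖ ≤ ∑ k : S, ∑ n : S, ‖entry A k n‖ := by
  conv_lhs => rw [eq_sum_entry A]
  refine (norm_sum_le _ _).trans (Finset.sum_le_sum fun k _ => (norm_sum_le _ _).trans
    (Finset.sum_le_sum fun n _ => ?_))
  rw [norm_smul, InnerProductSpace.norm_rankOne, norm_unitVec, norm_unitVec]; simp

theorem norm_entry_le (A : Op S) (k n : S) : ‖entry A k n‖ ≤ ‖A‖ := by
  refine (norm_inner_le_norm _ _).trans ?_
  rw [norm_unitVec, one_mul]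
  exact (A.le_opNorm _).trans (by simp)

theorem norm_entry_le_of_isPositive {A : Op S} (hA : A.IsPositive) (k n : S) :
    ‖entry A k n‖ ≤ (entry A k k).re + (entry A n n).re :=
  norm_inner_apply_le_of_isPositive hA _ _

theorem entry_re_nonneg {A : Op S} (hA : A.IsPositive) (k : S) : 0 ≤ (entry A k k).re :=
  re_inner_apply_nonneg hA _

theorem posTrace_eq [Fintype S] {A : Op S} (hA : A.IsPositive) :
    posTrace A = ENNReal.ofReal (∑ k : S, (entry A k k).re) := by
  unfold posTrace
  rw [tsum_fintype, ENNReal.ofReal_sum_of_nonneg fun k _ => entry_re_nonneg hA k]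

/-- Entries of a positive operator are controlled by its diagonal. For finite S this makes trace
integrability the same as norm integrability. -/
theorem enorm_le_posTrace [Fintype S] {A : Op S} (hA : A.IsPositive) :
    ‖A‖ₑ ≤ ENNReal.ofReal (2 * Fintype.card S) * posTrace A := by
  rw [posTrace_eq hA, ← ENNReal.ofReal_mul (by positivity), ← ofReal_norm]
  refine ENNReal.ofReal_le_ofReal ((norm_le_sum_entry A).trans ?_)
  calc _ ≤ ∑ k : S, ∑ n : S, ((entry A k k).re + (entry A n n).re) :=
        Finset.sum_le_sum fun k _ => Finset.sum_le_sum fun n _ =>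
          norm_entry_le_of_isPositive hA k n
    _ = _ := by
        simp only [Finset.sum_add_distrib, Finset.sum_const, Finset.card_univ, nsmul_eq_mul,
          ← Finset.mul_sum]
        ring

theorem posTrace_le_enorm [Fintype S] {A : Op S} (hA : A.IsPositive) :
    posTrace A ≤ ENNReal.ofReal (Fintype.card S) * ‖A‖ₑ := by
  rw [posTrace_eq hA, ← ofReal_norm, ← ENNReal.ofReal_mul (by positivity)]
  refine ENNReal.ofReal_le_ofReal ?_
  calc _ ≤ ∑ k : S, ‖A‖ := Finset.sum_le_sum fun k _ =>
        (Complex.re_le_norm _).trans (norm_entry_le A k k)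
    _ = _ := by simp

theorem aestronglyMeasurable_of_entry [Finite S] {f : ℝ → Op S}
    (hf : ∀ k n : S, AEMeasurable (fun x => entry (f x) k n) circ) :
    AEStronglyMeasurable f circ := by
  have := Fintype.ofFinite S
  rw [show f = fun x => _ from funext fun x => eq_sum_entry (f x)]
  exact Finset.aestronglyMeasurable_fun_sum _ fun k _ =>
    Finset.aestronglyMeasurable_fun_sum _ fun n _ => (hf k n).aestronglyMeasurable.smul_const _

theorem aemeasurable_entry {f : ℝ → Op S} (hf : AEStronglyMeasurable f circ) (k n : S) :
    AEMeasurable (fun x => entry (f x) k n) circ := by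
  unfold entry
  exact (aestronglyMeasurable_const.inner
    (hf.apply_continuousLinearMap _)).aemeasurable

theorem isPositive_smul {A : Op S} (hA : A.IsPositive) {c : ℝ} (hc : 0 ≤ c) :
    ((c : ℂ) • A).IsPositive := by
  refine hA.smul_of_nonneg ?_
  exact_mod_cast hc

theorem posTrace_smul {A : Op S} {c : ℝ} (hc : 0 ≤ c) :
    posTrace ((c : ℂ) • A) = ENNReal.ofReal c * posTrace A := by
  unfold posTrace
  rw [← ENNReal.tsum_mul_left]
  congr 1; ext k
  rw [← ENNReal.ofReal_mul hc]
  congr 1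
  unfold entry
  rw [_root_.smul_apply, inner_smul_right, Complex.re_ofReal_mul]

theorem inverse_smul {A : Op S} {c : ℝ} (hc : c ≠ 0) (hA : IsUnit A) :
    Ring.inverse ((c : ℂ) • A) = ((c⁻¹ : ℝ) : ℂ) • Ring.inverse A := by
  have hc' : (c : ℂ) ≠ 0 := by exact_mod_cast hc
  have hu : IsUnit ((c : ℂ) • A) := (isUnit_smul_iff (Units.mk0 (c : ℂ) hc') A).2 hA
  refine hu.mul_left_cancel ?_
  rw [Ring.mul_inverse_cancel _ hu, smul_mul_smul_comm, Ring.mul_inverse_cancel _ hA,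
    ofReal_inv, mul_inv_cancel₀ hc', one_smul]

/-- The density multiplied by the weight. -/
def weighted (d τ : ℕ) (f : ℝ → Op S) (x : ℝ) : Op S := (weight d τ x : ℂ) • f x

theorem unweighted_weighted {d τ : ℕ} {x : ℝ} (hx : 0 < weight d τ x) (A : Op S) :
    (weight d τ x : ℂ) • (((weight d τ x)⁻¹ : ℝ) : ℂ) • A = A := by
  rw [smul_smul, ← ofReal_mul, mul_inv_cancel₀ hx.ne', ofReal_one, one_smul]

theorem invDensity_eq {d τ : ℕ} {f : ℝ → Op S} {x : ℝ} (hx : 0 < weight d τ x)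
    (hu : IsUnit (f x)) : invDensity d τ f x = Ring.inverse (weighted d τ f x) := by
  unfold weighted invDensity
  rw [inverse_smul hx.ne' hu, ofReal_inv]

theorem isUnit_weighted {d τ : ℕ} {f : ℝ → Op S} {x : ℝ} (hx : 0 < weight d τ x)
    (hu : IsUnit (f x)) : IsUnit (weighted d τ f x) :=
  (isUnit_smul_iff (Units.mk0 (weight d τ x : ℂ) (by exact_mod_cast hx.ne')) (f x)).2 hu

theorem integrable_of_posTrace [Finite S] {W : ℝ → Op S} (hW : AEStronglyMeasurable W circ)
    (hp : ∀ᵐ x ∂circ, (W x).IsPositive) (hi : ∫⁻ x, posTrace (W x) ∂circ < ⊤) :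
    Integrable W circ := by
  have := Fintype.ofFinite S
  refine ⟨hW, lt_of_le_of_lt (lintegral_mono_ae (hp.mono fun x hx => enorm_le_posTrace hx)) ?_⟩
  rw [lintegral_const_mul' _ _ ENNReal.ofReal_ne_top]
  exact ENNReal.mul_lt_top ENNReal.ofReal_lt_top hi

theorem lintegral_posTrace_lt_top [Finite S] {W : ℝ → Op S} (hW : Integrable W circ)
    (hp : ∀ᵐ x ∂circ, (W x).IsPositive) : ∫⁻ x, posTrace (W x) ∂circ < ⊤ := by
  have := Fintype.ofFinite S
  refine lt_of_le_of_lt (lintegral_mono_ae (hp.mono fun x hx => posTrace_le_enorm hx)) ?_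
  rw [lintegral_const_mul' _ _ ENNReal.ofReal_ne_top]
  exact ENNReal.mul_lt_top ENNReal.ofReal_lt_top hW.2

theorem IsSpectralDensity.aestronglyMeasurable [Finite S] {d τ : ℕ} {f : ℝ → Op S}
    (hf : IsSpectralDensity d τ f) : AEStronglyMeasurable f circ :=
  aestronglyMeasurable_of_entry hf.measurable

theorem isPositive_weighted {d τ : ℕ} {f : ℝ → Op S} (hf : ∀ᵐ x ∂circ, (f x).IsPositive) :
    ∀ᵐ x ∂circ, (weighted d τ f x).IsPositive :=
  hf.mono fun x hx => isPositive_smul hx (weight_nonneg d τ x)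

theorem aestronglyMeasurable_weight_smul {d τ : ℕ} {f : ℝ → Op S}
    (hf : AEStronglyMeasurable f circ) : AEStronglyMeasurable (weighted d τ f) circ :=
  (Complex.continuous_ofReal.measurable.comp (measurable_weight d τ)).aestronglyMeasurable.smul hf

theorem IsSpectralDensity.integrable_weighted [Finite S] {d τ : ℕ} {f : ℝ → Op S}
    (hf : IsSpectralDensity d τ f) : Integrable (weighted d τ f) circ := by
  refine integrable_of_posTrace (aestronglyMeasurable_weight_smul hf.aestronglyMeasurable)
    (isPositive_weighted hf.positive) ?_
  simp only [weighted, posTrace_smul (weight_nonneg d τ _)]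
  exact hf.kernel

theorem IsSpectralDensity.isRegularWeight [Finite S] {d τ : ℕ} (hτ : 0 < τ) {f : ℝ → Op S}
    (hf : IsSpectralDensity d τ f) (hm : Minimality d τ f) :
    IsRegularWeight (weighted d τ f) := by
  have hu : ∀ᵐ x ∂circ, IsUnit (weighted d τ f x) := by
    filter_upwards [ae_weight_pos (d := d) hτ, hm.1] with x h1 h2 using isUnit_weighted h1 h2
  have hp := isPositive_weighted (d := d) (τ := τ) hf.positive
  have hi := hf.integrable_weighted
  refine ⟨hi, hp, hu, ?_⟩
  refine integrable_of_posTrace (aestronglyMeasurable_inverse hi.aestronglyMeasurable hu) ?_ ?_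
  · filter_upwards [hp, hu] with x h1 h2 using isPositive_inverse h1 h2
  · refine lt_of_le_of_lt (le_of_eq (lintegral_congr_ae ?_)) hm.2
    filter_upwards [ae_weight_pos (d := d) hτ, hm.1] with x h1 h2
    unfold weighted
    rw [inverse_smul h1.ne' h2, posTrace_smul (inv_nonneg.2 h1.le)]

/-- The density corresponding to a weighted density. -/
def unweighted (d τ : ℕ) (W : ℝ → Op S) (x : ℝ) : Op S := (((weight d τ x)⁻¹ : ℝ) : ℂ) • W x

theorem weighted_unweighted {d τ : ℕ} (hτ : 0 < τ) (W : ℝ → Op S) :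
    weighted d τ (unweighted d τ W) =ᵐ[circ] W := by
  filter_upwards [ae_weight_pos (d := d) hτ] with x hx using unweighted_weighted hx _

/-- Realizes perturbed weights by actual spectral densities, so that they can compete in the class.
-/
theorem isSpectralDensity_unweighted [Finite S] {d τ : ℕ} (hτ : 0 < τ) {W : ℝ → Op S}
    (hW : Integrable W circ) (hp : ∀ᵐ x ∂circ, (W x).IsPositive) :
    IsSpectralDensity d τ (unweighted d τ W) := by
  have hm : AEStronglyMeasurable (unweighted d τ W) circ :=
    (Complex.continuous_ofReal.measurable.comp
      (measurable_weight d τ).inv).aestronglyMeasurable.smul hW.aestronglyMeasurable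
  refine ⟨aemeasurable_entry hm, ?_, ?_⟩
  · filter_upwards [hp] with x hx using
      isPositive_smul hx (inv_nonneg.2 (weight_nonneg d τ x))
  · refine lt_of_le_of_lt (le_of_eq (lintegral_congr_ae ?_)) (lintegral_posTrace_lt_top hW hp)
    filter_upwards [weighted_unweighted (d := d) hτ W] with x hx
    rw [← hx]
    exact (posTrace_smul (weight_nonneg d τ x)).symm

theorem minimality_unweighted [Finite S] {d τ : ℕ} (hτ : 0 < τ) {W : ℝ → Op S}
    (hW : IsRegularWeight W) : Minimality d τ (unweighted d τ W) := by
  have hu : ∀ᵐ x ∂circ, IsUnit (unweighted d τ W x) := by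
    filter_upwards [ae_weight_pos (d := d) hτ, hW.isUnit] with x h1 h2
    exact (isUnit_smul_iff (Units.mk0 (((weight d τ x)⁻¹ : ℝ) : ℂ)
      (by exact_mod_cast (inv_pos.2 h1).ne')) (W x)).2 h2
  refine ⟨hu, lt_of_le_of_lt (le_of_eq (lintegral_congr_ae ?_)) (lintegral_posTrace_lt_top
    hW.integrable_inverse ?_)⟩
  · filter_upwards [ae_weight_pos (d := d) hτ, hW.isUnit] with x h1 h2
    unfold unweighted
    rw [inverse_smul (inv_pos.2 h1).ne' h2, inv_inv, posTrace_smul h1.le, ← mul_assoc,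
      ← ENNReal.ofReal_mul (inv_nonneg.2 h1.le), inv_mul_cancel₀ h1.ne', ENNReal.ofReal_one,
      one_mul]
  · filter_upwards [hW.positive, hW.isUnit] with x h1 h2 using isPositive_inverse h1 h2

/-- Every diagonal entry of a positive invertible operator is at least 1/‖A^{-1}‖, so infinitely
many of them cannot have a finite sum. -/
theorem finite_of_posTrace_lt_top {A : Op S} (hA : A.IsPositive) (hu : IsUnit A)
    (ht : posTrace A ≠ ⊤) : Finite S := by
  by_contra hinf
  rw [not_finite_iff_infinite] at hinf
  have h1 : ∀ k : S, 1 ≤ ‖Ring.inverse A‖ * (entry A k k).re := by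
    intro k
    have := norm_sq_le_mul_re_inner hA hu (unitVec k)
    rwa [norm_unitVec, one_pow] at this
  have h0 : 0 < ‖Ring.inverse A‖ := by
    obtain ⟨k⟩ := (inferInstance : Nonempty S)
    refine (norm_nonneg _).lt_of_ne fun h => ?_
    have := h1 k
    rw [← h, zero_mul] at this
    exact absurd this (by norm_num)
  refine ht (top_unique ?_)
  rw [← ENNReal.tsum_const_eq_top_of_ne_zero (α := S) (c := ENNReal.ofReal ‖Ring.inverse A‖⁻¹)
    (by simpa using h0)]
  refine ENNReal.tsum_le_tsum fun k => ENNReal.ofReal_le_ofReal ?_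
  rw [inv_le_iff_one_le_mul₀ h0, mul_comm]
  exact h1 k

theorem IsSpectralDensity.finite {d τ : ℕ} (hτ : 0 < τ) {f : ℝ → Op S}
    (hf : IsSpectralDensity d τ f) (hm : Minimality d τ f) : Finite S := by
  have hmeas : AEMeasurable (fun x => ENNReal.ofReal (weight d τ x) * posTrace (f x)) circ := by
    refine (measurable_weight d τ).ennreal_ofReal.aemeasurable.mul ?_
    unfold posTrace
    exact AEMeasurable.tsum fun k =>
      (Complex.measurable_re.comp_aemeasurable (hf.measurable k k)).ennreal_ofReal
  have h1 := ae_lt_top' hmeas hf.kernel.ne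
  obtain ⟨x, h2, h3, h4, h5⟩ := ae_exists (h1.and (hf.positive.and (hm.1.and
    (ae_weight_pos (d := d) hτ))))
  refine finite_of_posTrace_lt_top h3 h4 fun h => ?_
  rw [h, ENNReal.mul_top (by simpa using h5)] at h2
  exact lt_irrefl _ h2

end Vec

/-! ### Translation between estimation errors, prediction errors and the operator F -/

section Bridge

variable {S : Set ℕ+} {d τ : ℕ}

theorem bSymbol_eq_expSum (b : ℕ → Vec S) : bSymbol b = expSum b := by
  ext1 x
  unfold bSymbol expSum character
  simp

theorem specNormSq_eq_weightedNormSq (f : ℝ → Op S) (g : ℝ → Vec S) :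
    specNormSq f g = weightedNormSq f g := rfl

theorem weightedNormSq_congr {F : Type*} [NormedAddCommGroup F] [InnerProductSpace ℂ F]
    {W W' : ℝ → F →L[ℂ] F} {g g' : ℝ → F} (hW : W =ᵐ[circ] W') (hg : g =ᵐ[circ] g') :
    weightedNormSq W g = weightedNormSq W' g' := by
  unfold weightedNormSq
  congr 1
  refine lintegral_congr_ae ?_
  filter_upwards [hW, hg] with x h1 h2
  simp only [h1, h2]

/-- The squared modulus of the factor `incr` is the weight, so the factor can be moved from the
function into the density. -/
theorem specNormSq_incr_smul (f : ℝ → Op S) (u : ℝ → Vec S) :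
    specNormSq f (fun x => incr d τ x • u x) = weightedNormSq (weighted d τ f) u := by
  unfold specNormSq weightedNormSq
  congr 1
  refine lintegral_congr fun x => ?_
  congr 2
  rw [weighted, _root_.smul_apply, map_smul, inner_smul_left, inner_smul_right, inner_smul_right,
    ← mul_assoc, ← norm_incr_sq, ← Complex.normSq_eq_conj_mul_self, Complex.normSq_eq_norm_sq]

theorem incr_smul_mem_pastSpan [Finite S] {p : ℝ → Vec S} (hp : p ∈ pastPoly (Vec S)) :
    (fun x => incr d τ x • p x) ∈ pastSpan S d τ := by
  have := Fintype.ofFinite S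
  induction hp using Submodule.span_induction with
  | mem g hg =>
    obtain ⟨n, v, hn, rfl⟩ := hg
    have h1 : (fun x => incr d τ x • character n x • v) = ∑ k : S, (inner ℂ (unitVec k) v : ℂ) •
        fun x : ℝ => (exp (I * x * n) * incr d τ x) • unitVec k := by
      ext1 x
      have h2 := (unitBasis S).sum_repr' v
      simp only [unitBasis_apply] at h2
      conv_lhs => rw [← h2]
      simp only [Finset.sum_apply, Pi.smul_apply, Finset.smul_sum, smul_smul]
      refine Finset.sum_congr rfl fun k _ => ?_
      congr 1
      unfold character
      rw [mul_right_comm I]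
      ring
    rw [h1]
    exact Submodule.sum_mem _ fun k _ => Submodule.smul_mem _ _
      (Submodule.subset_span ⟨n, k, by omega, rfl⟩)
  | zero =>
    simp only [Pi.zero_apply, smul_zero]
    exact zero_mem _
  | add p q _ _ ihp ihq =>
    have := add_mem ihp ihq
    refine (congrArg (· ∈ pastSpan S d τ) ?_).mp this
    ext1 x
    simp [smul_add]
  | smul c p _ ih =>
    have := Submodule.smul_mem _ c ih
    refine (congrArg (· ∈ pastSpan S d τ) ?_).mp this
    ext1 x
    simp [smul_comm c]

theorem exists_of_mem_pastSpan {p : ℝ → Vec S} (hp : p ∈ pastSpan S d τ) :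
    ∃ q ∈ pastPoly (Vec S), p = fun x => incr d τ x • q x := by
  induction hp using Submodule.span_induction with
  | mem g hg =>
    obtain ⟨n, k, hn, rfl⟩ := hg
    refine ⟨_, Submodule.subset_span ⟨n, unitVec k, by omega, rfl⟩, ?_⟩
    ext1 x
    rw [smul_smul]
    congr 1
    unfold character
    rw [mul_right_comm I]
    ring
  | zero => exact ⟨0, zero_mem _, by ext1 x; simp⟩
  | add p q _ _ ihp ihq =>
    obtain ⟨p', hp', rfl⟩ := ihp
    obtain ⟨q', hq', rfl⟩ := ihq
    exact ⟨p' + q', add_mem hp' hq', by ext1 x; simp [smul_add]⟩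
  | smul c p _ ih =>
    obtain ⟨p', hp', rfl⟩ := ih
    exact ⟨c • p', Submodule.smul_mem _ c hp', by ext1 x; simp [smul_comm c]⟩

theorem ae_incr_ne_zero (hτ : 0 < τ) : ∀ᵐ x ∂circ, incr d τ x ≠ 0 := by
  filter_upwards [ae_weight_pos (d := d) hτ] with x hx h
  rw [← norm_incr_sq, h] at hx
  simp at hx

/-- Approximability by polynomials with negative frequencies. -/
def IsPast {F : Type*} [NormedAddCommGroup F] [InnerProductSpace ℂ F] (W : ℝ → F →L[ℂ] F)
    (u : ℝ → F) : Prop :=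
  AEStronglyMeasurable u circ ∧
    ∀ ε : ENNReal, 0 < ε → ∃ p ∈ pastPoly F, weightedNormSq W (u - p) < ε

theorem IsPast.mem_pastSpace [Finite S] {f : ℝ → Op S} {u : ℝ → Vec S}
    (hu : IsPast (weighted d τ f) u) {h : ℝ → Vec S}
    (hh : h =ᵐ[circ] fun x => incr d τ x • u x) : h ∈ pastSpace d τ f := by
  refine ⟨((measurable_incr d τ).aestronglyMeasurable.smul hu.1).congr hh.symm, fun ε hε => ?_⟩
  obtain ⟨p, hp, hlt⟩ := hu.2 ε hε
  refine ⟨_, incr_smul_mem_pastSpan hp, lt_of_le_of_lt (le_of_eq ?_) hlt⟩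
  rw [← specNormSq_incr_smul, specNormSq_eq_weightedNormSq, specNormSq_eq_weightedNormSq]
  refine weightedNormSq_congr (Filter.EventuallyEq.refl _ _) ?_
  filter_upwards [hh] with x hx
  simp [hx, smul_sub]

theorem exists_of_mem_pastSpace (hτ : 0 < τ) {f : ℝ → Op S} {h : ℝ → Vec S}
    (hh : h ∈ pastSpace d τ f) :
    ∃ u, IsPast (weighted d τ f) u ∧ h =ᵐ[circ] fun x => incr d τ x • u x := by
  have he : h =ᵐ[circ] fun x => incr d τ x • (incr d τ x)⁻¹ • h x := by
    filter_upwards [ae_incr_ne_zero (d := d) hτ] with x hx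
    rw [smul_smul, mul_inv_cancel₀ hx, one_smul]
  refine ⟨fun x => (incr d τ x)⁻¹ • h x,
    ⟨(measurable_incr d τ).inv.aestronglyMeasurable.smul hh.1, fun ε hε => ?_⟩, he⟩
  obtain ⟨p, hp, hlt⟩ := hh.2 ε hε
  obtain ⟨q, hq, rfl⟩ := exists_of_mem_pastSpan hp
  refine ⟨q, hq, lt_of_le_of_lt (le_of_eq ?_) hlt⟩
  rw [← specNormSq_incr_smul, specNormSq_eq_weightedNormSq, specNormSq_eq_weightedNormSq]
  refine weightedNormSq_congr (Filter.EventuallyEq.refl _ _) ?_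
  filter_upwards [he] with x hx
  rw [Pi.sub_apply, Pi.sub_apply, smul_sub, ← hx]

theorem mse_congr (b : ℕ → Vec S) {h : ℝ → Vec S} {u : ℝ → Vec S} (f : ℝ → Op S)
    (hh : h =ᵐ[circ] fun x => incr d τ x • u x) :
    mse d τ b h f = weightedNormSq (weighted d τ f) (expSum b - u) := by
  unfold mse
  rw [← specNormSq_incr_smul, specNormSq_eq_weightedNormSq, specNormSq_eq_weightedNormSq]
  refine weightedNormSq_congr (Filter.EventuallyEq.refl _ _) ?_
  filter_upwards [hh] with x hx
  rw [hx, bSymbol_eq_expSum, Pi.sub_apply, smul_sub]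

variable [Finite S]

omit [Finite S] in
theorem IsPredictionError.isPast {b : ℕ → Vec S} {W : ℝ → Op S} {R : ℝ → Vec S}
    (hR : IsPredictionError W b R) (hb : Summable fun j => ‖b j‖) :
    IsPast W (expSum b - R) :=
  ⟨(continuous_expSum hb).aestronglyMeasurable.sub hR.memLp.aestronglyMeasurable, hR.approx⟩

theorem IsPredictionError.optMse_eq (hτ : 0 < τ) {b : ℕ → Vec S} {f : ℝ → Op S} {R : ℝ → Vec S}
    (hR : IsPredictionError (weighted d τ f) b R) (hb : Summable fun j => ‖b j‖) :
    optMse d τ b f = weightedNormSq (weighted d τ f) R := by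
  refine le_antisymm ?_ ?_
  · refine (iInf₂_le _ ((hR.isPast hb).mem_pastSpace (d := d) (τ := τ)
      (Filter.EventuallyEq.refl _ _))).trans (le_of_eq ?_)
    rw [mse_congr b f (Filter.EventuallyEq.refl _ _), sub_sub_cancel]
  · refine le_iInf₂ fun h hh => ?_
    obtain ⟨u, hu, he⟩ := exists_of_mem_pastSpace hτ hh
    rw [mse_congr b f he, hR.pythagoras u hu.1 hu.2]
    exact le_self_add

omit [Finite S] in
theorem IsPredictionError.isSymbol {b : ℕ → Vec S} {W : ℝ → Op S} {R : ℝ → Vec S}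
    (hR : IsPredictionError W b R) :
    IsSymbol (fun j : ℕ => fourierC (fun x => W x (R x)) j) fun x => W x (R x) :=
  ⟨hR.memLp_weight, fun j => coef_eq_fourierC _ _, fun n hn => by
    rw [coef_eq_fourierC]; exact hR.analytic n hn⟩

theorem inverse_apply_apply {F : Type*} [NormedAddCommGroup F] [NormedSpace ℂ F]
    {A : F →L[ℂ] F} (hA : IsUnit A) (v : F) : Ring.inverse A (A v) = v :=
  congrArg (fun B : F →L[ℂ] F => B v) (Ring.inverse_mul_cancel A hA)

omit [Finite S] in
theorem ae_invDensity_eq (hτ : 0 < τ) {f : ℝ → Op S} (hm : Minimality d τ f) :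
    invDensity d τ f =ᵐ[circ] fun x => Ring.inverse (weighted d τ f x) := by
  filter_upwards [ae_weight_pos (d := d) hτ, hm.1] with x h1 h2 using invDensity_eq h1 h2

omit [Finite S] in
-- With C = WR the product W^{-1} C is R, whose coefficients with numbers l ≥ 0 are b_l.
theorem IsPredictionError.fMaps (hτ : 0 < τ) {b : ℕ → Vec S} {f : ℝ → Op S} {R : ℝ → Vec S}
    (hm : Minimality d τ f) (hW : IsRegularWeight (weighted d τ f))
    (hR : IsPredictionError (weighted d τ f) b R) :
    FMaps d τ f (fun j : ℕ => fourierC (fun x => weighted d τ f x (R x)) j) b := by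
  have h1 : (fun x => invDensity d τ f x (weighted d τ f x (R x))) =ᵐ[circ] R := by
    filter_upwards [ae_invDensity_eq hτ hm, hW.isUnit] with x h1 h2
    rw [h1, inverse_apply_apply h2]
  refine ⟨_, hR.isSymbol, (hR.memLp.integrable (by norm_num)).congr h1.symm, fun l => ?_⟩
  rw [coef_eq_fourierC, fourierC_congr h1, hR.coeff]

theorem IsSymbol.ae_eq {c : ℕ → Vec S} {C C' : ℝ → Vec S} (hC : IsSymbol c C)
    (hC' : IsSymbol c C') : C =ᵐ[circ] C' := by
  have h1 := hC.1.integrable (by norm_num)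
  have h2 := hC'.1.integrable (by norm_num)
  have h := ae_eq_zero_of_fourierC_eq_zero' (h1.sub h2) fun n => ?_
  · filter_upwards [h] with x hx using sub_eq_zero.1 hx
  · refine (fourierC_sub h1 h2 n).trans ?_
    rw [← coef_eq_fourierC, ← coef_eq_fourierC]
    rcases lt_or_ge n 0 with hn | hn
    · rw [hC.2.2 n hn, hC'.2.2 n hn, sub_zero]
    · lift n to ℕ using hn
      rw [hC.2.1, hC'.2.1, sub_self]

/-- The difference C - C' is analytic, its product with W^{-1} has no coefficients with numbers n ≥
0, and their inner product is nonnegative, hence zero; definiteness of W^{-1} finishes. The product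
is only integrable, so the L_2 orthogonality of the two factors is not available directly. -/
theorem FMaps.unique (hτ : 0 < τ) {b c c' : ℕ → Vec S} {f : ℝ → Op S}
    (hm : Minimality d τ f) (hW : IsRegularWeight (weighted d τ f))
    (h : FMaps d τ f c b) (h' : FMaps d τ f c' b) : c = c' := by
  obtain ⟨C, hC, hi, hb⟩ := h
  obtain ⟨C', hC', hi', hb'⟩ := h'
  have h1 := hC.1.integrable (by norm_num)
  have h2 := hC'.1.integrable (by norm_num)
  have hpos : ∀ᵐ x ∂circ, (invDensity d τ f x).IsPositive := by
    filter_upwards [ae_invDensity_eq hτ hm, hW.isUnit, hW.positive] with x h1 h2 h3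
    rw [h1]; exact isPositive_inverse h3 h2
  have hun : ∀ᵐ x ∂circ, IsUnit (invDensity d τ f x) := by
    filter_upwards [ae_invDensity_eq hτ hm, hW.isUnit] with x h1 h2
    rw [h1]; exact h2.ringInverse
  have key := re_inner_eq_zero_of_analytic
    (Z := fun x => invDensity d τ f x (C x) - invDensity d τ f x (C' x)) (C := C - C')
    (hi.sub hi') (hC.1.sub hC'.1) (fun n hn => ?_) (fun n hn => ?_) ?_ ?_
  · have he : C =ᵐ[circ] C' := by
      filter_upwards [key, hpos, hun] with x hx h3 h4
      have h5 := norm_sq_le_mul_re_inner h3 h4 ((C - C') x)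
      rw [Pi.sub_apply, map_sub] at h5
      rw [Pi.sub_apply] at hx
      rw [hx, mul_zero] at h5
      have h6 : ‖C x - C' x‖ = 0 := by
        have := sq_nonneg ‖C x - C' x‖
        exact pow_eq_zero_iff (two_ne_zero) |>.1 (le_antisymm h5 this)
      exact sub_eq_zero.1 (norm_eq_zero.1 h6)
    ext1 j
    rw [← hC.2.1, ← hC'.2.1, coef_eq_fourierC, coef_eq_fourierC, fourierC_congr he]
  · lift n to ℕ using hn
    rw [fourierC_sub hi hi', ← coef_eq_fourierC, ← coef_eq_fourierC, hb, hb', sub_self]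
  · refine (fourierC_sub h1 h2 n).trans ?_
    rw [← coef_eq_fourierC, ← coef_eq_fourierC, hC.2.2 n hn, hC'.2.2 n hn, sub_zero]
  · filter_upwards [hpos] with x hx
    rw [← map_sub]
    exact re_inner_apply_nonneg hx _
  · filter_upwards [hpos] with x hx
    rw [← map_sub]
    exact hx.isSymmetric.im_inner_self_apply _

omit [Finite S] in
theorem IsPredictionError.pairing_eq {b : ℕ → Vec S} {W : ℝ → Op S} {R : ℝ → Vec S}
    (hR : IsPredictionError W b R) : weightedNormSq W R =
      ENNReal.ofReal (pairing b fun j : ℕ => fourierC (fun x => W x (R x)) j) :=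
  hR.energy

end Bridge

theorem IsPredictionError.congr_weight {F : Type*} [NormedAddCommGroup F] [InnerProductSpace ℂ F]
    [CompleteSpace F] [FiniteDimensional ℂ F] {W W' : ℝ → F →L[ℂ] F} {b : ℕ → F} {R : ℝ → F}
    (hR : IsPredictionError W b R) (h : W =ᵐ[circ] W') : IsPredictionError W' b R := by
  have h1 : (fun x => W x (R x)) =ᵐ[circ] fun x => W' x (R x) := by
    filter_upwards [h] with x hx using by rw [hx]
  have h2 : ∀ g : ℝ → F, weightedNormSq W' g = weightedNormSq W g := fun g =>
    weightedNormSq_congr h.symm (Filter.EventuallyEq.refl _ _)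
  have h3 : fourierC (fun x => W' x (R x)) = fourierC fun x => W x (R x) :=
    (fourierC_congr h1).symm
  obtain ⟨M, hM⟩ := hR.bounded
  refine ⟨hR.memLp, ⟨M, ?_⟩, hR.memLp_weight.ae_eq h1, ?_, hR.coeff, ?_, ?_, ?_, ?_⟩
  · filter_upwards [hM, h] with x h4 h5
    rwa [← h5]
  · rw [h3]; exact hR.analytic
  · simp only [h2]; exact hR.approx
  · simp only [h2]; exact hR.pythagoras
  · rw [h3]; exact hR.energy_nonneg
  · rw [h3, h2]; exact hR.energy

theorem ae_eq_zero_of_weightedNormSq_eq_zero {F : Type*} [NormedAddCommGroup F]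
    [InnerProductSpace ℂ F] [CompleteSpace F] [FiniteDimensional ℂ F] {W : ℝ → F →L[ℂ] F}
    (hW : IsRegularWeight W) {g : ℝ → F} (hg : AEStronglyMeasurable g circ)
    (h : weightedNormSq W g = 0) : g =ᵐ[circ] 0 := by
  unfold weightedNormSq at h
  rw [mul_eq_zero, lintegral_eq_zero_iff' (aestronglyMeasurable_re_inner
    hW.integrable.aestronglyMeasurable hg).aemeasurable.ennreal_ofReal] at h
  have h1 := h.resolve_left (by simp [Real.pi_pos])
  filter_upwards [h1, hW.positive, hW.isUnit] with x h2 h3 h4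
  have h5 := norm_sq_le_mul_re_inner h3 h4 (g x)
  have h6 : (inner ℂ (g x) (W x (g x)) : ℂ).re ≤ 0 := ENNReal.ofReal_eq_zero.1 h2
  have h7 : ‖g x‖ ^ 2 ≤ 0 := h5.trans (mul_nonpos_of_nonneg_of_nonpos (norm_nonneg _) h6)
  exact norm_eq_zero.1 (pow_eq_zero_iff two_ne_zero |>.1 (le_antisymm h7 (sq_nonneg _)))

/-- (Wr)(Wr)^* = W (r r^*) W, and the invertible outer factors cancel. -/
theorem rankOne_eq_comp_iff {F : Type*} [NormedAddCommGroup F] [InnerProductSpace ℂ F]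
    [CompleteSpace F] {W : F →L[ℂ] F} (hW : IsSelfAdjoint W) (hu : IsUnit W) (r : F)
    (A : F →L[ℂ] F) :
    InnerProductSpace.rankOne ℂ (W r) (W r) = W ∘L A ∘L W ↔
      InnerProductSpace.rankOne ℂ r r = A := by
  have h1 : InnerProductSpace.rankOne ℂ (W r) (W r) =
      W * (InnerProductSpace.rankOne ℂ r r * W) := by
    have hW' : ContinuousLinearMap.adjoint W = W := hW
    rw [ContinuousLinearMap.mul_def, ContinuousLinearMap.mul_def,
      InnerProductSpace.rankOne_comp, InnerProductSpace.comp_rankOne, hW']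
  rw [h1, ← ContinuousLinearMap.mul_def, ← ContinuousLinearMap.mul_def,
    hu.mul_right_inj, hu.mul_left_inj]

/-! ### Saddle point and variational argument for classes given by moments -/

section Moment

variable {S : Set ℕ+} [Finite S] {d τ : ℕ} {b : ℕ → Vec S} {f₀ : ℝ → Op S} {R : ℝ → Vec S}

/-- When R R^* is constant the error depends on f only through ∫ w f, and only through its pairing
with A. -/
theorem weightedNormSq_eq_tracePairing {A : Op S}
    (hA : ∀ᵐ x ∂circ, InnerProductSpace.rankOne ℂ (R x) (R x) = A) {f : ℝ → Op S}
    (hf : IsSpectralDensity d τ f) :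
    weightedNormSq (weighted d τ f) R =
      ENNReal.ofReal (1 / (2 * Real.pi) * tracePairing A (∫ x, weighted d τ f x ∂circ)) := by
  have hi := hf.integrable_weighted
  have h1 : (fun x => (inner ℂ (R x) (weighted d τ f x (R x)) : ℂ).re) =ᵐ[circ]
      fun x => tracePairing A (weighted d τ f x) := by
    filter_upwards [hA] with x hx
    rw [← tracePairing_rankOne, hx]
  have h2 : ∫ x, tracePairing A (weighted d τ f x) ∂circ =
      tracePairing A (∫ x, weighted d τ f x ∂circ) := (tracePairing A).integral_comp_comm hi
  rw [weightedNormSq_eq_ofReal (isPositive_weighted hf.positive)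
    (((tracePairing A).integrable_comp hi).congr h1.symm), integral_congr_ae h1, h2]

/-- ‖R‖² = ‖A‖ makes B - R bounded, and its coefficients with numbers ≥ 0 vanish; so it is in the
past of every spectral density, minimal or not. -/
theorem isPast_of_rankOne_eq (hR : MemLp R 2 circ) (hRb : ∀ l : ℕ, fourierC R l = b l)
    (hb : Summable fun j => ‖b j‖) {A : Op S}
    (hA : ∀ᵐ x ∂circ, InnerProductSpace.rankOne ℂ (R x) (R x) = A) {f : ℝ → Op S}
    (hf : IsSpectralDensity d τ f) : IsPast (weighted d τ f) (expSum b - R) := by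
  have hm : AEStronglyMeasurable (expSum b - R) circ :=
    (continuous_expSum hb).aestronglyMeasurable.sub hR.aestronglyMeasurable
  refine ⟨hm, fun ε hε => exists_pastPoly_lt_of_bounded hf.integrable_weighted hm
    (M := (∑' j, ‖b j‖) + Real.sqrt ‖A‖) ?_ (fun n hn => ?_) hε⟩
  · filter_upwards [hA] with x hx
    refine (norm_sub_le _ _).trans (add_le_add (norm_expSum_le hb x) ?_)
    refine Real.le_sqrt_of_sq_le (le_of_eq ?_)
    rw [← hx, InnerProductSpace.norm_rankOne, sq]
  · lift n to ℕ using hn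
    have h1 : Integrable (expSum b) circ := Integrable.of_bound
      (continuous_expSum hb).aestronglyMeasurable _
      (Filter.Eventually.of_forall (norm_expSum_le hb))
    refine (fourierC_sub h1 (hR.integrable (by norm_num)) n).trans ?_
    rw [fourierC_expSum hb, hRb, sub_self]

omit [Finite S] in
-- The coefficient of f₀^{-1} C is the inverse of the conjugate of `incr`; multiplied by w, the
-- squared modulus of `incr`, it becomes `incr` itself.
theorem specChar_ae_eq (hτ : 0 < τ) (hm : Minimality d τ f₀) {C : ℝ → Vec S}
    (hC : C =ᵐ[circ] fun x => weighted d τ f₀ x (R x)) :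
    specChar d τ b f₀ C =ᵐ[circ] fun x => incr d τ x • (expSum b - R) x := by
  filter_upwards [hC, hm.1, ae_weight_pos (d := d) hτ] with x h1 h2 h3
  unfold specChar
  have h4 : incr d τ x ≠ 0 := fun h => by
    rw [← norm_incr_sq, h] at h3
    simp at h3
  have h5 : (starRingEnd ℂ) (incr d τ x) ≠ 0 := (map_ne_zero _).2 h4
  rw [h1, weighted, _root_.smul_apply, map_smul, inverse_apply_apply h2, smul_smul,
    bSymbol_eq_expSum, Pi.sub_apply, smul_sub, ← inv_div ((1 - exp (I * x * τ)) ^ d), ← conj_incr,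
    ← norm_incr_sq, ← Complex.normSq_eq_norm_sq, Complex.normSq_eq_conj_mul_self,
    inv_mul_cancel_left₀ h5]

variable {D V : Set (Op S)}

omit [Finite S] in
/-- The equation for the multipliers in terms of the prediction error. -/
theorem multiplierEq_iff (hW : IsRegularWeight (weighted d τ f₀)) {C : ℝ → Vec S}
    (hC : C =ᵐ[circ] fun x => weighted d τ f₀ x (R x)) (A : Op S) :
    MultiplierEq d τ f₀ C A ↔ ∀ᵐ x ∂circ, InnerProductSpace.rankOne ℂ (R x) (R x) = A := by
  unfold MultiplierEq
  constructor
  · intro h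
    filter_upwards [h, hC, hW.positive, hW.isUnit] with x h1 h2 h3 h4
    rw [h2] at h1
    exact (rankOne_eq_comp_iff h3.isSelfAdjoint h4 _ _).1 h1
  · intro h
    filter_upwards [h, hC, hW.positive, hW.isUnit] with x h1 h2 h3 h4
    rw [h2]
    exact (rankOne_eq_comp_iff h3.isSelfAdjoint h4 _ _).2 h1

/-- The class of densities for which the pairings of the integral with the operators of `V` are
the same as for `f₀`. -/
def momentClass (d τ : ℕ) (V : Set (Op S)) (f₀ : ℝ → Op S) : Set (ℝ → Op S) :=
  {f | IsSpectralDensity d τ f ∧ ∀ B ∈ V, tracePairing B (∫ x, weighted d τ f x ∂circ) =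
    tracePairing B (∫ x, weighted d τ f₀ x ∂circ)}

/-- The optimal estimate for f₀ is admissible for every f of the class with the same error, which
bounds the optimal error at f from above. -/
theorem IsLeastFavorable.of_rankOne_eq (hτ : 0 < τ) (hf₀ : IsSpectralDensity d τ f₀)
    (hR : IsPredictionError (weighted d τ f₀) b R) (hb : Summable fun j => ‖b j‖) {A : Op S}
    (hAV : A ∈ V) (hA : ∀ᵐ x ∂circ, InnerProductSpace.rankOne ℂ (R x) (R x) = A) :
    IsLeastFavorable d τ b (momentClass d τ V f₀) f₀ := by
  refine ⟨⟨hf₀, fun B _ => rfl⟩, fun f hf => ?_⟩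
  have h1 := (isPast_of_rankOne_eq hR.memLp hR.coeff hb hA hf.1).mem_pastSpace (d := d) (τ := τ)
    (Filter.EventuallyEq.refl _ _)
  refine (iInf₂_le _ h1).trans (le_of_eq ?_)
  rw [mse_congr b f (Filter.EventuallyEq.refl _ _), sub_sub_cancel, hR.optMse_eq hτ hb,
    weightedNormSq_eq_tracePairing hA hf.1, weightedNormSq_eq_tracePairing hA hf₀, hf.2 A hAV]

/-- For minimal densities the optimal error is the pairing ⟨b, F^{-1} b⟩; uniqueness identifies any
given solutions with those coming from the prediction errors. -/
theorem IsLeastFavorable.solvesOptimization (hτ : 0 < τ)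
    (hant : Summable fun j : ℕ => ((j : ℝ) + 1) * ‖b j‖) (hb : Summable fun j => ‖b j‖)
    (hf₀ : IsSpectralDensity d τ f₀) (hm : Minimality d τ f₀) {D : Set (ℝ → Op S)}
    (hD : ∀ f ∈ D, IsSpectralDensity d τ f) (h : IsLeastFavorable d τ b D f₀) :
    SolvesOptimization d τ b D f₀ := by
  refine ⟨h.1, fun f hf hmf c c₀ hc hc₀ => ?_⟩
  have hW := hf₀.isRegularWeight hτ hm
  have hWf := (hD f hf).isRegularWeight hτ hmf
  obtain ⟨R, hR⟩ := hW.exists_isPredictionError hant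
  obtain ⟨Q, hQ⟩ := hWf.exists_isPredictionError hant
  have h1 := h.2 f hf
  have hnn : 0 ≤ pairing b fun j : ℕ => fourierC (fun x => weighted d τ f₀ x (R x)) j :=
    hR.energy_nonneg
  rw [hR.optMse_eq hτ hb, hQ.optMse_eq hτ hb, hR.pairing_eq, hQ.pairing_eq,
    ENNReal.ofReal_le_ofReal_iff hnn, (hR.fMaps hτ hm hW).unique hτ hm hW hc₀,
    (hQ.fMaps hτ hmf hWf).unique hτ hmf hWf hc] at h1
  exact h1

/-- The regular perturbed weights come from minimal densities of the class, so maximality among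
minimal densities already triggers the variational argument. -/
theorem SolvesOptimization.exists_rankOne_eq (hτ : 0 < τ)
    (hant : Summable fun j : ℕ => ((j : ℝ) + 1) * ‖b j‖) (hb : Summable fun j => ‖b j‖)
    (hf₀ : IsSpectralDensity d τ f₀) (hm : Minimality d τ f₀) (hV : ∀ A ∈ V, IsSelfAdjoint A)
    (hproj : ∀ N : Op S, IsSelfAdjoint N → ∃ A ∈ V, ∀ B ∈ V, tracePairing B (N - A) = 0)
    (hR : IsPredictionError (weighted d τ f₀) b R)
    (h : SolvesOptimization d τ b (momentClass d τ V f₀) f₀) :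
    ∃ A ∈ V, ∀ᵐ x ∂circ, InnerProductSpace.rankOne ℂ (R x) (R x) = A := by
  have hW := hf₀.isRegularWeight hτ hm
  refine hW.exists_rankOne_eq hR hb hV hproj fun Ψ hΨi hΨs hΨV t hWt => ?_
  set Wt : ℝ → Op S := fun x => weighted d τ f₀ x + (t : ℂ) • Ψ x with hWt_def
  obtain ⟨Rt, hRt⟩ := hWt.exists_isPredictionError hant
  refine ⟨Rt, hRt, ?_⟩
  have hf := isSpectralDensity_unweighted hτ (d := d) hWt.integrable hWt.positive
  have hmf := minimality_unweighted (d := d) hτ hWt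
  have hae := weighted_unweighted (d := d) hτ Wt
  have hRt' := hRt.congr_weight hae.symm
  have hmem : unweighted d τ Wt ∈ momentClass d τ V f₀ := by
    refine ⟨hf, fun B hB => ?_⟩
    have hI : ∫ x, Wt x ∂circ = (∫ x, weighted d τ f₀ x ∂circ) + (t : ℂ) • ∫ x, Ψ x ∂circ := by
      rw [← integral_smul]
      exact integral_add hW.integrable (hΨi.smul (t : ℂ))
    have h0 : tracePairing B (∫ x, Ψ x ∂circ) = 0 := hΨV B hB
    rw [integral_congr_ae hae, hI, map_add, tracePairing_smul_self, h0, mul_zero, add_zero]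
  have h1 := h.2 _ hmem hmf _ _ (hRt'.fMaps hτ hmf (hf.isRegularWeight hτ hmf))
    (hR.fMaps hτ hm hW)
  rw [weightedNormSq_congr hae.symm (Filter.EventuallyEq.refl _ _), hRt'.pairing_eq,
    hR.pairing_eq]
  exact ENNReal.ofReal_le_ofReal h1

/-- The error of B - R is constant over the class, while at f₀ every other admissible function pays
the additional squared distance to B - R. A robust one therefore has zero distance, and the weight
is definite a.e. -/
theorem isMinimaxRobust_iff_of_rankOne_eq (hτ : 0 < τ) (hf₀ : IsSpectralDensity d τ f₀)
    (hm : Minimality d τ f₀) (hR : IsPredictionError (weighted d τ f₀) b R)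
    (hb : Summable fun j => ‖b j‖) {A : Op S} (hAV : A ∈ V)
    (hA : ∀ᵐ x ∂circ, InnerProductSpace.rankOne ℂ (R x) (R x) = A) (h : ℝ → Vec S) :
    IsMinimaxRobust d τ b (momentClass d τ V f₀) h ↔
      h =ᵐ[circ] fun x => incr d τ x • (expSum b - R) x := by
  have hW := hf₀.isRegularWeight hτ hm
  have hmem₀ : f₀ ∈ momentClass d τ V f₀ := ⟨hf₀, fun B _ => rfl⟩
  have hspace : ∀ h : ℝ → Vec S, (h =ᵐ[circ] fun x => incr d τ x • (expSum b - R) x) →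
      h ∈ robustSpace d τ (momentClass d τ V f₀) := fun h he =>
    mem_iInter₂.2 fun f hf =>
      (isPast_of_rankOne_eq hR.memLp hR.coeff hb hA hf.1).mem_pastSpace he
  have hsup : ∀ h : ℝ → Vec S, (h =ᵐ[circ] fun x => incr d τ x • (expSum b - R) x) →
      (⨆ f ∈ momentClass d τ V f₀, mse d τ b h f) ≤ weightedNormSq (weighted d τ f₀) R := by
    refine fun h he => iSup₂_le fun f hf => le_of_eq ?_
    rw [mse_congr b f he, sub_sub_cancel, weightedNormSq_eq_tracePairing hA hf.1,
      weightedNormSq_eq_tracePairing hA hf₀, hf.2 A hAV]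
  have hle : ∀ h : ℝ → Vec S, mse d τ b h f₀ ≤ ⨆ f ∈ momentClass d τ V f₀, mse d τ b h f :=
    fun h => le_iSup₂ (f := fun f _ => mse d τ b h f) f₀ hmem₀
  constructor
  · intro hh
    obtain ⟨u, hu, he⟩ := exists_of_mem_pastSpace hτ (mem_iInter₂.1 hh.1 f₀ hmem₀)
    have h1 := ((hle h).trans (hh.2 _ (hspace _ (Filter.EventuallyEq.refl _ _)))).trans
      (hsup _ (Filter.EventuallyEq.refl _ _))
    rw [mse_congr b f₀ he, hR.pythagoras u hu.1 hu.2] at h1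
    have hfin : weightedNormSq (weighted d τ f₀) R ≠ ⊤ := by
      rw [hR.energy]; exact ENNReal.ofReal_ne_top
    have h2 : weightedNormSq (weighted d τ f₀) (expSum b - R - u) = 0 := by
      have : weightedNormSq (weighted d τ f₀) R +
          weightedNormSq (weighted d τ f₀) (expSum b - R - u) ≤
          weightedNormSq (weighted d τ f₀) R + 0 := by rwa [add_zero]
      exact le_zero_iff.1 ((ENNReal.add_le_add_iff_left hfin).1 this)
    have h3 := ae_eq_zero_of_weightedNormSq_eq_zero hW ((hR.isPast hb).1.sub hu.1) h2
    filter_upwards [he, h3] with x h4 h5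
    have h6 : (expSum b - R) x = u x := sub_eq_zero.1 h5
    rw [h4, h6]
  · intro he
    refine ⟨hspace h he, fun h' hh' => (hsup h he).trans (le_trans ?_ (hle h'))⟩
    obtain ⟨u, hu, he'⟩ := exists_of_mem_pastSpace hτ (mem_iInter₂.1 hh' f₀ hmem₀)
    rw [mse_congr b f₀ he', hR.pythagoras u hu.1 hu.2]
    exact le_self_add

/-- Classes determined by moment conditions. -/
theorem determinedBy_of_momentClass (hτ : 0 < τ)
    (hant : Summable fun j : ℕ => ((j : ℝ) + 1) * ‖b j‖)
    (hf₀ : IsSpectralDensity d τ f₀) (hm : Minimality d τ f₀) {c₀ : ℕ → Vec S} {C : ℝ → Vec S}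
    (hc : FMaps d τ f₀ c₀ b) (hC : IsSymbol c₀ C) {D : Set (ℝ → Op S)}
    (hV : ∀ A ∈ V, IsSelfAdjoint A)
    (hproj : ∀ N : Op S, IsSelfAdjoint N → ∃ A ∈ V, ∀ B ∈ V, tracePairing B (N - A) = 0)
    (hD : f₀ ∈ D → D = momentClass d τ V f₀) {E : Prop}
    (hE : ∀ A : Op S, (∃ r, InnerProductSpace.rankOne ℂ r r = A) → A ∈ V →
      MultiplierEq d τ f₀ C A → E)
    (hE' : E → ∃ A ∈ V, MultiplierEq d τ f₀ C A) : DeterminedBy d τ b D f₀ C E := by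
  -- If f₀ is outside the class, both sides of the equivalences are false and the last claim is
  -- vacuous.
  by_cases hmem : f₀ ∈ D
  swap
  · exact ⟨⟨fun h => absurd h.1 hmem, fun h => absurd h.1 hmem⟩,
      ⟨fun h => absurd h.1 hmem, fun h => absurd h.1 hmem⟩, fun h => absurd h.1 hmem⟩
  have hb : Summable fun j => ‖b j‖ :=
    hant.of_nonneg_of_le (fun _ => norm_nonneg _) fun j =>
      le_mul_of_one_le_left (norm_nonneg _) (by linarith [Nat.cast_nonneg (α := ℝ) j])
  have hW := hf₀.isRegularWeight hτ hm
  obtain ⟨R, hR⟩ := hW.exists_isPredictionError hant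
  have hCR : C =ᵐ[circ] fun x => weighted d τ f₀ x (R x) := by
    have := (hR.fMaps hτ hm hW).unique hτ hm hW hc
    exact hC.ae_eq (this ▸ hR.isSymbol)
  have hEiff : E ↔ ∃ A ∈ V, ∀ᵐ x ∂circ, InnerProductSpace.rankOne ℂ (R x) (R x) = A := by
    constructor
    · intro h
      obtain ⟨A, hA, h1⟩ := hE' h
      exact ⟨A, hA, (multiplierEq_iff hW hCR A).1 h1⟩
    · rintro ⟨A, hA, h1⟩
      -- A single point exhibits A as r r^*; positivity of this operator later turns the real
      -- multipliers into squares.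
      obtain ⟨x, hx⟩ := ae_exists h1
      exact hE A ⟨R x, hx⟩ hA ((multiplierEq_iff hW hCR A).2 h1)
  have hD' := hD hmem
  rw [hD'] at hmem ⊢
  have h1 : (∃ A ∈ V, ∀ᵐ x ∂circ, InnerProductSpace.rankOne ℂ (R x) (R x) = A) →
      IsLeastFavorable d τ b (momentClass d τ V f₀) f₀ := by
    rintro ⟨A, hA, h1⟩
    exact .of_rankOne_eq hτ hf₀ hR hb hA h1
  have h2 : IsLeastFavorable d τ b (momentClass d τ V f₀) f₀ →
      SolvesOptimization d τ b (momentClass d τ V f₀) f₀ :=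
    fun h => h.solvesOptimization hτ hant hb hf₀ hm fun f hf => hf.1
  have h3 : SolvesOptimization d τ b (momentClass d τ V f₀) f₀ →
      ∃ A ∈ V, ∀ᵐ x ∂circ, InnerProductSpace.rankOne ℂ (R x) (R x) = A :=
    fun h => h.exists_rankOne_eq hτ hant hb hf₀ hm hV hproj hR
  refine ⟨⟨fun h => ⟨hmem, hEiff.2 (h3 (h2 h))⟩, fun h => h1 (hEiff.1 h.2)⟩,
    ⟨h2, fun h => h1 (h3 h)⟩, fun h h' => ?_⟩
  obtain ⟨A, hA, h4⟩ := h3 (h2 h)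
  rw [isMinimaxRobust_iff_of_rankOne_eq hτ hf₀ hm hR hb hA h4]
  have h5 := specChar_ae_eq (b := b) hτ hm hCR
  exact ⟨fun h6 => h6.trans h5.symm, fun h6 => h6.trans h5⟩

end Moment

/-! ### The four classes as moment classes -/

section Classes

variable {S : Set ℕ+} [Finite S] {d τ : ℕ} {f : ℝ → Op S}

theorem smul_left_tracePairing (c : ℝ) (B M : Op S) :
    tracePairing ((c : ℂ) • B) M = c * tracePairing B M := by
  rw [tracePairing_comm, tracePairing_smul_self, tracePairing_comm]

theorem tracePairing_rankOne_unitVec (k : S) (M : Op S) :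
    tracePairing (InnerProductSpace.rankOne ℂ (unitVec k) (unitVec k)) M = (entry M k k).re :=
  tracePairing_rankOne _ _

/-- Tr(BM) is real for self-adjoint factors, by cyclicity of the trace. The complex constraint thus
carries no more than its real part. -/
theorem conj_trace_mul {B M : Op S} (hB : IsSelfAdjoint B) (hM : IsSelfAdjoint M) :
    (starRingEnd ℂ) (opTrace (B ∘L M)) = opTrace (B ∘L M) := by
  have := Fintype.ofFinite S
  have h1 : opTrace (B ∘L M) = opTrace (M ∘L B) := by
    rw [opTrace_eq_trace, opTrace_eq_trace, ContinuousLinearMap.toLinearMap_comp,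
      LinearMap.trace_comp_comm', ContinuousLinearMap.toLinearMap_comp]
  conv_rhs => rw [h1]
  unfold opTrace entry
  rw [tsum_fintype, tsum_fintype, map_sum]
  refine Finset.sum_congr rfl fun k _ => ?_
  rw [inner_conj_symm]
  exact (ContinuousLinearMap.isSelfAdjoint_iff_isSymmetric.1 hB _ _).trans
    (ContinuousLinearMap.isSelfAdjoint_iff_isSymmetric.1 hM _ _)

theorem opTrace_comp_eq {B M : Op S} (hB : IsSelfAdjoint B) (hM : IsSelfAdjoint M) :
    opTrace (B ∘L M) = tracePairing B M := by
  rw [tracePairing_apply, ← opTrace_eq_trace]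
  exact (Complex.conj_eq_iff_re.1 (conj_trace_mul hB hM)).symm

omit [Finite S] in
theorem entry_eq_re {M : Op S} (hM : IsSelfAdjoint M) (k : S) :
    entry M k k = (entry M k k).re := by
  refine (Complex.conj_eq_iff_re.1 ?_).symm
  unfold entry
  rw [inner_conj_symm]
  exact ContinuousLinearMap.isSelfAdjoint_iff_isSymmetric.1 hM _ _

omit [Finite S] in
theorem entry_smul (c : ℂ) (A : Op S) (k n : S) : entry (c • A) k n = c * entry A k n := by
  unfold entry
  rw [_root_.smul_apply, inner_smul_right]

theorem eq_of_entry {A B : Op S} (h : ∀ k n, entry A k n = entry B k n) : A = B := by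
  have := Fintype.ofFinite S
  rw [eq_sum_entry A, eq_sum_entry B]
  simp only [h]

omit [Finite S] in
theorem isSelfAdjoint_integral_weighted (hf : IsSpectralDensity d τ f) :
    IsSelfAdjoint (∫ x, weighted d τ f x ∂circ) :=
  isSelfAdjoint_integral
    ((isPositive_weighted hf.positive).mono fun _ hx => hx.isSelfAdjoint)

theorem integral_weight_mul_entry (hf : IsSpectralDensity d τ f) (k n : S) :
    ∫ x, (weight d τ x : ℂ) * entry (f x) k n ∂circ =
      entry (∫ x, weighted d τ f x ∂circ) k n := by
  have h1 : ∀ x, (weight d τ x : ℂ) * entry (f x) k n =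
      inner ℂ (unitVec n) (weighted d τ f x (unitVec k)) := fun x => (entry_smul _ _ k n).symm
  simp_rw [h1]
  unfold entry
  rw [ContinuousLinearMap.integral_apply hf.integrable_weighted]
  exact integral_inner (hf.integrable_weighted.apply_continuousLinearMap _) _

theorem integral_weight_mul_opTrace (hf : IsSpectralDensity d τ f) {B : Op S}
    (hB : IsSelfAdjoint B) : ∫ x, (weight d τ x : ℂ) * opTrace (B ∘L f x) ∂circ =
      tracePairing B (∫ x, weighted d τ f x ∂circ) := by
  have h2 : ∫ x, tracePairing B (weighted d τ f x) ∂circ =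
      tracePairing B (∫ x, weighted d τ f x ∂circ) :=
    (tracePairing B).integral_comp_comm hf.integrable_weighted
  rw [← h2, ← integral_complex_ofReal]
  refine integral_congr_ae ?_
  filter_upwards [hf.positive] with x hx
  rw [opTrace_comp_eq hB hx.isSelfAdjoint, weighted, tracePairing_smul_self, ofReal_mul]

theorem two_pi_inv_ne_zero : (1 / (2 * Real.pi) : ℂ) ≠ 0 := by
  simp [Real.pi_ne_zero]

theorem D01_eq_momentClass {P : Op S} {f₀ : ℝ → Op S} (hf₀ : f₀ ∈ D01 d τ P) :
    D01 d τ P = momentClass d τ {A | IsSelfAdjoint A} f₀ := by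
  ext f
  refine and_congr_right fun hf => ?_
  have h1 : (∀ k n, entry (∫ x, weighted d τ f x ∂circ) k n =
      entry (∫ x, weighted d τ f₀ x ∂circ) k n) ↔
      ∀ B ∈ {A : Op S | IsSelfAdjoint A}, tracePairing B (∫ x, weighted d τ f x ∂circ) =
        tracePairing B (∫ x, weighted d τ f₀ x ∂circ) := by
    constructor
    · intro h B _
      rw [eq_of_entry h]
    · intro h k n
      have h2 : IsSelfAdjoint ((∫ x, weighted d τ f x ∂circ) - ∫ x, weighted d τ f₀ x ∂circ) :=
        (isSelfAdjoint_integral_weighted hf).sub (isSelfAdjoint_integral_weighted hf₀.1)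
      -- The difference of the two integrals is self-adjoint, so it may be tested against itself.
      rw [sub_eq_zero.1 (eq_zero_of_tracePairing_self h2
        (by rw [map_sub, sub_eq_zero]; exact h _ h2))]
  rw [← h1]
  refine forall_congr' fun k => forall_congr' fun n => ?_
  rw [← hf₀.2 k n, integral_weight_mul_entry hf, integral_weight_mul_entry hf₀.1]
  exact mul_right_inj' two_pi_inv_ne_zero

theorem D03_eq_momentClass [Fintype S] {p : S → ℝ} {f₀ : ℝ → Op S} (hf₀ : f₀ ∈ D03 d τ p) :
    D03 d τ p = momentClass d τ {A | ∃ c : S → ℝ, A = ∑ k, (c k : ℂ) •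
      InnerProductSpace.rankOne ℂ (unitVec k) (unitVec k)} f₀ := by
  ext f
  refine and_congr_right fun hf => ?_
  have h0 : ∀ (c : S → ℝ) (M : Op S), tracePairing (∑ k, (c k : ℂ) •
      InnerProductSpace.rankOne ℂ (unitVec k) (unitVec k)) M = ∑ k, c k * (entry M k k).re := by
    intro c M
    rw [tracePairing_comm, map_sum]
    refine Finset.sum_congr rfl fun k _ => ?_
    rw [tracePairing_smul_self, tracePairing_comm, tracePairing_rankOne_unitVec]
  have h1 : ∀ k, ((1 / (2 * Real.pi) : ℂ) * ∫ x, (weight d τ x : ℂ) * entry (f x) k k ∂circ = p k ↔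
      (entry (∫ x, weighted d τ f x ∂circ) k k).re =
        (entry (∫ x, weighted d τ f₀ x ∂circ) k k).re) := by
    intro k
    rw [← hf₀.2 k, integral_weight_mul_entry hf, integral_weight_mul_entry hf₀.1,
      mul_right_inj' two_pi_inv_ne_zero, entry_eq_re (isSelfAdjoint_integral_weighted hf),
      entry_eq_re (isSelfAdjoint_integral_weighted hf₀.1), Complex.ofReal_inj]
    simp only [Complex.ofReal_re]
  simp_rw [h1]
  constructor
  · rintro h _ ⟨c, rfl⟩
    rw [h0, h0]
    simp only [h]
  · intro h k
    have := h (InnerProductSpace.rankOne ℂ (unitVec k) (unitVec k))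
      ⟨fun j => if j = k then 1 else 0, by simp [apply_ite]⟩
    rwa [tracePairing_rankOne_unitVec, tracePairing_rankOne_unitVec] at this

theorem D04_eq_momentClass {B₁ : Op S} (hB : IsSelfAdjoint B₁) {p : ℝ} {f₀ : ℝ → Op S}
    (hf₀ : f₀ ∈ D04 d τ B₁ p) :
    D04 d τ B₁ p = momentClass d τ {A | ∃ c : ℝ, A = (c : ℂ) • B₁} f₀ := by
  ext f
  refine and_congr_right fun hf => ?_
  rw [← hf₀.2, integral_weight_mul_opTrace hf hB, integral_weight_mul_opTrace hf₀.1 hB,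
    mul_right_inj' two_pi_inv_ne_zero, Complex.ofReal_inj]
  constructor
  · rintro h _ ⟨c, rfl⟩
    rw [smul_left_tracePairing, smul_left_tracePairing, h]
  · intro h
    exact h B₁ ⟨1, by simp⟩

end Classes

/-! ### Projections onto the multiplier spaces and signs of the multipliers -/

section Determined

variable {S : Set ℕ+} [Finite S] {d τ : ℕ} {b : ℕ → Vec S} {f₀ : ℝ → Op S} {c₀ : ℕ → Vec S}
  {C : ℝ → Vec S}

omit [Finite S] in
theorem isSelfAdjoint_real_smul {A : Op S} (hA : IsSelfAdjoint A) (c : ℝ) :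
    IsSelfAdjoint ((c : ℂ) • A) :=
  IsSelfAdjoint.smul (by simp [IsSelfAdjoint]) hA

theorem determinedBy_D01 (hτ : 0 < τ) (hant : Summable fun j : ℕ => ((j : ℝ) + 1) * ‖b j‖)
    (hf₀ : IsSpectralDensity d τ f₀) (hm : Minimality d τ f₀)
    (hc : FMaps d τ f₀ c₀ b) (hC : IsSymbol c₀ C) (P : Op S) :
    DeterminedBy d τ b (D01 d τ P) f₀ C (Eq1 d τ f₀ C) := by
  refine determinedBy_of_momentClass (V := {A | IsSelfAdjoint A}) hτ hant hf₀ hm hc hC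
    (fun A hA => hA) (fun N hN => ⟨N, hN, fun B _ => by rw [sub_self, map_zero]⟩)
    D01_eq_momentClass ?_ ?_
  · rintro _ ⟨r, rfl⟩ - h
    exact ⟨r, h⟩
  · rintro ⟨α, h⟩
    exact ⟨_, isSelfAdjoint_rankOne α, h⟩

theorem determinedBy_D03 (hτ : 0 < τ) (hant : Summable fun j : ℕ => ((j : ℝ) + 1) * ‖b j‖)
    (hf₀ : IsSpectralDensity d τ f₀) (hm : Minimality d τ f₀)
    (hc : FMaps d τ f₀ c₀ b) (hC : IsSymbol c₀ C) (p : S → ℝ) :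
    DeterminedBy d τ b (D03 d τ p) f₀ C (Eq3 d τ f₀ C) := by
  have := Fintype.ofFinite S
  have happ : ∀ (c : S → ℝ) (j : S), (∑ k, (c k : ℂ) •
      InnerProductSpace.rankOne ℂ (unitVec k) (unitVec k) : Op S) (unitVec j) =
      (c j : ℂ) • unitVec j := by
    intro c j
    have h2 : ∀ k : S, inner ℂ (unitVec k) (unitVec j) = if k = j then (1 : ℂ) else 0 := by
      intro k
      rw [← unitBasis_apply, ← unitBasis_apply]
      exact orthonormal_iff_ite.1 (unitBasis S).orthonormal k j
    simp only [FunLike.coe_sum, Finset.sum_apply, FunLike.coe_smul, Pi.smul_apply,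
      InnerProductSpace.rankOne_apply, h2]
    rw [Finset.sum_eq_single j (fun k _ hk => by simp [hk]) (by simp)]
    simp
  have hentry : ∀ (c : S → ℝ) (j : S), entry (∑ k, (c k : ℂ) •
      InnerProductSpace.rankOne ℂ (unitVec k) (unitVec k) : Op S) j j = c j := by
    intro c j
    unfold entry
    rw [happ, inner_smul_right, inner_self_eq_norm_sq_to_K, norm_unitVec]
    simp
  refine determinedBy_of_momentClass hτ hant hf₀ hm hc hC ?_ ?_ D03_eq_momentClass ?_ ?_
  · rintro _ ⟨c, rfl⟩
    exact sum_mem (S := selfAdjoint (Op S)) fun k _ => isSelfAdjoint_real_smul (isSelfAdjoint_rankOne _) _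
  · intro N hN
    -- The trace-orthogonal projection onto diagonal operators keeps the diagonal.
    refine ⟨_, ⟨fun k => (entry N k k).re, rfl⟩, ?_⟩
    rintro _ ⟨c, rfl⟩
    rw [tracePairing_comm, map_sum]
    refine Finset.sum_eq_zero fun k _ => ?_
    rw [tracePairing_smul_self, tracePairing_comm, map_sub, tracePairing_rankOne_unitVec,
      tracePairing_rankOne_unitVec, hentry, Complex.ofReal_re, sub_self, mul_zero]
  · rintro _ ⟨r, hr⟩ ⟨c, rfl⟩ h
    -- The diagonal operator equals r r^*, so its entries are nonnegative and have real square
    -- roots.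
    have h0 : ∀ k, 0 ≤ c k := by
      intro k
      have h1 := entry_re_nonneg (InnerProductSpace.isPositive_rankOne_self (𝕜 := ℂ) r) k
      rwa [hr, hentry, Complex.ofReal_re] at h1
    refine ⟨fun k => Real.sqrt (c k), _, fun k => ?_, h⟩
    rw [happ, Real.sq_sqrt (h0 k)]
  · rintro ⟨α, A, hA, h⟩
    refine ⟨A, ⟨fun k => α k ^ 2, ?_⟩, h⟩
    apply ContinuousLinearMap.coe_injective
    refine (unitBasis S).toBasis.ext fun j => ?_
    rw [OrthonormalBasis.coe_toBasis, unitBasis_apply, ContinuousLinearMap.coe_coe,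
      ContinuousLinearMap.coe_coe, happ, hA]

theorem determinedBy_D04 (hτ : 0 < τ) (hant : Summable fun j : ℕ => ((j : ℝ) + 1) * ‖b j‖)
    (hf₀ : IsSpectralDensity d τ f₀) (hm : Minimality d τ f₀)
    (hc : FMaps d τ f₀ c₀ b) (hC : IsSymbol c₀ C) {B₁ : Op S} (hB : IsPosDef B₁) (p : ℝ) :
    DeterminedBy d τ b (D04 d τ B₁ p) f₀ C (Eq4 d τ B₁ f₀ C) := by
  have hBs : IsSelfAdjoint B₁ := hB.1.isSelfAdjoint
  refine determinedBy_of_momentClass hτ hant hf₀ hm hc hC ?_ ?_ (D04_eq_momentClass hBs) ?_ ?_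
  · rintro _ ⟨c, rfl⟩
    exact isSelfAdjoint_real_smul hBs c
  · intro N _
    -- Projection onto the real line through B₁. A zero denominator means B₁ = 0, where any
    -- coefficient works.
    refine ⟨_, ⟨tracePairing B₁ N / tracePairing B₁ B₁, rfl⟩, ?_⟩
    rintro _ ⟨c, rfl⟩
    rw [smul_left_tracePairing, map_sub, tracePairing_smul_self]
    rcases eq_or_ne (tracePairing B₁ B₁) 0 with h | h
    · rw [eq_zero_of_tracePairing_self hBs h, tracePairing_comm, map_zero]
      simp
    · rw [div_mul_cancel₀ _ h, sub_self, mul_zero]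
  · rintro _ ⟨r, hr⟩ ⟨c, rfl⟩ h
    -- The sign of c is read off a diagonal entry: it is nonnegative for r r^* = c B₁ and positive
    -- for B₁. With no components all operators coincide.
    rcases isEmpty_or_nonempty S with hS | ⟨⟨k⟩⟩
    · refine ⟨0, ?_⟩
      have : (c : ℂ) • B₁ = (((0 : ℝ) ^ 2 : ℝ) : ℂ) • B₁ := eq_of_entry fun k => hS.elim k
      rwa [← this]
    · have h1 := entry_re_nonneg (InnerProductSpace.isPositive_rankOne_self (𝕜 := ℂ) r) k
      rw [hr, entry_smul, Complex.re_ofReal_mul] at h1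
      have h2 : 0 < (entry B₁ k k).re := hB.2 _ (unitVec_ne_zero k)
      have h3 : 0 ≤ c := nonneg_of_mul_nonneg_left h1 h2
      refine ⟨Real.sqrt c, ?_⟩
      rwa [Real.sq_sqrt h3]
  · rintro ⟨α, h⟩
    exact ⟨_, ⟨α ^ 2, rfl⟩, h⟩

omit [Finite S] in
theorem isPosDef_id : IsPosDef (ContinuousLinearMap.id ℂ (Vec S)) := by
  refine ⟨ContinuousLinearMap.isPositive_one, fun v hv => ?_⟩
  rw [ContinuousLinearMap.id_apply, inner_self_eq_norm_sq_to_K]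
  norm_cast
  exact pow_pos (norm_pos_iff.2 hv) 2

omit [Finite S] in
theorem D02_eq_D04 (p : ℝ) : D02 d τ p = D04 d τ (ContinuousLinearMap.id ℂ (Vec S)) p := by
  unfold D02 D04
  simp only [ContinuousLinearMap.id_comp]

end Determined

end

theorem mainTheorem6 (S : Set ℕ+) (d τ : ℕ) (hτ : 0 < τ) (T : ℝ) (hT : 0 < T)
    (a : ℝ → ℂ) (ha : LocallyIntegrableOn a (Ici 0))
    (hsum : ∀ (k : S) (j : ℕ),
      Summable fun i : ℕ => (stepCoeff d τ i : ℂ) * aCoef T a k (j + i))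
    (b : ℕ → Vec S) (hb : ∀ (j : ℕ) (k : S), b j k = bCoef d τ T a k j)
    (hant : Summable fun j : ℕ => ((j : ℝ) + 1) * ‖b j‖)
    (f₀ : ℝ → Op S) (hf₀ : IsSpectralDensity d τ f₀) (hmin : Minimality d τ f₀) :
    (∃! c₀ : ℕ → Vec S, FMaps d τ f₀ c₀ b) ∧
    ∀ (c₀ : ℕ → Vec S) (C : ℝ → Vec S), FMaps d τ f₀ c₀ b → IsSymbol c₀ C →
      (∀ P : Op S, IsPosDef P →
        DeterminedBy d τ b (D01 d τ P) f₀ C (Eq1 d τ f₀ C)) ∧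
      (∀ p : ℝ, DeterminedBy d τ b (D02 d τ p) f₀ C (Eq2 d τ f₀ C)) ∧
      (∀ p : S → ℝ, DeterminedBy d τ b (D03 d τ p) f₀ C (Eq3 d τ f₀ C)) ∧
      (∀ (B₁ : Op S) (p : ℝ), IsPosDef B₁ →
        DeterminedBy d τ b (D04 d τ B₁ p) f₀ C (Eq4 d τ B₁ f₀ C)) := by
  -- A trace-class value with a bounded inverse exists only in finite dimension, which unlocks the
  -- finite-dimensional theory.
  have hfin : Finite S := hf₀.finite hτ hmin
  have hW := hf₀.isRegularWeight hτ hmin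
  obtain ⟨R, hR⟩ := hW.exists_isPredictionError hant
  refine ⟨⟨_, hR.fMaps hτ hmin hW, fun c hc => hc.unique hτ hmin hW (hR.fMaps hτ hmin hW)⟩,
    fun c₀ C hc hC => ⟨fun P _ => determinedBy_D01 hτ hant hf₀ hmin hc hC P, fun p => ?_,
      fun p => determinedBy_D03 hτ hant hf₀ hmin hc hC p,
      fun B₁ p hB => determinedBy_D04 hτ hant hf₀ hmin hc hC hB p⟩⟩
  rw [D02_eq_D04]
  exact determinedBy_D04 hτ hant hf₀ hmin hc hC isPosDef_id p
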